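/- Let $c>0$ and $0<k<\sqrt c/2$, and put $$a=k(c-k^2)^{3/2},\quad E=\frac{k^2(c-2k^2)}{2c},\quad \omega_0=-9a^{-2/3},\quad \omega_1=9c\,a^{-4/3}(2E+c).$$ Let $\phi=\phi(\cdot;k)\in C^\infty(\mathbb R)$ be the profile of a smooth solitary wave $u(x,t)=\phi(x-ct)$ of the Novikov equation $u_t-u_{xxt}=u^2u_{xxx}-4u^2u_x+3uu_xu_{xx}$: $\phi$ is nonconstant, $\phi^2<c$ and $\phi-\phi''>0$ on $\mathbb R$, $\phi'(0)=0$, and $\phi(x)\to k$ as $x\to\pm\infty$. Let $\mu=\phi-\phi''$. Let $(1-\partial_x^2)^{-1}$ denote convolution with $\tfrac12e^{-|x|}$, and let $X_k$ be the set of continuous $m:\mathbb R\to(0,\infty)$ with $m-k\in H^1(\mathbb R)$. For $m\in X_k$ define formally $$\mathcal E(m)=\int_{\mathbb R}\big(m(1-\partial_x^2)^{-1}m-k^2\big)dx,\quad F_1(m)=\int_{\mathbb R}\big(m^{2/3}-k^{2/3}\big)dx,$$ $$F_2(m)=\int_{\mathbb R}\big(m^{-8/3}m_x^2+9(m^{-2/3}-k^{-2/3})\big)dx,$$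 and define $$\Lambda(m)=\omega_0\mathcal E(m)+\omega_1F_1(m)+F_2(m),\qquad \mathcal F(m)=\mathcal E(m)-3k^{4/3}F_1(m),$$ where in $\Lambda$ and in $\mathcal F$ the integrands are first combined and then integrated over $\mathbb R$ as an improper integral $\lim_{A,B\to\infty}\int_{-A}^{B}$. Let $$\mathcal M_k=\{m\in X_k:\mathcal F(m)=\mathcal F(\mu)\},\qquad \rho(m_1,m_2)=\inf_{x_0\in\mathbb R}\|m_1-m_2(\cdot-x_0)\|_{H^1},$$ $$\eta=\frac{\delta\mathcal F}{\delta m}(\mu)=2(1-\partial_x^2)^{-1}\mu-2k^{4/3}\mu^{-1/3},$$ and let $\mathcal L$ be the symmetric operator on $L^2(\mathbb R)$ with domain $H^2(\mathbb R)$ given by $$\mathcal Lv=\tfrac23\Big(-3\big(\mu^{-8/3}v'\big)'+8\mu''\mu^{-11/3}v-\tfrac{44}{3}(\mu')^2\mu^{-14/3}v+15\mu^{-8/3}v\Big)-\tfrac{2\omega_1}{9}\mu^{-4/3}v+2\omega_0(1-\partial_x^2)^{-1}v.$$ Assume: (i) the spectrum of $\mathcal L$ on $L^2(\mathbb R)$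 consists of a simple negative eigenvalue, a simple eigenvalue at $0$, and a remaining part that is positive and bounded away from $0$; (ii) (Vakhitov–Kolokolov condition) $\langle\mathcal L^{-1}\eta,\eta\rangle<0$, where $\mathcal L^{-1}\eta$ is any $y\in H^2(\mathbb R)$ with $\mathcal Ly=\eta$ (since $\eta\perp\ker\mathcal L$, the value does not depend on the choice of $y$). Then the improper integrals defining $\Lambda(m)$ and $\mathcal F(m)$ converge for every $m\in X_k$, and there are $\delta>0$ and $C>0$ such that every $m\in\mathcal M_k$ with $\rho(m,\mu)<\delta$ satisfies $$\Lambda(m)-\Lambda(\mu)\ge C\,\rho(m,\mu)^2.$$ -/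

import Mathlib

open MeasureTheory Filter Topology Set
open scoped ContDiff

noncomputable section

namespace Novikov

/-! ### Weak derivatives and Sobolev spaces on the line -/

/-- `g` is the weak (distributional) derivative of `u` on `ℝ`. -/
def IsWeakDeriv (u g : ℝ → ℝ) : Prop :=
  LocallyIntegrable u ∧ LocallyIntegrable g ∧
    ∀ ψ : ℝ → ℝ, ContDiff ℝ ∞ ψ → HasCompactSupport ψ →
      ∫ x, u x * deriv ψ x = - ∫ x, g x * ψ x

open Classical in
/-- A chosen weak derivative of `u` (unique almost everywhere), and `0` if there is none. -/
def weakDeriv (u : ℝ → ℝ) : ℝ → ℝ :=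
  if h : ∃ g, IsWeakDeriv u g then h.choose else 0

/-- `u ∈ H¹(ℝ)`. -/
def MemH1 (u : ℝ → ℝ) : Prop :=
  MemLp u 2 ∧ ∃ g, MemLp g 2 ∧ IsWeakDeriv u g

/-- The `H¹(ℝ)` norm `(‖u‖² + ‖u'‖²)^(1/2)`, with `L²` norms on the right. -/
def h1Norm (u : ℝ → ℝ) : ℝ :=
  Real.sqrt ((∫ x, u x ^ 2) + ∫ x, weakDeriv u x ^ 2)

/-! ### Improper integrals over the line -/

/-- `f` is locally integrable and `∫_{-A}^{B} f` converges as `A, B → ∞` independently. -/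
def ImproperlyIntegrable (f : ℝ → ℝ) : Prop :=
  LocallyIntegrable f ∧
    ∃ I : ℝ, Tendsto (fun p : ℝ × ℝ => ∫ x in (-p.1)..p.2, f x) atTop (𝓝 I)

/-- The improper integral `lim_{A, B → ∞} ∫_{-A}^{B} f`. -/
def improperIntegral (f : ℝ → ℝ) : ℝ :=
  limUnder atTop (fun p : ℝ × ℝ => ∫ x in (-p.1)..p.2, f x)

/-- On integrable functions the improper integral is the Lebesgue integral. -/
theorem improperIntegral_eq_integral {f : ℝ → ℝ} (hf : Integrable f) :
    improperIntegral f = ∫ x, f x := by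
  apply Tendsto.limUnder_eq
  rw [← prod_atTop_atTop_eq]
  exact intervalIntegral_tendsto_integral hf
    (tendsto_neg_atTop_atBot.comp tendsto_fst) tendsto_snd

/-! ### Solitary waves of the Novikov equation -/

/-- `u(x, t)` (space variable first) solves
`u_t - u_xxt = u² u_xxx - 4 u² u_x + 3 u u_x u_xx` pointwise. -/
def IsNovikovSolution (u : ℝ → ℝ → ℝ) : Prop :=
  ∀ x t : ℝ,
    deriv (fun s => u x s) t - deriv (fun s => iteratedDeriv 2 (fun y => u y s) x) t =
      u x t ^ 2 * iteratedDeriv 3 (fun y => u y t) x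
        - 4 * u x t ^ 2 * deriv (fun y => u y t) x
        + 3 * u x t * deriv (fun y => u y t) x * iteratedDeriv 2 (fun y => u y t) x

/-- The momentum density `μ = φ - φ''` of a profile `φ`. -/
def momentum (φ : ℝ → ℝ) (x : ℝ) : ℝ := φ x - iteratedDeriv 2 φ x

/-- `φ` is the profile of a smooth (nonconstant) solitary wave `u(x, t) = φ(x - ct)` of the
Novikov equation with asymptotic value `k`, satisfying `φ² < c`, `φ - φ'' > 0` and `φ'(0) = 0`. -/
structure IsSmoothSolitaryWave (c k : ℝ) (φ : ℝ → ℝ) : Prop where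
  smooth : ContDiff ℝ ∞ φ
  solution : IsNovikovSolution (fun x t => φ (x - c * t))
  sq_lt : ∀ x, φ x ^ 2 < c
  momentum_pos : ∀ x, 0 < momentum φ x
  deriv_zero : deriv φ 0 = 0
  nonconst : ∃ x, φ x ≠ k
  tendsto_atTop : Tendsto φ atTop (𝓝 k)
  tendsto_atBot : Tendsto φ atBot (𝓝 k)

/-! ### The functionals -/

/-- `a = k (c - k²)^{3/2}`. -/
def aPar (c k : ℝ) : ℝ := k * (c - k ^ 2) ^ (3 / 2 : ℝ)

/-- `E = k² (c - 2k²) / (2c)`. -/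
def EPar (c k : ℝ) : ℝ := k ^ 2 * (c - 2 * k ^ 2) / (2 * c)

/-- `ω₀ = -9 a^{-2/3}`. -/
def omega0 (c k : ℝ) : ℝ := -9 * aPar c k ^ (-(2 / 3) : ℝ)

/-- `ω₁ = 9 c a^{-4/3} (2E + c)`. -/
def omega1 (c k : ℝ) : ℝ := 9 * c * aPar c k ^ (-(4 / 3) : ℝ) * (2 * EPar c k + c)

/-- `(1 - ∂ₓ²)⁻¹ m`, the convolution of `m` with the Green's function `e^{-|x|} / 2`. -/
def helmholtzInv (m : ℝ → ℝ) (x : ℝ) : ℝ := ∫ y, Real.exp (-|x - y|) / 2 * m y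

/-- Integrand of `ℰ(m)`. -/
def densE (k : ℝ) (m : ℝ → ℝ) (x : ℝ) : ℝ := m x * helmholtzInv m x - k ^ 2

/-- Integrand of `F₁(m)`. -/
def densF1 (k : ℝ) (m : ℝ → ℝ) (x : ℝ) : ℝ := m x ^ (2 / 3 : ℝ) - k ^ (2 / 3 : ℝ)

/-- Integrand of `F₂(m)`. -/
def densF2 (k : ℝ) (m : ℝ → ℝ) (x : ℝ) : ℝ :=
  m x ^ (-(8 / 3) : ℝ) * weakDeriv m x ^ 2
    + 9 * (m x ^ (-(2 / 3) : ℝ) - k ^ (-(2 / 3) : ℝ))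

/-- Integrand of `Λ = ω₀ ℰ + ω₁ F₁ + F₂`. -/
def densLambda (c k : ℝ) (m : ℝ → ℝ) (x : ℝ) : ℝ :=
  omega0 c k * densE k m x + omega1 c k * densF1 k m x + densF2 k m x

/-- Integrand of `𝓕 = ℰ - 3 k^{4/3} F₁`. -/
def densF (k : ℝ) (m : ℝ → ℝ) (x : ℝ) : ℝ :=
  densE k m x - 3 * k ^ (4 / 3 : ℝ) * densF1 k m x

/-- The action `Λ = ω₀ ℰ + ω₁ F₁ + F₂`. For general `m ∈ X_k` the three integrals need not
converge separately, so the combined integrand is integrated. -/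
def Lambda (c k : ℝ) (m : ℝ → ℝ) : ℝ := improperIntegral (densLambda c k m)

/-- The constraint functional `𝓕 = ℰ - 3 k^{4/3} F₁`, again with the combined integrand. -/
def constraintF (k : ℝ) (m : ℝ → ℝ) : ℝ := improperIntegral (densF k m)

/-- `X_k`: continuous (representatives of) functions `m` with `m - k ∈ H¹(ℝ)` and `m > 0`. -/
def Xspace (k : ℝ) : Set (ℝ → ℝ) :=
  {m | Continuous m ∧ MemH1 (fun x => m x - k) ∧ ∀ x, 0 < m x}

/-- The constraint manifold `𝓜_k` of the wave `μ`. -/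
def constraintManifold (k : ℝ) (μ : ℝ → ℝ) : Set (ℝ → ℝ) :=
  {m | m ∈ Xspace k ∧ constraintF k m = constraintF k μ}

/-- The semidistance `ρ(m₁, m₂) = inf_{x₀} ‖m₁ - m₂(· - x₀)‖_{H¹}`. -/
def rho (m₁ m₂ : ℝ → ℝ) : ℝ := ⨅ x₀ : ℝ, h1Norm (fun x => m₁ x - m₂ (x - x₀))

/-- The first variation `δ𝓕/δm (μ) = 2 (1 - ∂ₓ²)⁻¹ μ - 2 k^{4/3} μ^{-1/3}`. -/
def varF (k : ℝ) (μ : ℝ → ℝ) (x : ℝ) : ℝ :=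
  2 * helmholtzInv μ x - 2 * k ^ (4 / 3 : ℝ) * μ x ^ (-(1 / 3) : ℝ)

/-! ### The Hessian operator and its spectrum -/

/-- The real Hilbert space `L²(ℝ)`. -/
abbrev L2 : Type := Lp ℝ 2 (volume : Measure ℝ)

/-- The graph in `L²(ℝ) × L²(ℝ)` of the operator, with domain `H²(ℝ)`,
`𝓛 v = (2/3) (-3 (μ^{-8/3} v')' + 8 μ'' μ^{-11/3} v - (44/3) (μ')² μ^{-14/3} v + 15 μ^{-8/3} v)`
`- (2 ω₁ / 9) μ^{-4/3} v + 2 ω₀ (1 - ∂ₓ²)⁻¹ v`.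
Here `v₁ = v'`, `v₂ = v''` and `q = (μ^{-8/3} v')'` weakly. -/
def hessianGraph (c k : ℝ) (μ : ℝ → ℝ) : Set (L2 × L2) :=
  {p | ∃ v₁ v₂ q : ℝ → ℝ,
    MemLp v₁ 2 ∧ MemLp v₂ 2 ∧ IsWeakDeriv p.1 v₁ ∧ IsWeakDeriv v₁ v₂ ∧
    IsWeakDeriv (fun x => μ x ^ (-(8 / 3) : ℝ) * v₁ x) q ∧
    ∀ᵐ x, p.2 x =
      2 / 3 * (-3 * q x
          + 8 * iteratedDeriv 2 μ x * μ x ^ (-(11 / 3) : ℝ) * p.1 x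
          - 44 / 3 * deriv μ x ^ 2 * μ x ^ (-(14 / 3) : ℝ) * p.1 x
          + 15 * μ x ^ (-(8 / 3) : ℝ) * p.1 x)
        - 2 * omega1 c k / 9 * μ x ^ (-(4 / 3) : ℝ) * p.1 x
        + 2 * omega0 c k * helmholtzInv p.1 x}

/-- The resolvent set of the (unbounded) operator `T` with graph `G`: those `z` for which
`T - z` is a bijection from the domain of `T` onto `L²(ℝ)` with bounded inverse `R`. -/
def graphResolventSet (G : Set (L2 × L2)) : Set ℝ :=
  {z | ∃ R : L2 →L[ℝ] L2, ∀ v f : L2, (v, f + z • v) ∈ G ↔ v = R f}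

/-- The spectrum of the operator with graph `G`. -/
def graphSpectrum (G : Set (L2 × L2)) : Set ℝ := (graphResolventSet G)ᶜ

/-- `z` is a simple eigenvalue of the operator with graph `G`: its eigenspace is a line. -/
def IsSimpleEigenvalue (G : Set (L2 × L2)) (z : ℝ) : Prop :=
  ∃ χ : L2, χ ≠ 0 ∧ ∀ v : L2, (v, z • v) ∈ G ↔ ∃ t : ℝ, v = t • χ

/-- The spectrum of `𝓛` consists of a simple negative eigenvalue, a simple eigenvalue at `0`, and
a remaining part that is positive and bounded away from `0`. -/
def SpectralAssumption (c k : ℝ) (μ : ℝ → ℝ) : Prop :=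
  ∃ ν σ : ℝ, ν < 0 ∧ 0 < σ ∧
    IsSimpleEigenvalue (hessianGraph c k μ) ν ∧
    IsSimpleEigenvalue (hessianGraph c k μ) 0 ∧
    graphSpectrum (hessianGraph c k μ) ⊆ {ν, 0} ∪ Ici σ

/-- The Vakhitov–Kolokolov condition `⟨𝓛⁻¹ η, η⟩ < 0` for `η = δ𝓕/δm (μ)`: here `𝓛⁻¹ η` is any
`y` in the domain of `𝓛` with `𝓛 y = η`. As `η` is orthogonal to the kernel of `𝓛`, the value of
`⟨y, η⟩` does not depend on the choice of `y`. -/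
def VKCondition (c k : ℝ) (μ : ℝ → ℝ) : Prop :=
  ∀ y f : L2, (y, f) ∈ hessianGraph c k μ → f =ᵐ[volume] varF k μ →
    ∫ x, y x * varF k μ x < 0

end Novikov

end

/-!
The wave is a critical point of the action `Λ`, and the constraint `𝓕 = 𝓕(μ)` turns it into a local
minimum modulo translations. The mechanism is the constrained second-variation argument.

*Functionals.* For `m = k + v` with `v ∈ H¹(ℝ)`, the densities of `Λ` and `𝓕` are integrable up to
a multiple of `(1 - ∂ₓ²)⁻¹ v - v`. Its integral over `[-A, B]` is a boundary term that tends to `0`,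
so the improper integrals are the Lebesgue integrals `regLambda` and `regF`
(`IsH1.Lambda_eq`, `IsH1.constraintF_eq`). For `Λ` the terms linear in `v` cancel since the constant
`k` solves the Euler–Lagrange equation (`SolitaryProfile.euler_const`).

*The wave.* The travelling-wave equation has two first integrals, `μ (c - φ²)^{3/2} = a` and an
energy of level `E` (`IsSmoothSolitaryWave.profile_eqs`), which combine to the Euler–Lagrange
equation `Λ'(μ) = 0` (`IsSmoothSolitaryWave.eulerLagrange_eq_zero`). The condition
`4 k² < c` makes `k` a saddle of the profile equation, which gives the decay
`φ - k ∈ L²(ℝ)` together with its derivatives. Everything needed later is recorded in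
`SolitaryProfile`.

*Coercivity.* The operator `𝓛` represents the closed form `hessForm`
(`SolitaryProfile.isFormOf`), and its kernel is spanned by `μ'`
(`SolitaryProfile.mem_hessianGraph_zero` with the simplicity of the eigenvalue `0`). For an abstract
operator with one negative direction and a spectral gap, the sign `⟨𝓛⁻¹ η, η⟩ < 0` forces
`⟨𝓛 h, h⟩ + Γ ⟨η, h⟩² ≥ β ‖h‖²` for `h ⊥ ker 𝓛` (`exists_coercive_of_spectrum`); Gårding's
inequality upgrades this to `H¹(ℝ)` (`SolitaryProfile.exists_coercive`). No functional calculus is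
used: the Rayleigh-quotient bounds come from the resolvents by elementary arguments.

*Conclusion.* If `m` is near the orbit of `μ`, a translation makes the difference `h` small in
`H¹(ℝ)` and orthogonal to `μ'` (`SolitaryProfile.exists_modulation`). The constraint gives
`⟨η, h⟩ = O(‖h‖²)`, so that `Λ(m) - Λ(μ) = ⟨𝓛 h, h⟩ / 2 + o(‖h‖²) ≥ C ‖h‖²`
(`SolitaryProfile.exists_regLambda_expansion`, `SolitaryProfile.exists_action_bound`), and `‖h‖`
bounds `ρ(m, μ)` from above.
-/

noncomputable section

namespace Novikov

/-! ### Symmetric operators on a Hilbert space -/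

section HilbertSpace

variable {H : Type*} [NormedAddCommGroup H] [InnerProductSpace ℝ H]

theorem sq_le_mul_of_quadratic_nonneg {a b c : ℝ} (h : ∀ t : ℝ, 0 ≤ a * t ^ 2 + 2 * b * t + c) :
    b ^ 2 ≤ a * c := by
  have := discrim_le_zero (a := a) (b := 2 * b) (c := c) (fun t => by nlinarith [h t])
  unfold discrim at this
  nlinarith

/-- Cauchy–Schwarz for the nonnegative form `⟪T x, x⟫` on an invariant subspace. -/
theorem norm_sq_le_of_form_nonneg {T : H →L[ℝ] H} (hT : ∀ x y, inner ℝ (T x) y = inner ℝ x (T y))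
    {W : Submodule ℝ H} (hW : ∀ x ∈ W, T x ∈ W) (hpos : ∀ x ∈ W, 0 ≤ inner ℝ (T x) x)
    {x : H} (hx : x ∈ W) : ‖T x‖ ^ 2 ≤ ‖T‖ * inner ℝ (T x) x := by
  have key : (inner ℝ (T x) (T x)) ^ 2 ≤ inner ℝ (T (T x)) (T x) * inner ℝ (T x) x := by
    apply sq_le_mul_of_quadratic_nonneg
    intro t
    have h := hpos (x + t • T x) (W.add_mem hx (W.smul_mem t (hW x hx)))
    simp only [map_add, map_smul, inner_add_left, inner_add_right, inner_smul_left,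
      inner_smul_right, RCLike.conj_to_real] at h
    have h2 : inner ℝ (T (T x)) x = inner ℝ (T x) (T x) := hT _ _
    rw [h2] at h
    nlinarith
  rw [real_inner_self_eq_norm_sq] at key
  have hb : inner ℝ (T (T x)) (T x) ≤ ‖T‖ * ‖T x‖ ^ 2 := by
    calc inner ℝ (T (T x)) (T x) ≤ ‖T (T x)‖ * ‖T x‖ := real_inner_le_norm _ _
      _ ≤ (‖T‖ * ‖T x‖) * ‖T x‖ := by gcongr; exact T.le_opNorm _
      _ = _ := by ring
  by_cases h0 : ‖T x‖ = 0
  · rw [h0]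
    simpa using mul_nonneg (norm_nonneg T) (hpos x hx)
  · have hp : 0 < ‖T x‖ ^ 2 := by positivity
    have := mul_le_mul_of_nonneg_right hb (hpos x hx)
    refine le_of_mul_le_mul_left ?_ hp
    nlinarith

/-- An upper bound `M` of the Rayleigh quotient is not sharp when `T - M` is bounded below: the
Cauchy–Schwarz inequality for the form of `M - T` gives a smaller one. -/
theorem exists_lt_rayleigh_bound {T : H →L[ℝ] H}
    (hT : ∀ x y, inner ℝ (T x) y = inner ℝ x (T y))
    {W : Submodule ℝ H} (hW : ∀ x ∈ W, T x ∈ W) {M c : ℝ} (hc : 0 < c)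
    (hM : ∀ x ∈ W, inner ℝ (T x) x ≤ M * ‖x‖ ^ 2)
    (hbb : ∀ x ∈ W, c * ‖x‖ ≤ ‖T x - M • x‖) :
    ∃ ε : ℝ, 0 < ε ∧ ∀ x ∈ W, inner ℝ (T x) x ≤ (M - ε) * ‖x‖ ^ 2 := by
  set A : H →L[ℝ] H := M • ContinuousLinearMap.id ℝ H - T with hA
  have hAx : ∀ x, A x = M • x - T x := fun x => by simp [hA]
  have hAin : ∀ x, inner ℝ (A x) x = M * ‖x‖ ^ 2 - inner ℝ (T x) x := fun x => by
    rw [hAx, inner_sub_left, real_inner_smul_left, real_inner_self_eq_norm_sq]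
  refine ⟨c ^ 2 / (‖A‖ + 1), by positivity, fun x hx => ?_⟩
  have h1 : ‖A x‖ ^ 2 ≤ ‖A‖ * inner ℝ (A x) x := by
    refine norm_sq_le_of_form_nonneg (W := W) ?_ ?_ ?_ hx
    · intro x y
      rw [hAx, hAx, inner_sub_left, inner_sub_right, hT, real_inner_smul_left,
        real_inner_smul_right]
    · intro x hx
      rw [hAx]
      exact W.sub_mem (W.smul_mem _ hx) (hW x hx)
    · intro x hx
      rw [hAin]
      linarith [hM x hx]
  have h2 : (c * ‖x‖) ^ 2 ≤ ‖A x‖ ^ 2 := by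
    have := hbb x hx
    rw [norm_sub_rev, ← hAx] at this
    gcongr
  have h3 : 0 ≤ inner ℝ (A x) x := by rw [hAin]; linarith [hM x hx]
  have h4 : c ^ 2 * ‖x‖ ^ 2 ≤ (‖A‖ + 1) * inner ℝ (A x) x := by nlinarith
  have h5 : c ^ 2 / (‖A‖ + 1) * ‖x‖ ^ 2 ≤ inner ℝ (A x) x := by
    rw [div_mul_eq_mul_div, div_le_iff₀ (by positivity)]
    linarith
  rw [hAin] at h5
  linarith

/-- The supremum of the Rayleigh quotient on an invariant subspace is an approximate eigenvalue, so
it lies below `s` as soon as `T - M` is bounded below there for every `M > s`. -/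
theorem rayleigh_le_of_boundedBelow {T : H →L[ℝ] H}
    (hT : ∀ x y, inner ℝ (T x) y = inner ℝ x (T y))
    {W : Submodule ℝ H} (hW : ∀ x ∈ W, T x ∈ W) {s M₀ : ℝ}
    (hM₀ : ∀ x ∈ W, inner ℝ (T x) x ≤ M₀ * ‖x‖ ^ 2)
    (hbb : ∀ M, s < M → M ≤ M₀ → ∃ c : ℝ, 0 < c ∧ ∀ x ∈ W, c * ‖x‖ ≤ ‖T x - M • x‖) :
    ∀ x ∈ W, inner ℝ (T x) x ≤ s * ‖x‖ ^ 2 := by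
  by_cases hsM : M₀ ≤ s
  · intro x hx
    exact (hM₀ x hx).trans (by gcongr)
  push Not at hsM
  set S : Set ℝ := {M | s ≤ M ∧ M ≤ M₀ ∧ ∀ x ∈ W, inner ℝ (T x) x ≤ M * ‖x‖ ^ 2} with hS
  have hne : S.Nonempty := ⟨M₀, hsM.le, le_rfl, hM₀⟩
  have hbd : BddBelow S := ⟨s, fun M hM => hM.1⟩
  have hcl : IsClosed S := by
    have : S = Icc s M₀ ∩ ⋂ x ∈ W, {M | inner ℝ (T x) x ≤ M * ‖x‖ ^ 2} := by
      ext M; simp [hS, and_assoc]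
    rw [this]
    refine isClosed_Icc.inter (isClosed_biInter fun x _ => ?_)
    exact isClosed_le continuous_const (by fun_prop)
  have hmem : sInf S ∈ S := hcl.csInf_mem hne hbd
  obtain ⟨h1, h2, h3⟩ := hmem
  rcases h1.eq_or_lt with h | h
  · rw [h]; exact h3
  · exfalso
    obtain ⟨c, hc, hcx⟩ := hbb _ h h2
    obtain ⟨ε, hε, hεx⟩ := exists_lt_rayleigh_bound hT hW hc h3 hcx
    have hin : max s (sInf S - ε) ∈ S := by
      refine ⟨le_max_left _ _, max_le hsM.le (by linarith), fun x hx => (hεx x hx).trans ?_⟩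
      gcongr
      exact le_max_right _ _
    have := csInf_le hbd hin
    rcases le_max_iff.1 this with h' | h' <;> linarith

/-- A symmetric operator whose (approximate) spectrum misses `(-d, d)` is bounded below by `d`. -/
theorem le_norm_of_gap {T : H →L[ℝ] H} (hT : ∀ x y, inner ℝ (T x) y = inner ℝ x (T y))
    {d : ℝ} (hd : 0 < d)
    (hbb : ∀ t : ℝ, |t| < d → ∃ c : ℝ, 0 < c ∧ ∀ x, c * ‖x‖ ≤ ‖T x - t • x‖) (x : H) :
    d * ‖x‖ ≤ ‖T x‖ := by
  have hin : ∀ x, inner ℝ ((-(T.comp T)) x) x = -‖T x‖ ^ 2 := fun x => by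
    simp only [neg_apply, ContinuousLinearMap.comp_apply, inner_neg_left]
    rw [hT, real_inner_self_eq_norm_sq]
  have key := rayleigh_le_of_boundedBelow (T := -(T.comp T)) (W := ⊤) (s := -d ^ 2) (M₀ := 0)
    (by intro x y; simp [hT]) (by simp) (by intro x _; rw [hin]; nlinarith [sq_nonneg ‖T x‖])
    (by
      intro M hM hM0
      set t := √(-M) with ht
      have htt : t * t = -M := Real.mul_self_sqrt (by linarith)
      have ht0 : 0 ≤ t := Real.sqrt_nonneg _
      have htd : |t| < d := by
        rw [abs_of_nonneg ht0]
        nlinarith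
      obtain ⟨c₁, hc₁, h₁⟩ := hbb t htd
      obtain ⟨c₂, hc₂, h₂⟩ := hbb (-t) (by rwa [abs_neg])
      refine ⟨c₁ * c₂, by positivity, fun x _ => ?_⟩
      have e1 : (-(T.comp T)) x - M • x = -(T (T x - (-t) • x) - t • (T x - (-t) • x)) := by
        have : M = -(t * t) := by linarith
        rw [this]
        simp only [neg_apply, ContinuousLinearMap.comp_apply, map_sub, map_smul]
        module
      rw [e1, norm_neg]
      calc c₁ * c₂ * ‖x‖ = c₁ * (c₂ * ‖x‖) := by ring
        _ ≤ c₁ * ‖T x - (-t) • x‖ := by gcongr; exact h₂ x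
        _ ≤ _ := h₁ _) x trivial
  rw [hin] at key
  refine le_of_sq_le_sq ?_ (norm_nonneg _)
  nlinarith

variable [CompleteSpace H]

theorem mem_closure_range_of_orthogonal_ker {T : H →L[ℝ] H}
    (hT : ∀ x y, inner ℝ (T x) y = inner ℝ x (T y)) {x : H}
    (hx : ∀ v, T v = 0 → inner ℝ v x = 0) : x ∈ closure (Set.range T) := by
  set K : Submodule ℝ H := LinearMap.range (T : H →ₗ[ℝ] H) with hK
  have h1 : x ∈ Kᗮᗮ := by
    rw [Submodule.mem_orthogonal]
    intro v hv
    apply hx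
    rw [Submodule.mem_orthogonal] at hv
    have : inner ℝ (T (T v)) v = 0 := hv _ ⟨T v, rfl⟩
    rw [hT, real_inner_self_eq_norm_sq] at this
    simpa using this
  rw [Submodule.orthogonal_orthogonal_eq_closure] at h1
  exact h1

/-- If `0` is isolated in the spectrum of the symmetric operator `T`, then `T` is bounded below on
the orthogonal complement of its kernel. The gap `(0, d²)` of `T²` gives
`d ‖T y‖ ≤ ‖T (T y)‖`, which extends from the range of `T` to its closure `(ker T)ᗮ`. -/
theorem le_norm_of_isolated {T : H →L[ℝ] H} (hT : ∀ x y, inner ℝ (T x) y = inner ℝ x (T y))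
    {d : ℝ} (hd : 0 < d)
    (hbb : ∀ t : ℝ, t ≠ 0 → |t| < d → ∃ c : ℝ, 0 < c ∧ ∀ x, c * ‖x‖ ≤ ‖T x - t • x‖)
    {x : H} (hx : ∀ v, T v = 0 → inner ℝ v x = 0) : d * ‖x‖ ≤ ‖T x‖ := by
  set S : H →L[ℝ] H := T.comp T - (d ^ 2 / 2) • ContinuousLinearMap.id ℝ H with hS
  have hSx : ∀ x, S x = T (T x) - (d ^ 2 / 2) • x := fun x => by simp [hS]
  have hgap : ∀ y, (d ^ 2 / 2) * ‖y‖ ≤ ‖S y‖ := by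
    refine le_norm_of_gap ?_ (by positivity) ?_
    · intro x y
      rw [hSx, hSx, inner_sub_left, inner_sub_right, hT, hT, real_inner_smul_left,
        real_inner_smul_right]
    · intro t ht
      rw [abs_lt] at ht
      set r := √(t + d ^ 2 / 2) with hr
      have hrr : r * r = t + d ^ 2 / 2 := Real.mul_self_sqrt (by linarith)
      have hr0 : 0 < r := Real.sqrt_pos.2 (by linarith)
      have hrd : |r| < d := by
        rw [abs_of_pos hr0]
        nlinarith
      obtain ⟨c₁, hc₁, h₁⟩ := hbb r hr0.ne' hrd
      obtain ⟨c₂, hc₂, h₂⟩ := hbb (-r) (neg_ne_zero.2 hr0.ne') (by rwa [abs_neg])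
      refine ⟨c₁ * c₂, by positivity, fun x => ?_⟩
      have e1 : S x - t • x = T (T x - (-r) • x) - r • (T x - (-r) • x) := by
        have : t = r * r - d ^ 2 / 2 := by linarith
        rw [this, hSx]
        simp only [map_sub, map_smul]
        module
      rw [e1]
      calc c₁ * c₂ * ‖x‖ = c₁ * (c₂ * ‖x‖) := by ring
        _ ≤ c₁ * ‖T x - (-r) • x‖ := by gcongr; exact h₂ x
        _ ≤ _ := h₁ _
  have hrange : ∀ y, d * ‖T y‖ ≤ ‖T (T y)‖ := by
    intro y
    have h1 : (d ^ 2 / 2 * ‖y‖) ^ 2 ≤ ‖S y‖ ^ 2 := by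
      have := hgap y
      gcongr
    rw [hSx, norm_sub_sq_real, norm_smul, inner_smul_right, hT, real_inner_self_eq_norm_sq,
      Real.norm_of_nonneg (by positivity)] at h1
    refine le_of_sq_le_sq ?_ (norm_nonneg _)
    nlinarith
  have hcl : IsClosed {z : H | d * ‖z‖ ≤ ‖T z‖} :=
    isClosed_le (by fun_prop) (by fun_prop)
  refine hcl.closure_subset_iff.2 ?_ (mem_closure_range_of_orthogonal_ker hT hx)
  rintro _ ⟨y, rfl⟩
  exact hrange y

/-- If `0` is isolated in the spectrum of the symmetric operator `T`, then `T` maps onto the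
orthogonal complement of its kernel: its range is closed. -/
theorem exists_preimage_of_isolated {T : H →L[ℝ] H}
    (hT : ∀ x y, inner ℝ (T x) y = inner ℝ x (T y)) {d : ℝ} (hd : 0 < d)
    (hbb : ∀ t : ℝ, t ≠ 0 → |t| < d → ∃ c : ℝ, 0 < c ∧ ∀ x, c * ‖x‖ ≤ ‖T x - t • x‖)
    {x : H} (hx : ∀ v, T v = 0 → inner ℝ v x = 0) : ∃ y, T y = x := by
  set N : Submodule ℝ H := LinearMap.ker (T : H →ₗ[ℝ] H) with hN
  have hNc : IsClosed (N : Set H) := T.isClosed_ker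
  have : CompleteSpace N := hNc.completeSpace_coe
  set f : Nᗮ →L[ℝ] H := T.comp Nᗮ.subtypeL with hf
  have hanti : AntilipschitzWith (Real.toNNReal d⁻¹) f := by
    refine AddMonoidHomClass.antilipschitz_of_bound f fun y => ?_
    have := le_norm_of_isolated hT hd hbb (x := (y : H)) (fun v hv => by
      exact (Submodule.mem_orthogonal N (y : H)).1 y.2 v hv)
    rw [Real.coe_toNNReal _ (by positivity), inv_mul_eq_div, le_div_iff₀ hd]
    simpa [hf, mul_comm] using this
  have hclosed : IsClosed (Set.range f) := hanti.isClosed_range f.uniformContinuous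
  have hsub : Set.range T ⊆ Set.range f := by
    rintro _ ⟨y, rfl⟩
    obtain ⟨a, ha, b, hb, rfl⟩ := N.exists_add_mem_mem_orthogonal y
    refine ⟨⟨b, hb⟩, ?_⟩
    have : T a = 0 := ha
    simp [hf, this]
  have := hclosed.closure_subset_iff.2 hsub (mem_closure_range_of_orthogonal_ker hT hx)
  obtain ⟨y, hy⟩ := this
  exact ⟨y, hy⟩

end HilbertSpace

/-! ### Constrained coercivity from the spectral picture -/

section Coercivity

variable {H : Type*} [NormedAddCommGroup H] [InnerProductSpace ℝ H]

/-- A symmetric form `Q` on the subspace `V`, bounded below, that represents the operator with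
graph `G`, whose domain lies in `V`: `Q h u = ⟪h, f⟫` for `(u, f) ∈ G` and `h ∈ V`. -/
structure IsFormOf (Q : H → H → ℝ) (V : Submodule ℝ H) (G : Set (H × H)) (K : ℝ) : Prop where
  symm : ∀ u ∈ V, ∀ v ∈ V, Q u v = Q v u
  add_left : ∀ u ∈ V, ∀ v ∈ V, ∀ w ∈ V, Q (u + v) w = Q u w + Q v w
  smul_left : ∀ (t : ℝ), ∀ u ∈ V, ∀ v ∈ V, Q (t • u) v = t * Q u v
  lower : ∀ u ∈ V, -K * ‖u‖ ^ 2 ≤ Q u u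
  mem : ∀ u f : H, (u, f) ∈ G → u ∈ V
  repr : ∀ u f : H, (u, f) ∈ G → ∀ h ∈ V, Q h u = inner ℝ h f

namespace IsFormOf

variable {Q : H → H → ℝ} {V : Submodule ℝ H} {G : Set (H × H)} {K : ℝ}

theorem add_smul_self (hQ : IsFormOf Q V G K) {u v : H} (hu : u ∈ V) (hv : v ∈ V) (t : ℝ) :
    Q (u + t • v) (u + t • v) = Q u u + 2 * t * Q u v + t ^ 2 * Q v v := by
  have htv := V.smul_mem t hv
  have hs := V.add_mem hu htv
  rw [hQ.add_left u hu _ htv _ hs, hQ.smul_left t v hv _ hs, hQ.symm u hu _ hs,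
    hQ.symm v hv _ hs, hQ.add_left u hu _ htv _ hu, hQ.add_left u hu _ htv _ hv,
    hQ.smul_left t v hv _ hu, hQ.smul_left t v hv _ hv, hQ.symm v hv u hu]
  ring

variable {R : H →L[ℝ] H} {z : ℝ}

theorem apply_resolvent (hQ : IsFormOf Q V G K)
    (hR : ∀ v f : H, (v, f + z • v) ∈ G ↔ v = R f) (x : H) {h : H} (hh : h ∈ V) :
    Q h (R x) = inner ℝ h x + z * inner ℝ h (R x) := by
  rw [hQ.repr _ _ ((hR (R x) x).2 rfl) h hh, inner_add_right, inner_smul_right]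

theorem resolvent_mem (hQ : IsFormOf Q V G K)
    (hR : ∀ v f : H, (v, f + z • v) ∈ G ↔ v = R f) (x : H) : R x ∈ V :=
  hQ.mem _ _ ((hR (R x) x).2 rfl)

theorem resolvent_symm (hQ : IsFormOf Q V G K)
    (hR : ∀ v f : H, (v, f + z • v) ∈ G ↔ v = R f) (x y : H) :
    inner ℝ (R x) y = inner ℝ x (R y) := by
  have hx := hQ.resolvent_mem hR x
  have hy := hQ.resolvent_mem hR y
  have h1 := hQ.apply_resolvent hR y hx
  have h2 := hQ.apply_resolvent hR x hy
  rw [hQ.symm _ hx _ hy, h2, real_inner_comm (R x) (R y), real_inner_comm x (R y)] at h1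
  linarith

theorem resolvent_form (hQ : IsFormOf Q V G K)
    (hR : ∀ v f : H, (v, f + z • v) ∈ G ↔ v = R f) (x : H) :
    inner ℝ (R x) x = Q (R x) (R x) - z * ‖R x‖ ^ 2 := by
  rw [hQ.apply_resolvent hR x (hQ.resolvent_mem hR x), real_inner_self_eq_norm_sq]
  ring

end IsFormOf

/-- Eigenvectors of the operator for `w` are eigenvectors of its resolvent at `z` for
`1 / (w - z)`. -/
theorem resolvent_eigen_iff {G : Set (H × H)} {R : H →L[ℝ] H} {z w : ℝ} (hzw : z < w)
    (hR : ∀ v f : H, (v, f + z • v) ∈ G ↔ v = R f) (v : H) :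
    R v - (w - z)⁻¹ • v = 0 ↔ (v, w • v) ∈ G := by
  have h : w - z ≠ 0 := by linarith
  have e : w • v = (w - z) • v + z • v := by module
  rw [e, hR, map_smul, sub_eq_zero, eq_comm (a := v), ← eq_inv_smul_iff₀ h]

/-- Resolvent points of `G` give points where `R - r` is bounded below. -/
theorem resolvent_sub_boundedBelow {G : Set (H × H)} {R R' : H →L[ℝ] H} {z r : ℝ} (hr : r ≠ 0)
    (hR : ∀ v f : H, (v, f + z • v) ∈ G ↔ v = R f)
    (hR' : ∀ v f : H, (v, f + (z + r⁻¹) • v) ∈ G ↔ v = R' f) :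
    ∃ c : ℝ, 0 < c ∧ ∀ x, c * ‖x‖ ≤ ‖R x - r • x‖ := by
  -- `(L - z - 1/r) (R x) = x - (1/r) R x = -(1/r) (R x - r x)`
  have key : ∀ x, R x = -(r⁻¹ • R' (R x - r • x)) := by
    intro x
    have h1 : (R x, x + z • R x) ∈ G := (hR _ _).2 rfl
    have h2 : x + z • R x = -(r⁻¹ • (R x - r • x)) + (z + r⁻¹) • R x := by
      rw [smul_sub, smul_smul, inv_mul_cancel₀ hr]
      module
    rw [h2, hR', map_neg, map_smul] at h1
    exact h1
  have hb : ∀ x, |r| * ‖x‖ ≤ (|r|⁻¹ * ‖R'‖ + 1) * ‖R x - r • x‖ := by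
    intro x
    have h1 : ‖R x‖ ≤ |r|⁻¹ * (‖R'‖ * ‖R x - r • x‖) := by
      conv_lhs => rw [key x]
      rw [norm_neg, norm_smul, norm_inv, Real.norm_eq_abs]
      gcongr
      exact R'.le_opNorm _
    have h2 : |r| * ‖x‖ ≤ ‖R x‖ + ‖R x - r • x‖ := by
      rw [← Real.norm_eq_abs, ← norm_smul]
      have : r • x = R x - (R x - r • x) := by module
      conv_lhs => rw [this]
      exact norm_sub_le _ _
    calc _ ≤ _ := h2
      _ ≤ |r|⁻¹ * (‖R'‖ * ‖R x - r • x‖) + ‖R x - r • x‖ := by gcongr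
      _ = _ := by ring
  have hr' : 0 < |r| := abs_pos.2 hr
  refine ⟨|r| / (|r|⁻¹ * ‖R'‖ + 1), by positivity, fun x => ?_⟩
  rw [div_mul_eq_mul_div, div_le_iff₀ (by positivity), mul_comm _ (_ + _)]
  exact hb x

section Spectral

variable {Q : H → H → ℝ} {V : Submodule ℝ H} {G : Set (H × H)} {K ν σ : ℝ}

/-- Near the inverse of an isolated point `w` of the spectrum, `R - r` is bounded below. -/
theorem exists_isolated_resolvent {R : H →L[ℝ] H} {z w d₀ : ℝ} (hzw : z < w) (hd₀ : 0 < d₀)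
    (hR : ∀ v f : H, (v, f + z • v) ∈ G ↔ v = R f)
    (hres : ∀ w', w' ≠ w → |w' - w| < d₀ →
      ∃ R' : H →L[ℝ] H, ∀ v f : H, (v, f + w' • v) ∈ G ↔ v = R' f) :
    ∃ d : ℝ, 0 < d ∧ ∀ t : ℝ, t ≠ 0 → |t| < d → ∃ c : ℝ, 0 < c ∧ ∀ x,
      c * ‖x‖ ≤ ‖(R - (w - z)⁻¹ • ContinuousLinearMap.id ℝ H) x - t • x‖ := by
  have hcont : ContinuousAt (fun t : ℝ => z + ((w - z)⁻¹ + t)⁻¹) 0 := by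
    refine continuousAt_const.add (ContinuousAt.inv₀ (by fun_prop) ?_)
    simp only [add_zero]
    exact inv_ne_zero (by linarith)
  have hev : ∀ᶠ t : ℝ in 𝓝 0, |z + ((w - z)⁻¹ + t)⁻¹ - w| < d₀ ∧ (w - z)⁻¹ + t ≠ 0 := by
    have h0 : z + ((w - z)⁻¹ + 0)⁻¹ = w := by simp
    have h1 := hcont.tendsto
    rw [h0] at h1
    have h2 := (Metric.tendsto_nhds.1 h1) d₀ hd₀
    have h3 : ∀ᶠ t : ℝ in 𝓝 0, (w - z)⁻¹ + t ≠ 0 := by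
      have : ContinuousAt (fun t : ℝ => (w - z)⁻¹ + t) 0 := by fun_prop
      refine this.eventually_ne ?_
      rw [add_zero]
      exact inv_ne_zero (by linarith)
    filter_upwards [h2, h3] with t ht ht'
    exact ⟨by rwa [Real.dist_eq] at ht, ht'⟩
  obtain ⟨d, hd, hdt⟩ := Metric.eventually_nhds_iff.1 hev
  refine ⟨d, hd, fun t ht0 htd => ?_⟩
  obtain ⟨h1, h2⟩ := hdt (y := t) (by rwa [Real.dist_eq, sub_zero])
  have hne : z + ((w - z)⁻¹ + t)⁻¹ ≠ w := by
    intro h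
    have : ((w - z)⁻¹ + t)⁻¹ = w - z := by linarith
    rw [inv_eq_iff_eq_inv] at this
    exact ht0 (by linarith)
  obtain ⟨R', hR'⟩ := hres _ hne h1
  obtain ⟨c, hc, hcx⟩ := resolvent_sub_boundedBelow h2 hR hR'
  refine ⟨c, hc, fun x => ?_⟩
  have : (R - (w - z)⁻¹ • ContinuousLinearMap.id ℝ H) x - t • x = R x - ((w - z)⁻¹ + t) • x := by
    simp only [sub_apply, smul_apply, ContinuousLinearMap.id_apply]
    module
  rw [this]
  exact hcx x

variable [CompleteSpace H] {χν χ₀ : H}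

/-- On the orthogonal complement of the two eigenvectors the form is bounded below by `σ`. For the
resolvent this is a Rayleigh quotient bound; it passes to all of the form domain by minimizing
`Q (h - R x) - z ‖h - R x‖² ≥ 0` over multiples `x` of `h`, so that no density argument for the
operator domain is needed. -/
theorem form_lower_bound (hQ : IsFormOf Q V G K) (hν : ν < 0) (hσ : 0 < σ)
    (hres : ∀ w, w ≠ ν → w ≠ 0 → w < σ →
      ∃ R : H →L[ℝ] H, ∀ v f : H, (v, f + w • v) ∈ G ↔ v = R f)
    (hχν : ∀ v : H, (v, ν • v) ∈ G ↔ ∃ t : ℝ, v = t • χν)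
    (hχ₀ : ∀ v : H, (v, (0 : ℝ) • v) ∈ G ↔ ∃ t : ℝ, v = t • χ₀)
    {h : H} (hh : h ∈ V) (h1 : inner ℝ χν h = 0) (h0 : inner ℝ χ₀ h = 0) :
    σ * ‖h‖ ^ 2 ≤ Q h h := by
  set z := min (ν - 1) (-K - 1) with hz
  have hzν : z < ν := lt_of_le_of_lt (min_le_left _ _) (by linarith)
  have hzK : z < -K := lt_of_le_of_lt (min_le_right _ _) (by linarith)
  obtain ⟨R, hR⟩ := hres z hzν.ne (by linarith) (by linarith)
  have hRs := hQ.resolvent_symm hR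
  set W : Submodule ℝ H := (ℝ ∙ χν)ᗮ ⊓ (ℝ ∙ χ₀)ᗮ with hW
  have hWmem : ∀ x, x ∈ W ↔ inner ℝ χν x = 0 ∧ inner ℝ χ₀ x = 0 := fun x => by
    simp only [hW, Submodule.mem_inf, Submodule.mem_orthogonal_singleton_iff_inner_right]
  have eigν := resolvent_eigen_iff (w := ν) hzν hR
  have eig₀ := resolvent_eigen_iff (w := 0) (hzν.trans hν) hR
  have hRν : R χν = (ν - z)⁻¹ • χν :=
    sub_eq_zero.1 ((eigν χν).2 ((hχν _).2 ⟨1, (one_smul _ _).symm⟩))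
  have hR₀ : R χ₀ = (0 - z)⁻¹ • χ₀ :=
    sub_eq_zero.1 ((eig₀ χ₀).2 ((hχ₀ _).2 ⟨1, (one_smul _ _).symm⟩))
  have hWR : ∀ x ∈ W, R x ∈ W := by
    intro x hx
    rw [hWmem] at hx ⊢
    rw [← hRs, ← hRs, hRν, hR₀, real_inner_smul_left, real_inner_smul_left, hx.1, hx.2]
    simp
  -- the isolated points are approximate eigenvalues only along the eigenvectors
  have hiso : ∀ w, z < w → (w = ν ∨ w = 0) →
      ∃ c : ℝ, 0 < c ∧ ∀ x ∈ W, c * ‖x‖ ≤ ‖R x - (w - z)⁻¹ • x‖ := by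
    intro w hzw hw
    have hd₀ : 0 < min (-ν) σ := lt_min (by linarith) hσ
    obtain ⟨d, hd, hbb⟩ := exists_isolated_resolvent hzw hd₀ hR (fun w' hne hlt => by
      rw [lt_min_iff, abs_lt, abs_lt] at hlt
      rcases hw with rfl | rfl
      · exact hres w' hne (by linarith) (by linarith)
      · exact hres w' (by linarith) hne (by linarith))
    refine ⟨d, hd, fun x hx => ?_⟩
    have hfin := le_norm_of_isolated (T := R - (w - z)⁻¹ • ContinuousLinearMap.id ℝ H) (x := x)
      (by
        intro x y
        simp only [sub_apply, smul_apply, ContinuousLinearMap.id_apply,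
          inner_sub_left, inner_sub_right, hRs, real_inner_smul_left, real_inner_smul_right])
      hd hbb (by
        intro v hv
        have hv' : R v - (w - z)⁻¹ • v = 0 := by simpa using hv
        rw [resolvent_eigen_iff hzw hR] at hv'
        rw [hWmem] at hx
        rcases hw with rfl | rfl
        · obtain ⟨t, rfl⟩ := (hχν v).1 hv'
          rw [real_inner_smul_left, hx.1, mul_zero]
        · obtain ⟨t, rfl⟩ := (hχ₀ v).1 hv'
          rw [real_inner_smul_left, hx.2, mul_zero])
    simpa using hfin
  have hsz : 0 < σ - z := by linarith
  have hRay : ∀ x ∈ W, inner ℝ (R x) x ≤ (σ - z)⁻¹ * ‖x‖ ^ 2 := by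
    refine rayleigh_le_of_boundedBelow hRs hWR (M₀ := ‖R‖) ?_ ?_
    · intro x _
      calc inner ℝ (R x) x ≤ ‖R x‖ * ‖x‖ := real_inner_le_norm _ _
        _ ≤ ‖R‖ * ‖x‖ * ‖x‖ := by gcongr; exact R.le_opNorm _
        _ = _ := by ring
    · intro M hM _
      have hM0 : 0 < M := lt_trans (by positivity) hM
      have hlt : z + M⁻¹ < σ := by
        have := inv_lt_of_inv_lt₀ hsz hM
        linarith
      by_cases hw : z + M⁻¹ = ν ∨ z + M⁻¹ = 0
      · have hMe : (z + M⁻¹ - z)⁻¹ = M := by rw [add_sub_cancel_left, inv_inv]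
        have := hiso (z + M⁻¹) (by have := inv_pos.2 hM0; linarith) hw
        rwa [hMe] at this
      · push Not at hw
        obtain ⟨R', hR'⟩ := hres _ hw.1 hw.2 hlt
        obtain ⟨c, hc, hcx⟩ := resolvent_sub_boundedBelow hM0.ne' hR hR'
        exact ⟨c, hc, fun x _ => hcx x⟩
  have hhW : h ∈ W := (hWmem h).2 ⟨h1, h0⟩
  -- completing the square with `u = R ((σ - z) h)`
  set x := (σ - z) • h with hx
  have hxW : x ∈ W := W.smul_mem _ hhW
  have hu := hQ.resolvent_mem hR x
  have e1 := hQ.add_smul_self hh hu (-1)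
  have e2 := hQ.apply_resolvent hR x hh
  have e3 := hQ.resolvent_form hR x
  have e4 := hQ.lower (h + (-1 : ℝ) • R x) (V.add_mem hh (V.smul_mem _ hu))
  have e5 : ‖h + (-1 : ℝ) • R x‖ ^ 2 = ‖h‖ ^ 2 - 2 * inner ℝ h (R x) + ‖R x‖ ^ 2 := by
    rw [neg_one_smul, ← sub_eq_add_neg, norm_sub_sq_real]
  have e6 := hRay x hxW
  have e7 : inner ℝ h x = (σ - z) * ‖h‖ ^ 2 := by
    rw [hx, real_inner_smul_right, real_inner_self_eq_norm_sq]
  have e8 : (σ - z)⁻¹ * ‖x‖ ^ 2 = (σ - z) * ‖h‖ ^ 2 := by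
    rw [hx, norm_smul, Real.norm_of_nonneg hsz.le]
    field_simp
  have e9 : z * ‖h + (-1 : ℝ) • R x‖ ^ 2 ≤ -K * ‖h + (-1 : ℝ) • R x‖ ^ 2 := by gcongr
  rw [e5] at e4 e9
  rw [e1, e2] at e4
  nlinarith

/-- A vector orthogonal to the kernel is in the range. -/
theorem exists_solution (hQ : IsFormOf Q V G K) (hν : ν < 0) (hσ : 0 < σ)
    (hres : ∀ w, w ≠ ν → w ≠ 0 → w < σ →
      ∃ R : H →L[ℝ] H, ∀ v f : H, (v, f + w • v) ∈ G ↔ v = R f)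
    (hχ₀ : ∀ v : H, (v, (0 : ℝ) • v) ∈ G ↔ ∃ t : ℝ, v = t • χ₀)
    {η : H} (hη : inner ℝ χ₀ η = 0) :
    ∃ y, (y, η) ∈ G ∧ inner ℝ χ₀ y = 0 := by
  obtain ⟨R, hR⟩ := hres (ν - 1) (by linarith) (by linarith) (by linarith)
  set z := ν - 1 with hz
  have hz0 : z < 0 := by linarith
  have hRs := hQ.resolvent_symm hR
  have eig₀ := resolvent_eigen_iff (w := 0) hz0 hR
  have hR₀ : R χ₀ = (0 - z)⁻¹ • χ₀ :=
    sub_eq_zero.1 ((eig₀ χ₀).2 ((hχ₀ _).2 ⟨1, (one_smul _ _).symm⟩))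
  obtain ⟨d, hd, hbb⟩ := exists_isolated_resolvent (w := 0) hz0
    (lt_min (by linarith : 0 < -ν) hσ) hR (fun w' hne hlt => by
      rw [lt_min_iff, abs_lt, abs_lt] at hlt
      exact hres w' (by linarith) hne (by linarith))
  obtain ⟨y, hy⟩ := exists_preimage_of_isolated
    (T := R - (0 - z)⁻¹ • ContinuousLinearMap.id ℝ H) (x := z⁻¹ • R η)
    (by
      intro x y
      simp only [sub_apply, smul_apply, ContinuousLinearMap.id_apply,
        inner_sub_left, inner_sub_right, hRs, real_inner_smul_left, real_inner_smul_right])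
    hd hbb (by
      intro v hv
      have hv' : R v - (0 - z)⁻¹ • v = 0 := by simpa using hv
      rw [resolvent_eigen_iff hz0 hR] at hv'
      obtain ⟨t, rfl⟩ := (hχ₀ v).1 hv'
      rw [real_inner_smul_right, ← hRs, map_smul, hR₀]
      simp only [real_inner_smul_left, hη, mul_zero])
  have hy2 : y = R (η - z • y) := by
    have h1 : R y - (0 - z)⁻¹ • y = z⁻¹ • R η := by simpa using hy
    have h2 : (0 - z)⁻¹ = -z⁻¹ := by rw [zero_sub, inv_neg]
    rw [h2] at h1
    have h3 : z • (R y - -z⁻¹ • y) = R η := by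
      rw [h1, smul_smul, mul_inv_cancel₀ hz0.ne, one_smul]
    have h4 : z • (-z⁻¹ • y) = -y := by
      rw [smul_smul, mul_neg, mul_inv_cancel₀ hz0.ne, neg_one_smul]
    rw [smul_sub, h4] at h3
    rw [map_sub, map_smul, ← h3]
    abel
  have hyG : (y, η) ∈ G := by
    have := (hR _ _).2 hy2
    rwa [sub_add_cancel] at this
  -- subtract the component along the kernel
  set t : ℝ := inner ℝ χ₀ y / ‖χ₀‖ ^ 2 with ht
  refine ⟨y - t • χ₀, ?_, ?_⟩
  · have h1 : η = (η - z • (y - t • χ₀)) + z • (y - t • χ₀) := by abel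
    rw [h1, hR]
    have h2 : η - z • (y - t • χ₀) = (η - z • y) + (z * t) • χ₀ := by module
    rw [h2, map_add, ← hy2, map_smul, hR₀, smul_smul, zero_sub, inv_neg, mul_neg,
      mul_right_comm, mul_inv_cancel₀ hz0.ne, one_mul, neg_smul, ← sub_eq_add_neg]
  · rw [inner_sub_right, real_inner_smul_right, real_inner_self_eq_norm_sq, ht]
    by_cases h : χ₀ = 0
    · simp [h]
    · have : ‖χ₀‖ ≠ 0 := norm_ne_zero_iff.2 h
      field_simp
      ring

/-- In the notation of `exists_coercive_of_spectrum`: with `q = Q g w` and `ℓ = ⟪η, h⟫`, the bound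
on the component of `h` along the negative direction. -/
theorem sub_sq_mul_le {g w D q : ℝ} (hg : 0 ≤ g) (hw : 0 ≤ w) (hD : 0 < D) (hq : q ^ 2 ≤ w * g)
    (ℓ : ℝ) : (ℓ - q) ^ 2 * D ≤ (g + D) * w * D + (D + g) * ℓ ^ 2 := by
  have f4 : 0 ≤ g * ℓ ^ 2 + 2 * D * (ℓ * q) + D ^ 2 * w := by
    rcases hg.eq_or_lt with h | h
    · rw [← h] at hq ⊢
      have : q = 0 := by nlinarith
      rw [this]
      have := mul_nonneg (sq_nonneg D) hw
      linarith
    · refine nonneg_of_mul_nonneg_right ?_ h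
      have : g * (g * ℓ ^ 2 + 2 * D * (ℓ * q) + D ^ 2 * w) =
          (g * ℓ + D * q) ^ 2 + D ^ 2 * (w * g - q ^ 2) := by ring
      rw [this]
      have := mul_nonneg (sq_nonneg D) (sub_nonneg.2 hq)
      positivity
  nlinarith

set_option maxHeartbeats 800000 in
/-- Coercivity modulo the kernel and the constraint direction: if `⟪L⁻¹ η, η⟫ < 0`, a multiple of
`⟪η, h⟫²` makes up for the negative direction of the form. -/
theorem exists_coercive_of_spectrum (hQ : IsFormOf Q V G K) (hν : ν < 0) (hσ : 0 < σ)
    (hres : ∀ w, w ≠ ν → w ≠ 0 → w < σ →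
      ∃ R : H →L[ℝ] H, ∀ v f : H, (v, f + w • v) ∈ G ↔ v = R f)
    (hν0 : χν ≠ 0) (hχν : ∀ v : H, (v, ν • v) ∈ G ↔ ∃ t : ℝ, v = t • χν)
    (hχ₀ : ∀ v : H, (v, (0 : ℝ) • v) ∈ G ↔ ∃ t : ℝ, v = t • χ₀)
    {η : H} (hη : inner ℝ χ₀ η = 0) (hVK : ∀ y, (y, η) ∈ G → inner ℝ y η < 0) :
    ∃ β : ℝ, 0 < β ∧ ∃ Γ : ℝ, 0 ≤ Γ ∧ ∀ h ∈ V, inner ℝ χ₀ h = 0 →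
      β * ‖h‖ ^ 2 ≤ Q h h + Γ * inner ℝ η h ^ 2 := by
  obtain ⟨y, hyG, hy0⟩ := exists_solution hQ hν hσ hres hχ₀ hη
  have hyη := hVK y hyG
  have hyV := hQ.mem _ _ hyG
  have hνG : (χν, ν • χν) ∈ G := (hχν _).2 ⟨1, (one_smul _ _).symm⟩
  have h0G : (χ₀, (0 : ℝ) • χ₀) ∈ G := (hχ₀ _).2 ⟨1, (one_smul _ _).symm⟩
  have hνV := hQ.mem _ _ hνG
  have h0V := hQ.mem _ _ h0G
  have hn : 0 < ‖χν‖ ^ 2 := by positivity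
  set n := ‖χν‖ ^ 2 with hnn
  have horth : inner ℝ χ₀ χν = 0 := by
    have h1 := hQ.repr _ _ hνG χ₀ h0V
    have h2 := hQ.repr _ _ h0G χν hνV
    rw [hQ.symm _ hνV _ h0V, zero_smul, inner_zero_right] at h2
    rw [h2, real_inner_smul_right] at h1
    rcases mul_eq_zero.1 h1.symm with h | h
    · linarith
    · exact h
  have hQν : ∀ h ∈ V, Q h χν = ν * inner ℝ h χν := fun h hh => by
    rw [hQ.repr _ _ hνG h hh, real_inner_smul_right]
  -- orthogonal decomposition along `χν`
  have hdec : ∀ h ∈ V, inner ℝ χ₀ h = 0 → ∃ a : ℝ, ∃ w ∈ V, h = w + a • χν ∧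
      inner ℝ χν w = 0 ∧ inner ℝ χ₀ w = 0 ∧ σ * ‖w‖ ^ 2 ≤ Q w w := by
    intro h hh hh0
    have hV : h - (inner ℝ χν h / n) • χν ∈ V := V.sub_mem hh (V.smul_mem _ hνV)
    have ho : inner ℝ χν (h - (inner ℝ χν h / n) • χν) = 0 := by
      rw [inner_sub_right, real_inner_smul_right, real_inner_self_eq_norm_sq,
        div_mul_cancel₀ _ hn.ne', sub_self]
    have ho' : inner ℝ χ₀ (h - (inner ℝ χν h / n) • χν) = 0 := by
      rw [inner_sub_right, real_inner_smul_right, hh0, horth, mul_zero, sub_zero]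
    exact ⟨inner ℝ χν h / n, h - (inner ℝ χν h / n) • χν, hV, by abel, ho, ho',
      form_lower_bound hQ hν hσ hres hχν hχ₀ hV ho ho'⟩
  obtain ⟨b, g, hgV, hyd, hgν, hg₀, hgσ⟩ := hdec y hyV hy0
  have hQw : ∀ w ∈ V, inner ℝ χν w = 0 → ∀ a : ℝ,
      Q (w + a • χν) (w + a • χν) = Q w w + ν * n * a ^ 2 := by
    intro w hw hwν a
    rw [hQ.add_smul_self hw hνV, hQν w hw, hQν _ hνV, real_inner_comm, hwν,
      real_inner_self_eq_norm_sq]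
    ring
  have hQyy : Q y y = Q g g + ν * n * b ^ 2 := by
    rw [hyd]
    exact hQw g hgV hgν b
  have hQy : Q y y < 0 := by
    rw [hQ.repr _ _ hyG y hyV]
    exact hyη
  have hg0 : 0 ≤ Q g g := le_trans (by positivity) hgσ
  have hb : 0 < b ^ 2 := by
    rcases eq_or_ne b 0 with h | h
    · rw [h] at hQyy
      nlinarith
    · positivity
  set P := -ν * n * b ^ 2 with hP
  have hP0 : 0 < P := by
    have : 0 < -ν := by linarith
    positivity
  have hgP : Q g g < P := by
    have : P = -(ν * n * b ^ 2) := by rw [hP]; ring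
    linarith
  -- `θ < 1` measures the gap in the Vakhitov–Kolokolov condition
  set θ := (Q g g + P) / (2 * P) with hθ
  have hθ1 : θ < 1 := by rw [hθ, div_lt_one (by positivity)]; linarith
  have hθ0 : 0 < θ := by rw [hθ]; positivity
  have hθP : θ * P = (Q g g + P) / 2 := by rw [hθ]; field_simp
  set D := (P - Q g g) / 2 with hD
  have hD0 : 0 < D := by rw [hD]; linarith
  set Γ := (1 + Q g g / D) / P with hΓ
  have hΓ0 : 0 ≤ Γ := by rw [hΓ]; positivity
  -- the component along `χν` is controlled by the rest
  have hmain : ∀ w ∈ V, inner ℝ χν w = 0 → inner ℝ χ₀ w = 0 → σ * ‖w‖ ^ 2 ≤ Q w w →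
      ∀ a : ℝ, -ν * n * a ^ 2 ≤ θ * Q w w + Γ * inner ℝ η (w + a • χν) ^ 2 := by
    intro w hw hwν hw₀ hwσ a
    have hw0 : 0 ≤ Q w w := le_trans (by positivity) hwσ
    have haV := V.smul_mem a hνV
    have hcs : Q g w ^ 2 ≤ Q w w * Q g g := by
      apply sq_le_mul_of_quadratic_nonneg
      intro t
      have h1 := hQ.add_smul_self hgV hw t
      have h2 : 0 ≤ Q (g + t • w) (g + t • w) := by
        refine le_trans ?_ (form_lower_bound hQ hν hσ hres hχν hχ₀
          (V.add_mem hgV (V.smul_mem t hw)) ?_ ?_)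
        · positivity
        · rw [inner_add_right, real_inner_smul_right, hgν, hwν]; simp
        · rw [inner_add_right, real_inner_smul_right, hg₀, hw₀]; simp
      linarith
    have hℓ : inner ℝ η (w + a • χν) = Q g w + ν * n * a * b := by
      have h1 := hQ.repr _ _ hyG (w + a • χν) (V.add_mem hw haV)
      rw [real_inner_comm, ← h1, hyd]
      rw [hQ.add_left w hw _ haV _ (V.add_mem hgV (V.smul_mem b hνV)),
        hQ.smul_left a _ hνV _ (V.add_mem hgV (V.smul_mem b hνV)),
        hQ.symm w hw _ (V.add_mem hgV (V.smul_mem b hνV)),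
        hQ.symm χν hνV _ (V.add_mem hgV (V.smul_mem b hνV)),
        hQ.add_left g hgV _ (V.smul_mem b hνV) _ hw,
        hQ.add_left g hgV _ (V.smul_mem b hνV) _ hνV,
        hQ.smul_left b _ hνV _ hw, hQ.smul_left b _ hνV _ hνV,
        hQ.symm χν hνV w hw, hQν w hw, hQν g hgV, hQν _ hνV, real_inner_comm, hwν,
        real_inner_comm, hgν, real_inner_self_eq_norm_sq]
      ring
    rw [hℓ]
    set q := Q g w with hq
    set ℓ := q + ν * n * a * b with hℓ'
    -- `P · (-ν n a²) = (ν n a b)² = (ℓ - q)²`, and `q² ≤ Q w w · Q g g`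
    have e1 : P * (-ν * n * a ^ 2) = (ℓ - q) ^ 2 := by rw [hℓ', hP]; ring
    have e2 : (ℓ - q) ^ 2 * D ≤ (θ * Q w w + Γ * ℓ ^ 2) * P * D := by
      have f1 : Γ * P * D = D + Q g g := by rw [hΓ]; field_simp
      have f2 : θ * P = Q g g + D := by rw [hθP, hD]; ring
      have f3 : (θ * Q w w + Γ * ℓ ^ 2) * P * D = (θ * P) * Q w w * D + (Γ * P * D) * ℓ ^ 2 := by
        ring
      rw [f3, f1, f2]
      exact sub_sq_mul_le hg0 hw0 hD0 hcs ℓ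
    have e3 : (ℓ - q) ^ 2 ≤ (θ * Q w w + Γ * ℓ ^ 2) * P :=
      le_of_mul_le_mul_right e2 hD0
    rw [← e1] at e3
    exact le_of_mul_le_mul_left (by linarith) hP0
  set κ := (1 - θ) / 2 with hκ
  have hκ0 : 0 < κ := by rw [hκ]; linarith
  have hmin : 0 < min σ (-ν) := lt_min hσ (by linarith)
  refine ⟨κ * min σ (-ν), by positivity, (1 + κ) * Γ, by positivity, fun h hh hh0 => ?_⟩
  obtain ⟨a, w, hw, hd, hwν, hw₀, hwσ⟩ := hdec h hh hh0
  have h1 := hmain w hw hwν hw₀ hwσ a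
  rw [← hd] at h1
  have h2 := hQw w hw hwν a
  rw [← hd] at h2
  have h3 : ‖h‖ ^ 2 = ‖w‖ ^ 2 + n * a ^ 2 := by
    rw [hd, norm_add_sq_real, real_inner_smul_right, real_inner_comm, hwν, norm_smul, mul_pow,
      Real.norm_eq_abs, sq_abs]
    ring
  have hw0 : 0 ≤ Q w w := le_trans (by positivity) hwσ
  have hX : 0 ≤ n * a ^ 2 := by positivity
  have h4 : min σ (-ν) * ‖w‖ ^ 2 ≤ Q w w :=
    le_trans (by gcongr; exact min_le_left _ _) hwσ
  have h5 : min σ (-ν) * (n * a ^ 2) ≤ -ν * n * a ^ 2 := by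
    rw [mul_assoc (-ν)]
    gcongr
    exact min_le_right _ _
  have h6 : κ * Q w w ≤ (1 - (1 + κ) * θ) * Q w w := by
    gcongr
    rw [hκ]
    nlinarith
  have h7 := mul_le_mul_of_nonneg_left h1 (by positivity : 0 ≤ 1 + κ)
  have h8 := mul_le_mul_of_nonneg_left (add_le_add h4 h5) hκ0.le
  rw [h2, h3]
  linarith

end Spectral

end Coercivity

/-! ### Absolutely continuous functions and `H¹` on the line -/

/-- `u` is an indefinite integral of the locally integrable function `g`. -/
structure IsPrimitive (u g : ℝ → ℝ) : Prop where
  locallyIntegrable : LocallyIntegrable g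
  sub_eq : ∀ x y, u y - u x = ∫ t in x..y, g t

theorem intervalIntegrable_of_locallyIntegrable {g : ℝ → ℝ} (hg : LocallyIntegrable g) (a b : ℝ) :
    IntervalIntegrable g volume a b :=
  intervalIntegrable_iff.mpr
    ((hg.integrableOn_isCompact isCompact_uIcc).mono_set uIoc_subset_uIcc)

theorem isPrimitive_of_hasDerivAt {u g : ℝ → ℝ} (h : ∀ x, HasDerivAt u (g x) x)
    (hg : Continuous g) : IsPrimitive u g where
  locallyIntegrable := hg.locallyIntegrable
  sub_eq x y := (intervalIntegral.integral_eq_sub_of_hasDerivAt (fun t _ => h t)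
    (hg.intervalIntegrable x y)).symm

theorem isPrimitive_integral {g : ℝ → ℝ} (hg : LocallyIntegrable g) (a : ℝ) :
    IsPrimitive (fun x => ∫ t in a..x, g t) g where
  locallyIntegrable := hg
  sub_eq _ _ := intervalIntegral.integral_interval_sub_left
    (intervalIntegrable_of_locallyIntegrable hg _ _)
    (intervalIntegrable_of_locallyIntegrable hg _ _)

namespace IsPrimitive

variable {u v f g : ℝ → ℝ}

theorem intervalIntegrable (h : IsPrimitive u f) (a b : ℝ) : IntervalIntegrable f volume a b :=
  intervalIntegrable_of_locallyIntegrable h.locallyIntegrable a b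

theorem eq_add (h : IsPrimitive u f) (a : ℝ) : u = fun x => u a + ∫ t in a..x, f t := by
  ext x
  rw [← h.sub_eq a x]
  ring

theorem absolutelyContinuousOnInterval (h : IsPrimitive u f) (a b : ℝ) :
    AbsolutelyContinuousOnInterval u a b := by
  rw [h.eq_add a]
  have h1 : AbsolutelyContinuousOnInterval (fun _ : ℝ => u a) a b :=
    ContDiffOn.absolutelyContinuousOnInterval contDiffOn_const
  exact h1.add ((h.intervalIntegrable a b).absolutelyContinuousOnInterval_intervalIntegral
    left_mem_uIcc)

theorem continuous (h : IsPrimitive u f) : Continuous u := by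
  rw [h.eq_add 0]
  exact continuous_const.add (intervalIntegral.continuous_primitive h.intervalIntegrable 0)

theorem ae_hasDerivAt (h : IsPrimitive u f) : ∀ᵐ x, HasDerivAt u (f x) x := by
  filter_upwards [_root_.LocallyIntegrable.ae_hasDerivAt_integral h.locallyIntegrable] with x hx
  rw [h.eq_add 0]
  exact (hx 0).const_add _

theorem mul (hu : IsPrimitive u f) (hv : IsPrimitive v g) :
    IsPrimitive (fun x => u x * v x) (fun x => f x * v x + u x * g x) where
  locallyIntegrable :=
    (hu.locallyIntegrable.mul_continuous hv.continuous).add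
      (hv.locallyIntegrable.continuous_mul hu.continuous)
  sub_eq a b := by
    rw [← (hu.absolutelyContinuousOnInterval a b).integral_deriv_mul_eq_sub
      (hv.absolutelyContinuousOnInterval a b)]
    apply intervalIntegral.integral_congr_ae
    filter_upwards [hu.ae_hasDerivAt, hv.ae_hasDerivAt] with x h1 h2 _
    rw [h1.deriv, h2.deriv]

theorem add (hu : IsPrimitive u f) (hv : IsPrimitive v g) :
    IsPrimitive (fun x => u x + v x) (fun x => f x + g x) where
  locallyIntegrable := hu.locallyIntegrable.add hv.locallyIntegrable
  sub_eq a b := by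
    rw [intervalIntegral.integral_add (hu.intervalIntegrable a b) (hv.intervalIntegrable a b),
      ← hu.sub_eq, ← hv.sub_eq]
    ring

theorem const_mul (hu : IsPrimitive u f) (t : ℝ) :
    IsPrimitive (fun x => t * u x) (fun x => t * f x) where
  locallyIntegrable := hu.locallyIntegrable.smul t
  sub_eq a b := by
    rw [intervalIntegral.integral_const_mul, ← hu.sub_eq]
    ring

theorem add_const (hu : IsPrimitive u f) (t : ℝ) : IsPrimitive (fun x => u x + t) f where
  locallyIntegrable := hu.locallyIntegrable
  sub_eq a b := by rw [← hu.sub_eq]; ring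

theorem isWeakDeriv (hu : IsPrimitive u f) : IsWeakDeriv u f := by
  refine ⟨hu.continuous.locallyIntegrable, hu.locallyIntegrable, fun ψ hψ hc => ?_⟩
  have hψ1 : IsPrimitive ψ (deriv ψ) := isPrimitive_of_hasDerivAt
    (fun x => (hψ.differentiable (by simp) x).hasDerivAt) (hψ.continuous_deriv (by simp))
  have hi1 : Integrable (fun x => f x * ψ x) := by
    simpa [mul_comm] using
      hu.locallyIntegrable.integrable_smul_left_of_hasCompactSupport hψ.continuous hc
  have hi2 : Integrable (fun x => u x * deriv ψ x) :=
    (hu.continuous.mul (hψ.continuous_deriv (by simp))).integrable_of_hasCompactSupport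
      (hc.deriv.mul_left)
  have hp := hu.mul hψ1
  have h1 := intervalIntegral_tendsto_integral (hi1.add hi2) tendsto_neg_atTop_atBot tendsto_id
  have h0 : Tendsto (fun R : ℝ => ∫ x in (-R)..R, (f x * ψ x + u x * deriv ψ x)) atTop (𝓝 0) := by
    apply tendsto_const_nhds.congr'
    obtain ⟨C, hC⟩ := hc.isCompact.isBounded.exists_norm_le
    filter_upwards [eventually_gt_atTop C, eventually_gt_atTop 0] with R hR hR0
    rw [← hp.sub_eq]
    have e : ∀ y, C < ‖y‖ → ψ y = 0 := fun y hy => by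
      by_contra hne
      exact absurd (hC y (subset_tsupport _ hne)) (not_le.2 hy)
    rw [e R (by rwa [Real.norm_of_nonneg hR0.le]),
      e (-R) (by rwa [norm_neg, Real.norm_of_nonneg hR0.le])]
    simp
  have h2 := tendsto_nhds_unique h1 h0
  have h3 := integral_add hi1 hi2
  simp only [Pi.add_apply] at h2
  rw [h3] at h2
  linarith

end IsPrimitive

theorem IsWeakDeriv.ae_unique {u g g' : ℝ → ℝ} (h : IsWeakDeriv u g) (h' : IsWeakDeriv u g') :
    g =ᵐ[volume] g' := by
  refine ae_eq_of_integral_contDiff_smul_eq h.2.1 h'.2.1 fun ψ hψ hc => ?_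
  have h1 := h.2.2 ψ hψ hc
  have h2 := h'.2.2 ψ hψ hc
  simp only [smul_eq_mul, mul_comm (ψ _)]
  linarith

theorem weakDeriv_ae_eq {u g : ℝ → ℝ} (h : IsWeakDeriv u g) : weakDeriv u =ᵐ[volume] g := by
  have he : ∃ g, IsWeakDeriv u g := ⟨g, h⟩
  rw [weakDeriv, dif_pos he]
  exact he.choose_spec.ae_unique h

theorem isWeakDeriv_weakDeriv {u g : ℝ → ℝ} (h : IsWeakDeriv u g) :
    IsWeakDeriv u (weakDeriv u) := by
  have he : ∃ g, IsWeakDeriv u g := ⟨g, h⟩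
  rw [weakDeriv, dif_pos he]
  exact he.choose_spec

/-- A test function with integral zero is the derivative of a test function. -/
theorem exists_testFunction_deriv_eq {θ : ℝ → ℝ} (hθ : ContDiff ℝ ∞ θ) (hc : HasCompactSupport θ)
    (h0 : ∫ x, θ x = 0) :
    ∃ ψ : ℝ → ℝ, ContDiff ℝ ∞ ψ ∧ HasCompactSupport ψ ∧ deriv ψ = θ := by
  obtain ⟨C, hC⟩ := hc.isCompact.isBounded.exists_norm_le
  set R := |C| + 1 with hR
  have hR0 : 0 < R := by positivity
  have e : ∀ y, R ≤ |y| → θ y = 0 := fun y hy => by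
    by_contra hne
    have h1 := hC y (subset_tsupport _ hne)
    rw [Real.norm_eq_abs] at h1
    have := le_abs_self C
    linarith
  have hi : Integrable θ := hθ.continuous.integrable_of_hasCompactSupport hc
  have hd : ∀ x, HasDerivAt (fun x => ∫ t in (-R)..x, θ t) (θ x) x := fun x =>
    intervalIntegral.integral_hasDerivAt_right (hθ.continuous.intervalIntegrable _ _)
      (hθ.continuous.stronglyMeasurableAtFilter _ _) hθ.continuous.continuousAt
  have hderiv : deriv (fun x => ∫ t in (-R)..x, θ t) = θ := funext fun x => (hd x).deriv
  refine ⟨fun x => ∫ t in (-R)..x, θ t, ?_, ?_, hderiv⟩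
  · rw [contDiff_infty_iff_deriv, hderiv]
    exact ⟨fun x => (hd x).differentiableAt, hθ⟩
  · refine HasCompactSupport.intro (isCompact_Icc (a := -R) (b := R)) fun x hx => ?_
    rw [mem_Icc, not_and_or, not_le, not_le] at hx
    rcases hx with hx | hx
    · rw [intervalIntegral.integral_congr (g := fun _ => 0)]
      · simp
      · intro t ht
        rw [uIcc_of_ge hx.le] at ht
        exact e t (by rw [abs_of_neg (by linarith [ht.2])]; linarith [ht.2])
    · have h1 : ∫ t in (-R)..x, θ t = ∫ t, θ t := by
        apply intervalIntegral.integral_eq_integral_of_support_subset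
        intro t ht
        have : ¬ R ≤ |t| := fun h => ht (e t h)
        rw [not_le, abs_lt] at this
        exact ⟨this.1, by linarith [this.2]⟩
      rw [h1, h0]

/-- Functions with a locally integrable weak derivative are absolutely continuous, up to a null
set (the lemma of du Bois-Reymond). -/
theorem IsWeakDeriv.exists_isPrimitive {u g : ℝ → ℝ} (h : IsWeakDeriv u g) :
    ∃ U : ℝ → ℝ, IsPrimitive U g ∧ u =ᵐ[volume] U := by
  have hP := isPrimitive_integral h.2.1 0
  set P : ℝ → ℝ := fun x => ∫ t in (0 : ℝ)..x, g t with hPdef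
  have hPw := hP.isWeakDeriv
  let b : ContDiffBump (0 : ℝ) := ⟨1, 2, by norm_num, by norm_num⟩
  set ψ₀ : ℝ → ℝ := b.normed volume with hψ₀
  have hs₀ : ContDiff ℝ ∞ ψ₀ := b.contDiff_normed
  have hc₀ : HasCompactSupport ψ₀ := b.hasCompactSupport_normed
  have hi₀ : ∫ x, ψ₀ x = 1 := b.integral_normed
  have hDloc : LocallyIntegrable (fun x => u x - P x) := h.1.sub hPw.1
  have hint : ∀ w : ℝ → ℝ, LocallyIntegrable w → ∀ ψ : ℝ → ℝ, ContDiff ℝ ∞ ψ →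
      HasCompactSupport ψ → Integrable (fun x => w x * ψ x) := fun w hw ψ hψ hc => by
    simpa [mul_comm] using hw.integrable_smul_left_of_hasCompactSupport hψ.continuous hc
  have hD : ∀ ψ : ℝ → ℝ, ContDiff ℝ ∞ ψ → HasCompactSupport ψ →
      ∫ x, (u x - P x) * deriv ψ x = 0 := by
    intro ψ hψ hc
    have hψ' : ContDiff ℝ ∞ (deriv ψ) := (contDiff_infty_iff_deriv.1 hψ).2
    simp only [sub_mul]
    rw [integral_sub (hint u h.1 _ hψ' hc.deriv) (hint P hPw.1 _ hψ' hc.deriv),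
      h.2.2 ψ hψ hc, hPw.2.2 ψ hψ hc, sub_self]
  set κ : ℝ := ∫ x, (u x - P x) * ψ₀ x with hκ
  have hconst : ∀ᵐ x, u x - P x = κ := by
    refine ae_eq_of_integral_contDiff_smul_eq hDloc (locallyIntegrable_const κ)
      fun ψ hψ hc => ?_
    have hiψ : Integrable ψ := hψ.continuous.integrable_of_hasCompactSupport hc
    have hi₀' : Integrable ψ₀ := hs₀.continuous.integrable_of_hasCompactSupport hc₀
    set s : ℝ := ∫ x, ψ x with hs
    obtain ⟨Ψ, h1, h2, h3⟩ := exists_testFunction_deriv_eq (θ := fun x => ψ x - s * ψ₀ x)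
      (hψ.sub (contDiff_const.mul hs₀)) (hc.sub (hc₀.mul_left))
      (by rw [integral_sub hiψ (hi₀'.const_mul s), integral_const_mul, hi₀]; simp [hs])
    have h4 := hD Ψ h1 h2
    rw [h3] at h4
    have h5 : ∀ x, (u x - P x) * (ψ x - s * ψ₀ x)
        = (u x - P x) * ψ x - s * ((u x - P x) * ψ₀ x) := fun x => by ring
    simp only [h5] at h4
    rw [integral_sub (hint _ hDloc _ hψ hc) ((hint _ hDloc _ hs₀ hc₀).const_mul s),
      integral_const_mul, ← hκ] at h4
    simp only [smul_eq_mul, mul_comm (ψ _)]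
    rw [integral_const_mul]
    linarith
  refine ⟨fun x => P x + κ, hP.add_const κ, ?_⟩
  filter_upwards [hconst] with x hx
  linarith

theorem IsWeakDeriv.isPrimitive {u g : ℝ → ℝ} (h : IsWeakDeriv u g) (hu : Continuous u) :
    IsPrimitive u g := by
  obtain ⟨U, hU, hae⟩ := h.exists_isPrimitive
  have : u = U := (hu.ae_eq_iff_eq volume hU.continuous).1 hae
  rwa [this]

theorem isWeakDeriv_congr {u u' g g' : ℝ → ℝ} (h : IsWeakDeriv u g) (hu : u =ᵐ[volume] u')
    (hg : g =ᵐ[volume] g') : IsWeakDeriv u' g' := by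
  refine ⟨h.1.congr hu, h.2.1.congr hg, fun ψ hψ hc => ?_⟩
  have e1 : ∫ x, u' x * deriv ψ x = ∫ x, u x * deriv ψ x :=
    integral_congr_ae (by filter_upwards [hu] with x hx; rw [hx])
  have e2 : ∫ x, g' x * ψ x = ∫ x, g x * ψ x :=
    integral_congr_ae (by filter_upwards [hg] with x hx; rw [hx])
  rw [e1, e2, h.2.2 ψ hψ hc]

/-- The continuous function `u` lies in `H¹(ℝ)` and has derivative `g`. -/
structure IsH1 (u g : ℝ → ℝ) : Prop extends IsPrimitive u g where
  memLp : MemLp u 2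
  memLp_deriv : MemLp g 2

theorem integrable_mul_of_memLp {f g : ℝ → ℝ} (hf : MemLp f 2) (hg : MemLp g 2) :
    Integrable (fun x => f x * g x) := hf.integrable_mul hg

theorem integrable_sq_of_memLp {f : ℝ → ℝ} (hf : MemLp f 2) : Integrable (fun x => f x ^ 2) :=
  hf.integrable_sq

namespace IsH1

variable {u v f g : ℝ → ℝ}

theorem add (hu : IsH1 u f) (hv : IsH1 v g) : IsH1 (fun x => u x + v x) (fun x => f x + g x) where
  toIsPrimitive := hu.toIsPrimitive.add hv.toIsPrimitive
  memLp := hu.memLp.add hv.memLp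
  memLp_deriv := hu.memLp_deriv.add hv.memLp_deriv

theorem const_mul (hu : IsH1 u f) (t : ℝ) : IsH1 (fun x => t * u x) (fun x => t * f x) where
  toIsPrimitive := hu.toIsPrimitive.const_mul t
  memLp := hu.memLp.const_mul t
  memLp_deriv := hu.memLp_deriv.const_mul t

theorem sub (hu : IsH1 u f) (hv : IsH1 v g) :
    IsH1 (fun x => u x - v x) (fun x => f x - g x) := by
  simpa [sub_eq_add_neg] using hu.add (hv.const_mul (-1))

theorem comp_add_right (hu : IsH1 u f) (s : ℝ) :
    IsH1 (fun x => u (x + s)) (fun x => f (x + s)) where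
  locallyIntegrable := by
    have := (hu.memLp_deriv.comp_measurePreserving (measurePreserving_add_right volume s))
    exact this.locallyIntegrable (by norm_num)
  sub_eq a b := by
    rw [intervalIntegral.integral_comp_add_right (fun x => f x) s, hu.sub_eq]
  memLp := hu.memLp.comp_measurePreserving (measurePreserving_add_right volume s)
  memLp_deriv := hu.memLp_deriv.comp_measurePreserving (measurePreserving_add_right volume s)

/-- `u²` has the integrable derivative `2 u u'`, so it converges at infinity; being integrable, it
tends to `0`. -/
theorem tendsto_zero_aux (hu : IsH1 u f) :
    Tendsto u atTop (𝓝 0) ∧ Tendsto u atBot (𝓝 0) := by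
  have hp := hu.toIsPrimitive.mul hu.toIsPrimitive
  have hi : Integrable (fun x => f x * u x + u x * f x) :=
    (integrable_mul_of_memLp hu.memLp_deriv hu.memLp).add
      (integrable_mul_of_memLp hu.memLp hu.memLp_deriv)
  have hsq : Integrable (fun x => u x * u x) := integrable_mul_of_memLp hu.memLp hu.memLp
  have key : ∀ l : Filter ℝ, (∀ s ∈ l, volume s = ⊤) →
      (∃ L, Tendsto (fun x => u x * u x) l (𝓝 L)) → Tendsto u l (𝓝 0) := by
    rintro l hl ⟨L, hL⟩
    have h0 : L = 0 := IntegrableAtFilter.eq_zero_of_tendsto (hsq.integrableAtFilter l) hl hL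
    rw [h0] at hL
    have := hL.sqrt
    rw [Real.sqrt_zero] at this
    simp only [Real.sqrt_mul_self_eq_abs] at this
    exact (tendsto_zero_iff_abs_tendsto_zero _).2 this
  refine ⟨key atTop ?_ ?_, key atBot ?_ ?_⟩
  · intro s hs
    obtain ⟨b, hb⟩ := mem_atTop_sets.1 hs
    exact measure_mono_top (s₁ := Ici b) hb Real.volume_Ici
  · refine ⟨u 0 * u 0 + ∫ x in Ioi (0 : ℝ), (f x * u x + u x * f x), ?_⟩
    have h1 := intervalIntegral_tendsto_integral_Ioi 0 hi.integrableOn tendsto_id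
    refine (h1.const_add (u 0 * u 0)).congr fun x => ?_
    rw [id, ← hp.sub_eq]
    ring
  · intro s hs
    obtain ⟨b, hb⟩ := mem_atBot_sets.1 hs
    exact measure_mono_top (s₁ := Iic b) hb Real.volume_Iic
  · refine ⟨u 0 * u 0 - ∫ x in Iic (0 : ℝ), (f x * u x + u x * f x), ?_⟩
    have h1 := intervalIntegral_tendsto_integral_Iic 0 hi.integrableOn tendsto_id
    refine (h1.const_sub (u 0 * u 0)).congr fun x => ?_
    rw [id, ← hp.sub_eq]
    ring

theorem tendsto_atTop (hu : IsH1 u f) : Tendsto u atTop (𝓝 0) := hu.tendsto_zero_aux.1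

theorem tendsto_atBot (hu : IsH1 u f) : Tendsto u atBot (𝓝 0) := hu.tendsto_zero_aux.2

theorem integral_mul_deriv (hu : IsH1 u f) (hv : IsH1 v g) :
    ∫ x, u x * g x = -∫ x, f x * v x := by
  have hp := hu.toIsPrimitive.mul hv.toIsPrimitive
  have hi1 := integrable_mul_of_memLp hu.memLp_deriv hv.memLp
  have hi2 := integrable_mul_of_memLp hu.memLp hv.memLp_deriv
  have h1 := intervalIntegral_tendsto_integral (hi1.add hi2) tendsto_neg_atTop_atBot tendsto_id
  have h0 : Tendsto (fun R : ℝ => ∫ x in (-R)..R, (f x * v x + u x * g x)) atTop (𝓝 0) := by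
    have h2 := (hu.tendsto_atTop.mul hv.tendsto_atTop).sub
      ((hu.tendsto_atBot.mul hv.tendsto_atBot).comp tendsto_neg_atTop_atBot)
    simp only [mul_zero, sub_zero] at h2
    refine h2.congr fun R => ?_
    rw [← hp.sub_eq]
    rfl
  have h2 := tendsto_nhds_unique h1 h0
  simp only [Pi.add_apply] at h2
  rw [integral_add hi1 hi2] at h2
  linarith

/-- The squared `H¹` norm, for the given derivative. -/
theorem sq_le (hu : IsH1 u f) (x : ℝ) : u x ^ 2 ≤ (∫ t, u t ^ 2) + ∫ t, f t ^ 2 := by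
  have hp := hu.toIsPrimitive.mul hu.toIsPrimitive
  have hiu := integrable_sq_of_memLp hu.memLp
  have hif := integrable_sq_of_memLp hu.memLp_deriv
  have hi := hiu.add hif
  rw [← integral_add hiu hif]
  have h1 : ∀ y, x ≤ y → u x ^ 2 ≤ u y ^ 2 + ∫ t, (u t ^ 2 + f t ^ 2) := by
    intro y hy
    have h2 := hp.sub_eq x y
    have h3 : -∫ t in x..y, (f t * u t + u t * f t) ≤ ∫ t, (u t ^ 2 + f t ^ 2) := by
      rw [← intervalIntegral.integral_neg, intervalIntegral.integral_of_le hy]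
      calc ∫ t in Ioc x y, -(f t * u t + u t * f t) ≤ ∫ t in Ioc x y, (u t ^ 2 + f t ^ 2) := by
            refine integral_mono ?_ hi.integrableOn fun t => ?_
            · exact ((integrable_mul_of_memLp hu.memLp_deriv hu.memLp).add
                (integrable_mul_of_memLp hu.memLp hu.memLp_deriv)).neg.integrableOn
            · nlinarith [sq_nonneg (u t + f t)]
        _ ≤ ∫ t, (u t ^ 2 + f t ^ 2) :=
            setIntegral_le_integral hi (Eventually.of_forall fun t => by
              simp only [Pi.zero_apply]; positivity)
    nlinarith
  have h2 : Tendsto (fun y => u y ^ 2 + ∫ t, (u t ^ 2 + f t ^ 2)) atTop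
      (𝓝 (0 ^ 2 + ∫ t, (u t ^ 2 + f t ^ 2))) := (hu.tendsto_atTop.pow 2).add_const _
  have h3 := ge_of_tendsto h2 (by filter_upwards [eventually_ge_atTop x] with y hy using h1 y hy)
  simpa using h3

theorem isWeakDeriv (hu : IsH1 u f) : IsWeakDeriv u f := hu.toIsPrimitive.isWeakDeriv

theorem h1Norm_sq (hu : IsH1 u f) : h1Norm u ^ 2 = (∫ t, u t ^ 2) + ∫ t, f t ^ 2 := by
  have h1 : ∫ t, weakDeriv u t ^ 2 = ∫ t, f t ^ 2 :=
    integral_congr_ae (by filter_upwards [weakDeriv_ae_eq hu.isWeakDeriv] with x hx; rw [hx])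
  rw [h1Norm, Real.sq_sqrt, h1]
  exact add_nonneg (integral_nonneg fun _ => sq_nonneg _) (integral_nonneg fun _ => sq_nonneg _)

end IsH1

theorem isH1_of_memH1 {u : ℝ → ℝ} (h : MemH1 u) (hu : Continuous u) : IsH1 u (weakDeriv u) := by
  obtain ⟨h2, g, hg2, hg⟩ := h
  have hw := isWeakDeriv_weakDeriv hg
  exact ⟨hw.isPrimitive hu, h2, hg2.ae_eq (weakDeriv_ae_eq hg).symm⟩

theorem h1Norm_nonneg (u : ℝ → ℝ) : 0 ≤ h1Norm u := Real.sqrt_nonneg _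

/-! ### The Helmholtz resolvent -/

/-- The Green's function `e^{-|t|} / 2` of `1 - ∂ₓ²`. -/
def green (t : ℝ) : ℝ := Real.exp (-|t|) / 2

theorem helmholtzInv_eq (m : ℝ → ℝ) (x : ℝ) : helmholtzInv m x = ∫ y, green (x - y) * m y := rfl

theorem continuous_green : Continuous green := by unfold green; fun_prop

theorem green_nonneg (t : ℝ) : 0 ≤ green t := by unfold green; positivity

theorem green_le (t : ℝ) : green t ≤ 1 / 2 := by
  unfold green
  have : Real.exp (-|t|) ≤ 1 := Real.exp_le_one_iff.2 (by simp)
  linarith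

theorem green_neg (t : ℝ) : green (-t) = green t := by simp [green]

theorem green_sub_comm (x y : ℝ) : green (x - y) = green (y - x) := by
  rw [← green_neg, neg_sub]

theorem integrable_green : Integrable green := by
  rw [← integrableOn_univ, ← Iic_union_Ioi (a := (0 : ℝ))]
  refine IntegrableOn.union ?_ ?_
  · refine IntegrableOn.congr_fun ((integrableOn_exp_Iic 0).div_const 2) ?_ measurableSet_Iic
    intro t ht
    simp only [green, abs_of_nonpos (mem_Iic.1 ht), neg_neg]
  · refine IntegrableOn.congr_fun ((integrableOn_exp_neg_Ioi 0).div_const 2) ?_ measurableSet_Ioi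
    intro t ht
    simp only [green, abs_of_pos (mem_Ioi.1 ht)]

theorem integral_green : ∫ t, green t = 1 := by
  have h := integral_comp_abs (f := fun t => Real.exp (-t) / 2)
  rw [integral_div (μ := volume.restrict (Ioi 0)), integral_exp_neg_Ioi_zero] at h
  simpa [green] using h

theorem integral_green_sub (x : ℝ) : ∫ y, green (x - y) = 1 := by
  rw [integral_sub_left_eq_self green volume x, integral_green]

theorem integrable_green_sub (x : ℝ) : Integrable (fun y => green (x - y)) :=
  integrable_green.comp_sub_left x

theorem memLp_green_sub (x : ℝ) : MemLp (fun y => green (x - y)) 2 := by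
  have hc : Continuous (fun y => green (x - y)) := by
    have := continuous_green
    fun_prop
  rw [memLp_two_iff_integrable_sq hc.aestronglyMeasurable]
  refine (integrable_green_sub x).mono' (hc.pow 2).aestronglyMeasurable
    (Eventually.of_forall fun y => ?_)
  rw [Real.norm_of_nonneg (sq_nonneg _)]
  nlinarith [green_nonneg (x - y), green_le (x - y)]

theorem integrable_green_mul {v : ℝ → ℝ} (hv : MemLp v 2) (x : ℝ) :
    Integrable (fun y => green (x - y) * v y) :=
  integrable_mul_of_memLp (memLp_green_sub x) hv

theorem helmholtzInv_add {u v : ℝ → ℝ} (hu : MemLp u 2) (hv : MemLp v 2) (x : ℝ) :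
    helmholtzInv (fun y => u y + v y) x = helmholtzInv u x + helmholtzInv v x := by
  simp only [helmholtzInv_eq, mul_add]
  exact integral_add (integrable_green_mul hu x) (integrable_green_mul hv x)

theorem helmholtzInv_add_const {v : ℝ → ℝ} (hv : MemLp v 2) (k x : ℝ) :
    helmholtzInv (fun y => v y + k) x = helmholtzInv v x + k := by
  simp only [helmholtzInv_eq, mul_add]
  rw [integral_add (integrable_green_mul hv x) ((integrable_green_sub x).mul_const k),
    integral_mul_const, integral_green_sub, one_mul]

theorem helmholtzInv_congr {u v : ℝ → ℝ} (h : u =ᵐ[volume] v) :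
    helmholtzInv u = helmholtzInv v := by
  ext x
  exact integral_congr_ae (by filter_upwards [h] with y hy; rw [hy])

theorem helmholtzInv_comp_add_right (v : ℝ → ℝ) (s x : ℝ) :
    helmholtzInv (fun y => v (y + s)) x = helmholtzInv v (x + s) := by
  simp only [helmholtzInv_eq]
  rw [← integral_add_right_eq_self (fun y => green (x + s - y) * v y) s]
  simp

theorem aestronglyMeasurable_helmholtzInv {v : ℝ → ℝ} (hv : AEStronglyMeasurable v) :
    AEStronglyMeasurable (helmholtzInv v) := by
  have h1 : AEStronglyMeasurable (fun p : ℝ × ℝ => green (p.1 - p.2) * v p.2)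
      (volume.prod volume) := by
    refine AEStronglyMeasurable.mul ?_ ?_
    · exact (continuous_green.comp (continuous_fst.sub continuous_snd)).aestronglyMeasurable
    · exact hv.comp_snd
  exact h1.integral_prod_right'

/-- Jensen's inequality for the probability density `green (x - ·)`. -/
theorem helmholtzInv_sq_le {v : ℝ → ℝ} (hv : MemLp v 2) (x : ℝ) :
    helmholtzInv v x ^ 2 ≤ ∫ y, green (x - y) * v y ^ 2 := by
  set s := helmholtzInv v x with hs
  have hi2 : Integrable (fun y => green (x - y) * v y ^ 2) :=
    (integrable_sq_of_memLp hv).bdd_mul (c := 1 / 2)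
      (integrable_green_sub x).aestronglyMeasurable
      (Eventually.of_forall fun y => by
        rw [Real.norm_of_nonneg (green_nonneg _)]; exact green_le _)
  have h0 : 0 ≤ ∫ y, green (x - y) * (v y - s) ^ 2 :=
    integral_nonneg fun y => mul_nonneg (green_nonneg _) (sq_nonneg _)
  have h1 : ∀ y, green (x - y) * (v y - s) ^ 2 =
      green (x - y) * v y ^ 2 - 2 * s * (green (x - y) * v y) + s ^ 2 * green (x - y) :=
    fun y => by ring
  simp only [h1] at h0
  rw [integral_add (f := fun y => green (x - y) * v y ^ 2 - 2 * s * (green (x - y) * v y))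
    (hi2.sub ((integrable_green_mul hv x).const_mul _))
    ((integrable_green_sub x).const_mul _), integral_sub hi2
    ((integrable_green_mul hv x).const_mul _), integral_const_mul, integral_const_mul,
    integral_green_sub, ← helmholtzInv_eq v, ← hs] at h0
  nlinarith

theorem integrable_prod_green_mul {w : ℝ → ℝ} (hw : Integrable w) :
    Integrable (fun p : ℝ × ℝ => green (p.1 - p.2) * w p.2) (volume.prod volume) := by
  have h := hw.convolution_integrand (ContinuousLinearMap.mul ℝ ℝ) integrable_green (μ := volume)
  simpa [mul_comm] using h

/-- `(1 - ∂ₓ²)⁻¹` is a contraction of `L²(ℝ)`. -/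
theorem integrable_helmholtzInv_sq {v : ℝ → ℝ} (hv : MemLp v 2) :
    Integrable (fun x => helmholtzInv v x ^ 2) ∧
      ∫ x, helmholtzInv v x ^ 2 ≤ ∫ x, v x ^ 2 := by
  have hw := integrable_sq_of_memLp hv
  have hp := integrable_prod_green_mul hw
  have hi : Integrable (fun x => ∫ y, green (x - y) * v y ^ 2) := hp.integral_prod_left
  have h1 : Integrable (fun x => helmholtzInv v x ^ 2) :=
    hi.mono' ((aestronglyMeasurable_helmholtzInv hv.1).pow 2) (Eventually.of_forall fun x => by
      rw [Real.norm_of_nonneg (sq_nonneg _)]; exact helmholtzInv_sq_le hv x)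
  refine ⟨h1, (integral_mono h1 hi (helmholtzInv_sq_le hv)).trans_eq ?_⟩
  rw [integral_integral_swap hp]
  refine integral_congr_ae (Eventually.of_forall fun y => ?_)
  simp only [integral_mul_const]
  rw [integral_sub_right_eq_self green, integral_green, one_mul]

theorem memLp_helmholtzInv {v : ℝ → ℝ} (hv : MemLp v 2) : MemLp (helmholtzInv v) 2 :=
  (memLp_two_iff_integrable_sq (aestronglyMeasurable_helmholtzInv hv.1)).2
    (integrable_helmholtzInv_sq hv).1

theorem abs_integral_mul_helmholtzInv_le {u v : ℝ → ℝ} (hu : MemLp u 2) (hv : MemLp v 2) :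
    |∫ x, u x * helmholtzInv v x| ≤ ((∫ x, u x ^ 2) + ∫ x, v x ^ 2) / 2 := by
  have hG := integrable_helmholtzInv_sq hv
  have hu2 := integrable_sq_of_memLp hu
  calc |∫ x, u x * helmholtzInv v x| ≤ ∫ x, |u x * helmholtzInv v x| := abs_integral_le_integral_abs
    _ ≤ ∫ x, (u x ^ 2 + helmholtzInv v x ^ 2) / 2 := by
        refine integral_mono (integrable_mul_of_memLp hu (memLp_helmholtzInv hv)).abs
          ((hu2.add hG.1).div_const 2) fun x => ?_
        rw [abs_le]
        constructor <;>
          nlinarith [sq_nonneg (u x + helmholtzInv v x), sq_nonneg (u x - helmholtzInv v x)]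
    _ = ((∫ x, u x ^ 2) + ∫ x, helmholtzInv v x ^ 2) / 2 := by
        rw [integral_div, integral_add hu2 hG.1]
    _ ≤ _ := by linarith [hG.2]

theorem integral_mul_helmholtzInv_comm {u v : ℝ → ℝ} (hu : MemLp u 2) (hv : MemLp v 2) :
    ∫ x, u x * helmholtzInv v x = ∫ x, v x * helmholtzInv u x := by
  have h1 := integrable_prod_green_mul (integrable_sq_of_memLp hv)
  have h2 := (integrable_prod_green_mul (integrable_sq_of_memLp hu)).swap
  have hmeas : AEStronglyMeasurable (fun p : ℝ × ℝ => u p.1 * (green (p.1 - p.2) * v p.2))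
      (volume.prod volume) := by
    refine hu.1.comp_fst.mul (AEStronglyMeasurable.mul ?_ hv.1.comp_snd)
    exact (continuous_green.comp (continuous_fst.sub continuous_snd)).aestronglyMeasurable
  have hi : Integrable (fun p : ℝ × ℝ => u p.1 * (green (p.1 - p.2) * v p.2))
      (volume.prod volume) := by
    refine (h1.add h2).mono' hmeas (Eventually.of_forall fun p => ?_)
    simp only [Pi.add_apply, Function.comp_apply, Prod.fst_swap, Prod.snd_swap,
      green_sub_comm p.2 p.1, norm_mul, Real.norm_eq_abs, abs_of_nonneg (green_nonneg _)]
    have hg := green_nonneg (p.1 - p.2)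
    have : |u p.1| * |v p.2| ≤ v p.2 ^ 2 + u p.1 ^ 2 := by
      nlinarith [sq_abs (u p.1), sq_abs (v p.2), sq_nonneg (|u p.1| - |v p.2|), abs_nonneg (u p.1),
        abs_nonneg (v p.2)]
    nlinarith
  simp only [helmholtzInv_eq, ← integral_const_mul]
  rw [integral_integral_swap hi]
  refine integral_congr_ae (Eventually.of_forall fun y => ?_)
  refine integral_congr_ae (Eventually.of_forall fun x => ?_)
  simp only [green_sub_comm x y]
  ring

/-! ### The derivative of the Helmholtz resolvent -/

theorem green_sub_of_le {x y : ℝ} (h : y ≤ x) :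
    green (x - y) = Real.exp (-x) / 2 * Real.exp y := by
  rw [green, abs_of_nonneg (by linarith), neg_sub, sub_eq_add_neg, add_comm, Real.exp_add]
  ring

theorem green_sub_of_ge {x y : ℝ} (h : x ≤ y) :
    green (x - y) = Real.exp x / 2 * Real.exp (-y) := by
  rw [green, abs_of_nonpos (by linarith), neg_neg, sub_eq_add_neg, Real.exp_add]
  ring

section Green

variable {v : ℝ → ℝ}

theorem integrableOn_exp_mul_Iic (hi : ∀ x, Integrable (fun y => green (x - y) * v y))
    (x : ℝ) : IntegrableOn (fun y => Real.exp y * v y) (Iic x) := by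
  have h := ((hi x).integrableOn (s := Iic x)).const_mul (2 * Real.exp x)
  refine IntegrableOn.congr_fun h (fun y hy => ?_) measurableSet_Iic
  simp only [green_sub_of_le (mem_Iic.1 hy), Real.exp_neg]
  field_simp

theorem integrableOn_exp_mul_Ioi (hi : ∀ x, Integrable (fun y => green (x - y) * v y))
    (x : ℝ) :
    IntegrableOn (fun y => Real.exp (-y) * v y) (Ioi x) := by
  have h := ((hi x).integrableOn (s := Ioi x)).const_mul (2 * Real.exp (-x))
  refine IntegrableOn.congr_fun h (fun y hy => ?_) measurableSet_Ioi
  simp only [green_sub_of_ge (mem_Ioi.1 hy).le, Real.exp_neg]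
  field_simp

theorem helmholtzInv_eq_half_lines (hi : ∀ x, Integrable (fun y => green (x - y) * v y))
    (x : ℝ) :
    helmholtzInv v x = Real.exp (-x) / 2 * (∫ y in Iic x, Real.exp y * v y)
      + Real.exp x / 2 * ∫ y in Ioi x, Real.exp (-y) * v y := by
  rw [helmholtzInv_eq, ← setIntegral_univ, ← Iic_union_Ioi (a := x),
    setIntegral_union (Iic_disjoint_Ioi le_rfl) measurableSet_Ioi (hi x).integrableOn
      (hi x).integrableOn, ← integral_const_mul, ← integral_const_mul]
  congr 1
  · refine setIntegral_congr_fun measurableSet_Iic fun y hy => ?_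
    simp only [green_sub_of_le (mem_Iic.1 hy), mul_assoc]
  · refine setIntegral_congr_fun measurableSet_Ioi fun y hy => ?_
    simp only [green_sub_of_ge (mem_Ioi.1 hy).le, mul_assoc]

/-- `(1 - ∂ₓ²)⁻¹ (φ - φ'') = φ`. -/
theorem helmholtzInv_sub_deriv_deriv (hi : ∀ x, Integrable (fun y => green (x - y) * v y))
    {φ φ' φ'' : ℝ → ℝ} (h1 : ∀ x, HasDerivAt φ (φ' x) x)
    (h2 : ∀ x, HasDerivAt φ' (φ'' x) x) (hv : ∀ x, v x = φ x - φ'' x) {C : ℝ}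
    (hC : ∀ x, |φ x| ≤ C) (hC' : ∀ x, |φ' x| ≤ C) (x : ℝ) : helmholtzInv v x = φ x := by
  have e1 : ∫ y in Iic x, Real.exp y * v y = Real.exp x * (φ x - φ' x) - 0 := by
    refine integral_Iic_of_hasDerivAt_of_tendsto' (f := fun y => Real.exp y * (φ y - φ' y))
      (fun y _ => ?_) (integrableOn_exp_mul_Iic hi x) ?_
    · refine ((Real.hasDerivAt_exp y).mul ((h1 y).sub (h2 y))).congr_deriv ?_
      rw [hv]
      simp only [Pi.sub_apply]
      ring
    · refine squeeze_zero_norm (a := fun y => Real.exp y * (C + C)) (fun y => ?_) ?_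
      · rw [norm_mul, Real.norm_of_nonneg (Real.exp_pos y).le]
        gcongr
        exact (norm_sub_le _ _).trans (add_le_add (hC y) (hC' y))
      · simpa using Real.tendsto_exp_atBot.mul_const (C + C)
  have e2 : ∫ y in Ioi x, Real.exp (-y) * v y = 0 - (-(Real.exp (-x) * (φ x + φ' x))) := by
    refine integral_Ioi_of_hasDerivAt_of_tendsto'
      (f := fun y => -(Real.exp (-y) * (φ y + φ' y)))
      (fun y _ => ?_) (integrableOn_exp_mul_Ioi hi x) ?_
    · refine (((hasDerivAt_neg y).exp.mul ((h1 y).add (h2 y))).neg).congr_deriv ?_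
      rw [hv]
      simp only [Pi.add_apply]
      ring
    · refine squeeze_zero_norm (a := fun y => Real.exp (-y) * (C + C)) (fun y => ?_) ?_
      · rw [norm_neg, norm_mul, Real.norm_of_nonneg (Real.exp_pos _).le]
        gcongr
        exact (norm_add_le _ _).trans (add_le_add (hC y) (hC' y))
      · simpa using (Real.tendsto_exp_atBot.comp tendsto_neg_atTop_atBot).mul_const (C + C)
  rw [helmholtzInv_eq_half_lines hi, e1, e2, Real.exp_neg]
  field_simp
  ring

theorem hasDerivAt_half_lines (hi : ∀ x, Integrable (fun y => green (x - y) * v y))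
    (hv : Continuous v) (x : ℝ) :
    HasDerivAt (fun x => ∫ y in Iic x, Real.exp y * v y) (Real.exp x * v x) x ∧
    HasDerivAt (fun x => ∫ y in Ioi x, Real.exp (-y) * v y) (-(Real.exp (-x) * v x)) x := by
  have c1 : Continuous fun y => Real.exp y * v y := by fun_prop
  have c2 : Continuous fun y => Real.exp (-y) * v y := by fun_prop
  constructor
  · have e : (fun x => ∫ y in Iic x, Real.exp y * v y) =
        fun x => (∫ y in (0 : ℝ)..x, Real.exp y * v y) + ∫ y in Iic 0, Real.exp y * v y := by
      ext x
      rw [← intervalIntegral.integral_Iic_sub_Iic (integrableOn_exp_mul_Iic hi 0)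
        (integrableOn_exp_mul_Iic hi x)]
      ring
    rw [e]
    exact (intervalIntegral.integral_hasDerivAt_right (c1.intervalIntegrable _ _)
      (c1.stronglyMeasurableAtFilter _ _) c1.continuousAt).add_const _
  · have e : (fun x => ∫ y in Ioi x, Real.exp (-y) * v y) =
        fun x => (∫ y in Ioi 0, Real.exp (-y) * v y) - ∫ y in (0 : ℝ)..x, Real.exp (-y) * v y := by
      ext x
      rw [← intervalIntegral.integral_Ioi_sub_Ioi' (integrableOn_exp_mul_Ioi hi 0)
        (integrableOn_exp_mul_Ioi hi x)]
      ring
    rw [e]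
    exact (intervalIntegral.integral_hasDerivAt_right (c2.intervalIntegrable _ _)
      (c2.stronglyMeasurableAtFilter _ _) c2.continuousAt).const_sub _

theorem continuous_helmholtzInv (hi : ∀ x, Integrable (fun y => green (x - y) * v y))
    (hv : Continuous v) : Continuous (helmholtzInv v) := by
  rw [funext (helmholtzInv_eq_half_lines hi)]
  have h1 : Continuous (fun x => ∫ y in Iic x, Real.exp y * v y) :=
    continuous_iff_continuousAt.2 fun x => (hasDerivAt_half_lines hi hv x).1.continuousAt
  have h2 : Continuous (fun x => ∫ y in Ioi x, Real.exp (-y) * v y) :=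
    continuous_iff_continuousAt.2 fun x => (hasDerivAt_half_lines hi hv x).2.continuousAt
  fun_prop

end Green

/-- `(1 - ∂ₓ²)⁻¹ w` vanishes at infinity when `w` does, by dominated convergence. -/
theorem tendsto_helmholtzInv_zero {w : ℝ → ℝ} (hw : Continuous w) {C : ℝ} (hC : ∀ x, |w x| ≤ C)
    {l : Filter ℝ} [l.IsCountablyGenerated] (hl : ∀ y : ℝ, Tendsto (fun x => x - y) l l)
    (h0 : Tendsto w l (𝓝 0)) : Tendsto (helmholtzInv w) l (𝓝 0) := by
  have e : ∀ x, helmholtzInv w x = ∫ y, green y * w (x - y) := by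
    intro x
    rw [helmholtzInv_eq, ← integral_sub_left_eq_self (fun y => green y * w (x - y)) volume x]
    simp
  have h : Tendsto (fun x => ∫ y, green y * w (x - y)) l (𝓝 (∫ y, green y * (0 : ℝ))) := by
    refine tendsto_integral_filter_of_dominated_convergence (fun y => green y * C) ?_ ?_
      (integrable_green.mul_const C) ?_
    · refine Eventually.of_forall fun x => Continuous.aestronglyMeasurable ?_
      have := continuous_green
      fun_prop
    · refine Eventually.of_forall fun x => Eventually.of_forall fun y => ?_
      rw [norm_mul, Real.norm_of_nonneg (green_nonneg y)]
      exact mul_le_mul_of_nonneg_left (hC _) (green_nonneg y)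
    · exact Eventually.of_forall fun y => (h0.comp (hl y)).const_mul _
  simp only [mul_zero, integral_zero] at h
  exact h.congr fun x => (e x).symm

/-- `∫_{-A}^{B} ((1 - ∂ₓ²)⁻¹ v - v) → 0`: the integrand is `∂ₓ² (1 - ∂ₓ²)⁻¹ v`. -/
theorem IsH1.tendsto_integral_helmholtzInv_sub {v f : ℝ → ℝ} (hv : IsH1 v f) :
    Tendsto (fun p : ℝ × ℝ => ∫ x in (-p.1)..p.2, (helmholtzInv v x - v x)) atTop (𝓝 0) := by
  have hi := integrable_green_mul hv.memLp
  have hc := hv.continuous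
  have hGc := continuous_helmholtzInv hi hc
  set J : ℝ → ℝ := fun x => Real.exp x / 2 * (∫ y in Ioi x, Real.exp (-y) * v y)
    - Real.exp (-x) / 2 * ∫ y in Iic x, Real.exp y * v y with hJ
  have hJd : ∀ x, HasDerivAt J (helmholtzInv v x - v x) x := by
    intro x
    obtain ⟨d1, d2⟩ := hasDerivAt_half_lines hi hc x
    have d3 : HasDerivAt (fun x => Real.exp x / 2) (Real.exp x / 2) x :=
      (Real.hasDerivAt_exp x).div_const 2
    have d4 : HasDerivAt (fun x => Real.exp (-x) / 2) (-(Real.exp (-x) / 2)) x :=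
      ((hasDerivAt_neg x).exp.div_const 2).congr_deriv (by ring)
    refine ((d3.mul d2).sub (d4.mul d1)).congr_deriv ?_
    rw [helmholtzInv_eq_half_lines hi]
    have : Real.exp (-x) * Real.exp x = 1 := by rw [← Real.exp_add]; simp
    linear_combination -(v x) * this
  have habs : MemLp (fun x => |v x|) 2 := hv.memLp.abs
  have hJle : ∀ x, ‖J x‖ ≤ helmholtzInv (fun x => |v x|) x := by
    intro x
    rw [helmholtzInv_eq_half_lines (integrable_green_mul habs), hJ]
    refine (norm_sub_le _ _).trans ?_
    have b1 : ‖∫ y in Ioi x, Real.exp (-y) * v y‖ ≤ ∫ y in Ioi x, Real.exp (-y) * |v y| :=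
      (norm_integral_le_integral_norm _).trans_eq (by simp)
    have b2 : ‖∫ y in Iic x, Real.exp y * v y‖ ≤ ∫ y in Iic x, Real.exp y * |v y| :=
      (norm_integral_le_integral_norm _).trans_eq (by simp)
    rw [add_comm, norm_mul, norm_mul, Real.norm_of_nonneg (by positivity : 0 ≤ Real.exp x / 2),
      Real.norm_of_nonneg (by positivity : 0 ≤ Real.exp (-x) / 2)]
    exact add_le_add (mul_le_mul_of_nonneg_left b2 (by positivity))
      (mul_le_mul_of_nonneg_left b1 (by positivity))
  obtain ⟨C, hC⟩ : ∃ C, ∀ x, |(|v x|)| ≤ C :=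
    ⟨_, fun x => by
      rw [abs_abs]
      exact Real.abs_le_sqrt (hv.sq_le x)⟩
  have hT : Tendsto J atTop (𝓝 0) := squeeze_zero_norm hJle
    (tendsto_helmholtzInv_zero hc.abs hC (fun y => tendsto_atTop_add_const_right _ (-y) tendsto_id)
      (by simpa using hv.tendsto_atTop.abs))
  have hB : Tendsto J atBot (𝓝 0) := squeeze_zero_norm hJle
    (tendsto_helmholtzInv_zero hc.abs hC (fun y => tendsto_atBot_add_const_right _ (-y) tendsto_id)
      (by simpa using hv.tendsto_atBot.abs))
  rw [← prod_atTop_atTop_eq]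
  have h := (hT.comp tendsto_snd).sub
    ((hB.comp tendsto_neg_atTop_atBot).comp
      (tendsto_fst (f := atTop (α := ℝ)) (g := atTop (α := ℝ))))
  rw [sub_zero] at h
  refine h.congr fun p => ?_
  rw [intervalIntegral.integral_eq_sub_of_hasDerivAt (fun x _ => hJd x)
    ((hGc.sub hc).intervalIntegrable _ _)]
  rfl

/-! ### The profile equation -/

theorem bounded_of_tendsto {f : ℝ → ℝ} (hf : Continuous f) {a b : ℝ} (h1 : Tendsto f atTop (𝓝 a))
    (h2 : Tendsto f atBot (𝓝 b)) : ∃ C, ∀ x, |f x| ≤ C := by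
  obtain ⟨R, hR⟩ := eventually_atTop.1 ((h1.abs).eventually_le_const (lt_add_one |a|))
  obtain ⟨R', hR'⟩ := eventually_atBot.1 ((h2.abs).eventually_le_const (lt_add_one |b|))
  obtain ⟨C, hC⟩ := (isCompact_Icc (a := R') (b := R)).exists_bound_of_continuousOn
    hf.continuousOn
  refine ⟨max C (max (|a| + 1) (|b| + 1)), fun x => ?_⟩
  rcases le_total x R' with h | h
  · exact (hR' x h).trans ((le_max_right _ _).trans (le_max_right _ _))
  rcases le_total R x with h' | h'
  · exact (hR x h').trans ((le_max_left _ _).trans (le_max_right _ _))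
  · exact (hC x ⟨h, h'⟩).trans (le_max_left _ _)

/-- If `f` converges at infinity, its derivative tends to `0` along some sequence. -/
theorem eq_of_tendsto_comp_deriv {f f' F : ℝ → ℝ} (hf : ∀ x, HasDerivAt f (f' x) x) {ℓ N : ℝ}
    (hℓ : Tendsto f atTop (𝓝 ℓ)) (hF : Continuous F)
    (hN : Tendsto (fun x => F (f' x)) atTop (𝓝 N)) : F 0 = N := by
  have h1 : ∀ n : ℕ, ∃ ξ : ℝ, (n : ℝ) < ξ ∧ f' ξ = f (n + 1) - f n := by
    intro n
    obtain ⟨ξ, hξ, h⟩ := exists_hasDerivAt_eq_slope f f' (lt_add_one (n : ℝ))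
      (fun x _ => (hf x).continuousAt.continuousWithinAt) (fun x _ => hf x)
    exact ⟨ξ, hξ.1, by rw [h]; simp⟩
  choose ξ hξ hξ' using h1
  have h2 : Tendsto ξ atTop atTop :=
    tendsto_atTop_mono (fun n => (hξ n).le) tendsto_natCast_atTop_atTop
  have h3 : Tendsto (fun n => f' (ξ n)) atTop (𝓝 0) := by
    simp only [hξ']
    have ha : Tendsto (fun n : ℕ => f ((n : ℝ) + 1)) atTop (𝓝 ℓ) :=
      hℓ.comp (tendsto_atTop_add_const_right _ 1 tendsto_natCast_atTop_atTop)
    have hb : Tendsto (fun n : ℕ => f (n : ℝ)) atTop (𝓝 ℓ) :=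
      hℓ.comp tendsto_natCast_atTop_atTop
    simpa using ha.sub hb
  exact tendsto_nhds_unique ((hF.tendsto 0).comp h3) (hN.comp h2)

/-- `√(c - φ²)`. -/
def wavegap (c : ℝ) (φ : ℝ → ℝ) (x : ℝ) : ℝ := √(c - φ x ^ 2)

theorem sq_lt_of_lt_sqrt {c k : ℝ} (hc : 0 < c) (hk : 0 < k) (hkc : k < √c / 2) :
    4 * k ^ 2 < c := by
  have h1 : 0 < √c := Real.sqrt_pos.2 hc
  have h2 := Real.sq_sqrt hc.le
  nlinarith

namespace IsSmoothSolitaryWave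

variable {c k : ℝ} {φ : ℝ → ℝ}

theorem hasDerivAt_iteratedDeriv (h : IsSmoothSolitaryWave c k φ) (n : ℕ) (x : ℝ) :
    HasDerivAt (iteratedDeriv n φ) (iteratedDeriv (n + 1) φ x) x := by
  rw [iteratedDeriv_succ]
  have := h.smooth.differentiable_iteratedDeriv n (by exact_mod_cast WithTop.coe_lt_top n)
  exact (this x).hasDerivAt

theorem hasDerivAt (h : IsSmoothSolitaryWave c k φ) (x : ℝ) :
    HasDerivAt φ (iteratedDeriv 1 φ x) x := by
  simpa using h.hasDerivAt_iteratedDeriv 0 x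

theorem continuous_iteratedDeriv (h : IsSmoothSolitaryWave c k φ) (n : ℕ) :
    Continuous (iteratedDeriv n φ) :=
  continuous_iff_continuousAt.2 fun x => (h.hasDerivAt_iteratedDeriv n x).continuousAt

/-- The travelling-wave equation, as a first-order equation for the momentum density:
`(c - φ²) μ' = 3 φ φ' μ`. -/
theorem profile_ode (h : IsSmoothSolitaryWave c k φ) (x : ℝ) :
    (c - φ x ^ 2) * (iteratedDeriv 1 φ x - iteratedDeriv 3 φ x) =
      3 * φ x * iteratedDeriv 1 φ x * momentum φ x := by
  have hs := h.solution x 0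
  simp only at hs
  have e1 : ∀ (f f' : ℝ → ℝ), (∀ y, HasDerivAt f (f' y) y) →
      deriv (fun s : ℝ => f (x - c * s)) 0 = -c * f' x := by
    intro f f' hf
    have h1 : HasDerivAt (fun s : ℝ => x - c * s) (-c) 0 := by
      simpa using ((hasDerivAt_id (0 : ℝ)).const_mul c).const_sub x
    have h2 := HasDerivAt.scomp (g₁ := f) (h := fun s : ℝ => x - c * s) (0 : ℝ)
      (hf (x - c * 0)) h1
    have h3 := h2.deriv
    simp only [Function.comp_def, smul_eq_mul, mul_zero, sub_zero] at h3
    exact h3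
  have e2 : ∀ n s, iteratedDeriv n (fun y => φ (y - c * s)) x = iteratedDeriv n φ (x - c * s) :=
    fun n s => by rw [iteratedDeriv_comp_sub_const]
  have e3 : deriv (fun y => φ (y - c * 0)) x = iteratedDeriv 1 φ x := by
    rw [mul_zero, iteratedDeriv_one]
    simp
  rw [e3] at hs
  simp only [e2] at hs
  rw [e1 φ _ h.hasDerivAt, e1 _ _ (h.hasDerivAt_iteratedDeriv 2)] at hs
  simp only [mul_zero, sub_zero] at hs
  unfold momentum
  linear_combination -hs

theorem wavegap_pos (h : IsSmoothSolitaryWave c k φ) (x : ℝ) : 0 < wavegap c φ x :=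
  Real.sqrt_pos.2 (by linarith [h.sq_lt x])

theorem wavegap_sq (h : IsSmoothSolitaryWave c k φ) (x : ℝ) :
    wavegap c φ x ^ 2 = c - φ x ^ 2 :=
  Real.sq_sqrt (by linarith [h.sq_lt x])

theorem hasDerivAt_wavegap (h : IsSmoothSolitaryWave c k φ) (x : ℝ) :
    HasDerivAt (wavegap c φ) (-(φ x * iteratedDeriv 1 φ x) / wavegap c φ x) x := by
  have h1 : HasDerivAt (fun x => c - φ x ^ 2) (-(2 * φ x * iteratedDeriv 1 φ x)) x := by
    refine (((h.hasDerivAt x).pow 2).const_sub c).congr_deriv ?_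
    simp
  have h2 := h1.sqrt (by linarith [h.sq_lt x])
  refine h2.congr_deriv ?_
  have := h.wavegap_pos x
  unfold wavegap at this ⊢
  field_simp

theorem hasDerivAt_momentum (h : IsSmoothSolitaryWave c k φ) (x : ℝ) :
    HasDerivAt (momentum φ) (iteratedDeriv 1 φ x - iteratedDeriv 3 φ x) x :=
  (h.hasDerivAt x).sub (h.hasDerivAt_iteratedDeriv 2 x)

theorem continuous_momentum (h : IsSmoothSolitaryWave c k φ) : Continuous (momentum φ) :=
  continuous_iff_continuousAt.2 fun x => (h.hasDerivAt_momentum x).continuousAt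

theorem continuous_wavegap (h : IsSmoothSolitaryWave c k φ) : Continuous (wavegap c φ) :=
  continuous_iff_continuousAt.2 fun x => (h.hasDerivAt_wavegap x).continuousAt

/-- The first integral `μ (c - φ²)^{3/2}`. -/
theorem exists_momentum_mul_eq (h : IsSmoothSolitaryWave c k φ) :
    ∃ A, ∀ x, momentum φ x * wavegap c φ x ^ 3 = A := by
  refine ⟨momentum φ 0 * wavegap c φ 0 ^ 3, fun x => ?_⟩
  have hd : ∀ x, HasDerivAt (fun x => momentum φ x * wavegap c φ x ^ 3) 0 x := by
    intro x
    refine ((h.hasDerivAt_momentum x).mul ((h.hasDerivAt_wavegap x).pow 3)).congr_deriv ?_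
    have h1 := h.wavegap_pos x
    have h2 := h.wavegap_sq x
    have h3 := h.profile_ode x
    rw [← h2] at h3
    simp only [Nat.cast_ofNat, Nat.add_one_sub_one, Pi.pow_apply]
    field_simp
    linear_combination wavegap c φ x * h3
  exact is_const_of_deriv_eq_zero (fun x => (hd x).differentiableAt) (fun x => (hd x).deriv) x 0

/-- The energy integral of `φ'' = φ - A (c - φ²)^{-3/2}`. -/
theorem energy_eq {A : ℝ} (h : IsSmoothSolitaryWave c k φ)
    (hc : 0 < c) (hA : ∀ x, momentum φ x * wavegap c φ x ^ 3 = A) :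
    ∃ e, ∀ x, iteratedDeriv 1 φ x ^ 2 = e + φ x ^ 2 - 2 * A * φ x / (c * wavegap c φ x) := by
  set g : ℝ → ℝ := fun x =>
    iteratedDeriv 1 φ x ^ 2 - φ x ^ 2 + 2 * A * φ x / (c * wavegap c φ x) with hg
  have hd : ∀ x, HasDerivAt g 0 x := by
    intro x
    have h1 := h.wavegap_pos x
    refine ((((h.hasDerivAt_iteratedDeriv 1 x).pow 2).sub ((h.hasDerivAt x).pow 2)).add
      (((h.hasDerivAt x).const_mul (2 * A)).div ((h.hasDerivAt_wavegap x).const_mul c)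
        (by positivity))).congr_deriv ?_
    have h2 := h.wavegap_sq x
    have h4 : iteratedDeriv (1 + 1) φ x = φ x - momentum φ x := by unfold momentum; ring_nf
    rw [h4, ← hA x]
    simp only [Nat.cast_ofNat, Nat.add_one_sub_one, pow_one]
    have h5 : c = wavegap c φ x ^ 2 + φ x ^ 2 := by linarith
    set S := wavegap c φ x
    field_simp
    rw [h5]
    ring
  refine ⟨g 0, fun x => ?_⟩
  have := is_const_of_deriv_eq_zero (fun x => (hd x).differentiableAt) (fun x => (hd x).deriv) x 0
  rw [← this, hg]
  ring

theorem tendsto_wavegap {l : Filter ℝ} (hl : Tendsto φ l (𝓝 k)) :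
    Tendsto (wavegap c φ) l (𝓝 (√(c - k ^ 2))) :=
  ((hl.pow 2).const_sub c).sqrt

theorem momentum_tendsto {A : ℝ} (h : IsSmoothSolitaryWave c k φ) (hkc : k ^ 2 < c)
    (hA : ∀ x, momentum φ x * wavegap c φ x ^ 3 = A) {l : Filter ℝ} (hl : Tendsto φ l (𝓝 k)) :
    Tendsto (momentum φ) l (𝓝 (A / √(c - k ^ 2) ^ 3)) := by
  have hs : 0 < √(c - k ^ 2) := Real.sqrt_pos.2 (by linarith)
  have e : ∀ x, momentum φ x = A / wavegap c φ x ^ 3 := fun x => by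
    rw [← hA x]
    have := h.wavegap_pos x
    field_simp
  rw [funext e]
  exact tendsto_const_nhds.div ((tendsto_wavegap hl).pow 3) (by positivity)

/-- The constants of the two first integrals: `a = k (c - k²)^{3/2}` and the energy level `E`, read
off at infinity. -/
theorem profile_eqs (h : IsSmoothSolitaryWave c k φ) (hc : 0 < c) (hkc : k ^ 2 < c) :
    (∀ x, momentum φ x * wavegap c φ x ^ 3 = k * √(c - k ^ 2) ^ 3) ∧
    (∀ x, iteratedDeriv 1 φ x ^ 2 = 2 * EPar c k + φ x ^ 2
      - 2 * (k * √(c - k ^ 2) ^ 3) * φ x / (c * wavegap c φ x)) := by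
  obtain ⟨A, hA⟩ := h.exists_momentum_mul_eq
  obtain ⟨e, he⟩ := h.energy_eq hc hA
  set s := √(c - k ^ 2) with hs'
  have hs : 0 < s := Real.sqrt_pos.2 (by linarith)
  have hss : s ^ 2 = c - k ^ 2 := Real.sq_sqrt (by linarith)
  have h1 : Tendsto (fun x => iteratedDeriv 1 φ x ^ 2) atTop
      (𝓝 (e + k ^ 2 - 2 * A * k / (c * s))) := by
    rw [funext he]
    refine ((h.tendsto_atTop.pow 2).const_add e).sub ?_
    exact (h.tendsto_atTop.const_mul _).div ((tendsto_wavegap h.tendsto_atTop).const_mul c)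
      (by positivity)
  have h2 := eq_of_tendsto_comp_deriv (F := fun y => y ^ 2) h.hasDerivAt h.tendsto_atTop
    (by fun_prop) h1
  rw [← h2] at h1
  have h3 : Tendsto (iteratedDeriv 1 φ) atTop (𝓝 0) := by
    have := h1.sqrt
    simp only [Real.sqrt_sq_eq_abs, abs_zero] at this
    exact (tendsto_zero_iff_abs_tendsto_zero _).2 (by simpa [Function.comp_def] using this)
  have h4 : Tendsto (iteratedDeriv 2 φ) atTop (𝓝 (k - A / s ^ 3)) := by
    have e : iteratedDeriv 2 φ = fun x => φ x - momentum φ x := by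
      ext x; unfold momentum; ring
    rw [e]
    exact h.tendsto_atTop.sub (h.momentum_tendsto hkc hA h.tendsto_atTop)
  have h5 := eq_of_tendsto_comp_deriv (F := fun y => y) (h.hasDerivAt_iteratedDeriv 1) h3
    continuous_id h4
  have hAk : A = k * s ^ 3 := by
    have hne : s ^ 3 ≠ 0 := by positivity
    field_simp at h5
    linarith
  refine ⟨fun x => by rw [hA, hAk], fun x => ?_⟩
  have hek : e = 2 * EPar c k := by
    simp only [hAk] at h2
    have h6 : 2 * (k * s ^ 3) * k / (c * s) = 2 * k ^ 2 * (c - k ^ 2) / c := by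
      rw [← hss]; field_simp
    rw [h6] at h2
    unfold EPar
    field_simp at h2 ⊢
    linarith
  rw [he x, hek, hAk]

theorem tendsto_derivs (h : IsSmoothSolitaryWave c k φ) (hc : 0 < c) (hkc : k ^ 2 < c)
    {l : Filter ℝ} (hl : Tendsto φ l (𝓝 k)) :
    Tendsto (momentum φ) l (𝓝 k) ∧ Tendsto (iteratedDeriv 1 φ) l (𝓝 0) ∧
      Tendsto (iteratedDeriv 2 φ) l (𝓝 0) := by
  obtain ⟨hA, he⟩ := h.profile_eqs hc hkc
  have hs : 0 < √(c - k ^ 2) := Real.sqrt_pos.2 (by linarith)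
  have hss : √(c - k ^ 2) ^ 2 = c - k ^ 2 := Real.sq_sqrt (by linarith)
  have h1 := h.momentum_tendsto hkc hA hl
  rw [mul_div_assoc, div_self (by positivity), mul_one] at h1
  refine ⟨h1, ?_, ?_⟩
  · have h2 : Tendsto (fun x => iteratedDeriv 1 φ x ^ 2) l (𝓝 0) := by
      rw [funext he]
      have h3 : 2 * EPar c k + k ^ 2 - 2 * (k * √(c - k ^ 2) ^ 3) * k / (c * √(c - k ^ 2)) = 0 := by
        have h6 : 2 * (k * √(c - k ^ 2) ^ 3) * k / (c * √(c - k ^ 2)) =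
            2 * k ^ 2 * (c - k ^ 2) / c := by
          field_simp; rw [hss]
        rw [h6]
        unfold EPar
        field_simp
        ring
      rw [← h3]
      refine ((hl.pow 2).const_add _).sub ?_
      exact (hl.const_mul _).div ((tendsto_wavegap hl).const_mul c) (by positivity)
    have := h2.sqrt
    simp only [Real.sqrt_sq_eq_abs, Real.sqrt_zero] at this
    exact (tendsto_zero_iff_abs_tendsto_zero _).2 this
  · have e : iteratedDeriv 2 φ = fun x => φ x - momentum φ x := by
      ext x; unfold momentum; ring
    rw [e]
    simpa using hl.sub h1

end IsSmoothSolitaryWave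

/-! ### Taylor estimates for powers -/

/-- One step of Taylor's formula: a bound on `F'` integrates to a bound on `F` of one order more. -/
theorem abs_le_mul_pow_of_hasDerivAt {F F' : ℝ → ℝ} {lo hi C x y : ℝ} (n : ℕ) (hC : 0 ≤ C)
    (hd : ∀ t ∈ Icc lo hi, HasDerivAt F (F' t) t) (hx : x ∈ Icc lo hi) (hy : y ∈ Icc lo hi)
    (h0 : F x = 0) (hb : ∀ t ∈ Icc lo hi, |F' t| ≤ C * |t - x| ^ n) :
    |F y| ≤ C * |y - x| ^ (n + 1) := by
  have hsub : uIcc x y ⊆ Icc lo hi := uIcc_subset_Icc hx hy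
  have h := (convex_uIcc x y).norm_image_sub_le_of_norm_hasDerivWithin_le (f := F) (f' := F')
    (C := C * |y - x| ^ n) (fun t ht => (hd t (hsub ht)).hasDerivWithinAt) (fun t ht => by
      refine (hb t (hsub ht)).trans ?_
      have := abs_sub_left_of_mem_uIcc ht
      gcongr) left_mem_uIcc right_mem_uIcc
  rw [h0, sub_zero, Real.norm_eq_abs, Real.norm_eq_abs] at h
  calc |F y| ≤ _ := h
    _ = _ := by ring

theorem exists_abs_rpow_le (q : ℝ) {lo : ℝ} (hlo : 0 < lo) (hi : ℝ) :
    ∃ C, 0 ≤ C ∧ ∀ x ∈ Icc lo hi, |x ^ q| ≤ C := by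
  have hc : ContinuousOn (fun x : ℝ => x ^ q) (Icc lo hi) := fun x hx =>
    (Real.continuousAt_rpow_const x q (Or.inl (by linarith [hx.1]))).continuousWithinAt
  obtain ⟨C, hC⟩ := isCompact_Icc.exists_bound_of_continuousOn hc
  exact ⟨max C 0, le_max_right _ _, fun x hx => (hC x hx).trans (le_max_left _ _)⟩

theorem exists_rpow_sub_le (q : ℝ) {lo : ℝ} (hlo : 0 < lo) (hi : ℝ) :
    ∃ C, 0 ≤ C ∧ ∀ x ∈ Icc lo hi, ∀ y ∈ Icc lo hi, |y ^ q - x ^ q| ≤ C * |y - x| := by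
  obtain ⟨C, hC, hb⟩ := exists_abs_rpow_le (q - 1) hlo hi
  refine ⟨|q| * C, by positivity, fun x hx y hy => ?_⟩
  have h := abs_le_mul_pow_of_hasDerivAt (F := fun t => t ^ q - x ^ q) (lo := lo) (hi := hi)
    (F' := fun t => q * t ^ (q - 1)) (C := |q| * C) 0 (by positivity) (fun t ht => ?_) hx hy
    (by simp) (fun t ht => ?_)
  · simpa using h
  · exact (Real.hasDerivAt_rpow_const (Or.inl (by linarith [ht.1]))).sub_const _
  · rw [abs_mul, pow_zero, mul_one]
    gcongr
    exact hb t ht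

theorem exists_rpow_taylor_two (q : ℝ) {lo : ℝ} (hlo : 0 < lo) (hi : ℝ) :
    ∃ C, 0 ≤ C ∧ ∀ x ∈ Icc lo hi, ∀ y ∈ Icc lo hi,
      |y ^ q - x ^ q - q * x ^ (q - 1) * (y - x)| ≤ C * |y - x| ^ 2 := by
  obtain ⟨C, hC, hb⟩ := exists_rpow_sub_le (q - 1) hlo hi
  refine ⟨|q| * C, by positivity, fun x hx y hy => ?_⟩
  refine abs_le_mul_pow_of_hasDerivAt
    (F := fun t => t ^ q - x ^ q - q * x ^ (q - 1) * (t - x)) (lo := lo) (hi := hi)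
    (F' := fun t => q * t ^ (q - 1) - q * x ^ (q - 1)) (C := |q| * C) 1 (by positivity)
    (fun t ht => ?_) hx hy (by simp) (fun t ht => ?_)
  · refine (((Real.hasDerivAt_rpow_const (Or.inl (by linarith [ht.1]))).sub_const _).sub
      (((hasDerivAt_id t).sub_const x).const_mul (q * x ^ (q - 1)))).congr_deriv (by ring)
  · rw [← mul_sub, abs_mul, pow_one, mul_assoc]
    gcongr
    exact hb x hx t ht

theorem exists_rpow_taylor_three (q : ℝ) {lo : ℝ} (hlo : 0 < lo) (hi : ℝ) :
    ∃ C, 0 ≤ C ∧ ∀ x ∈ Icc lo hi, ∀ y ∈ Icc lo hi,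
      |y ^ q - x ^ q - q * x ^ (q - 1) * (y - x) - q * (q - 1) / 2 * x ^ (q - 2) * (y - x) ^ 2|
        ≤ C * |y - x| ^ 3 := by
  obtain ⟨C, hC, hb⟩ := exists_rpow_taylor_two (q - 1) hlo hi
  refine ⟨|q| * C, by positivity, fun x hx y hy => ?_⟩
  refine abs_le_mul_pow_of_hasDerivAt
    (F := fun t => t ^ q - x ^ q - q * x ^ (q - 1) * (t - x)
      - q * (q - 1) / 2 * x ^ (q - 2) * (t - x) ^ 2) (lo := lo) (hi := hi)
    (F' := fun t => q * t ^ (q - 1) - q * x ^ (q - 1) - q * (q - 1) * x ^ (q - 2) * (t - x))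
    (C := |q| * C) 2 (by positivity) (fun t ht => ?_) hx hy (by simp) (fun t ht => ?_)
  · refine ((((Real.hasDerivAt_rpow_const (Or.inl (by linarith [ht.1]))).sub_const _).sub
      (((hasDerivAt_id t).sub_const x).const_mul (q * x ^ (q - 1)))).sub
      ((((hasDerivAt_id t).sub_const x).pow 2).const_mul
        (q * (q - 1) / 2 * x ^ (q - 2)))).congr_deriv ?_
    simp only [id, Nat.cast_ofNat, Nat.add_one_sub_one, pow_one]
    ring
  · have e : q * t ^ (q - 1) - q * x ^ (q - 1) - q * (q - 1) * x ^ (q - 2) * (t - x) =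
        q * (t ^ (q - 1) - x ^ (q - 1) - (q - 1) * x ^ (q - 1 - 1) * (t - x)) := by
      rw [show q - 1 - 1 = q - 2 by ring]; ring
    rw [e, abs_mul, mul_assoc |q| C]
    exact mul_le_mul_of_nonneg_left (hb x hx t ht) (abs_nonneg q)

theorem memLp_of_abs_le {f g : ℝ → ℝ} (hg : MemLp g 2) (hf : AEStronglyMeasurable f) {C : ℝ}
    (h : ∀ x, |f x| ≤ C * |g x|) : MemLp f 2 :=
  hg.of_le_mul hf (Eventually.of_forall h)

theorem memLp_bdd_mul {b f : ℝ → ℝ} (hf : MemLp f 2) (hb : Continuous b)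
    (hbd : ∃ C, ∀ x, |b x| ≤ C) : MemLp (fun x => b x * f x) 2 := by
  obtain ⟨C, hC⟩ := hbd
  refine memLp_of_abs_le hf (hb.aestronglyMeasurable.mul hf.1) (C := C) fun x => ?_
  rw [abs_mul]
  exact mul_le_mul_of_nonneg_right (hC x) (abs_nonneg _)

theorem continuous_rpow_of_pos {m : ℝ → ℝ} (hm : Continuous m) (hpos : ∀ x, 0 < m x) (q : ℝ) :
    Continuous fun x => m x ^ q :=
  hm.rpow_const fun x => Or.inl (hpos x).ne'

/-! ### Square integrability of the wave -/

/-- A function with `w w'' ≥ λ w²` near infinity, `λ > 0`, which tends to zero together with its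
derivative, is square integrable there with its derivative: `(w²)'' = 2 w'² + 2 w w''`. -/
theorem exists_integrableOn_sq_of_convex {w w₁ w₂ : ℝ → ℝ} (h1 : ∀ x, HasDerivAt w (w₁ x) x)
    (h2 : ∀ x, HasDerivAt w₁ (w₂ x) x) (hw : Tendsto w atTop (𝓝 0))
    (hw₁ : Tendsto w₁ atTop (𝓝 0)) {l : ℝ} (hl : 0 < l)
    (hconv : ∀ᶠ x in atTop, l * w x ^ 2 ≤ w x * w₂ x) :
    ∃ R, IntegrableOn (fun x => w x ^ 2) (Ioi R) ∧ IntegrableOn (fun x => w₁ x ^ 2) (Ioi R) := by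
  obtain ⟨R, hR⟩ := eventually_atTop.1 hconv
  have hcw : Continuous w := continuous_iff_continuousAt.2 fun x => (h1 x).continuousAt
  have hcw₁ : Continuous w₁ := continuous_iff_continuousAt.2 fun x => (h2 x).continuousAt
  have hint : IntegrableOn (fun x => w₁ x * w₁ x + w x * w₂ x) (Ioi R) := by
    refine integrableOn_Ioi_deriv_of_nonneg' (g := fun x => w x * w₁ x) (l := 0 * 0)
      (fun x _ => (h1 x).mul (h2 x)) (fun x hx => ?_) (hw.mul hw₁)
    have h3 := hR x (mem_Ioi.1 hx).le
    have h4 : 0 ≤ l * w x ^ 2 := by positivity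
    nlinarith [mul_self_nonneg (w₁ x)]
  have hmeas : ∀ᵐ x ∂(volume.restrict (Ioi R)), x ∈ Ioi R := ae_restrict_mem measurableSet_Ioi
  refine ⟨R, ?_, ?_⟩
  · refine Integrable.mono' (hint.const_mul l⁻¹) (hcw.pow 2).aestronglyMeasurable ?_
    filter_upwards [hmeas] with x hx
    have h3 := hR x (mem_Ioi.1 hx).le
    rw [Real.norm_of_nonneg (sq_nonneg _), inv_mul_eq_div, le_div_iff₀ hl]
    nlinarith [mul_self_nonneg (w₁ x)]
  · refine Integrable.mono' hint (hcw₁.pow 2).aestronglyMeasurable ?_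
    filter_upwards [hmeas] with x hx
    have h3 := hR x (mem_Ioi.1 hx).le
    have h4 : 0 ≤ l * w x ^ 2 := by positivity
    rw [Real.norm_of_nonneg (sq_nonneg _)]
    nlinarith [mul_self_nonneg (w₁ x)]

theorem memLp_two_of_integrableOn {f : ℝ → ℝ} (hf : Continuous f)
    (h1 : ∃ R, IntegrableOn (fun x => f x ^ 2) (Ioi R))
    (h2 : ∃ R, IntegrableOn (fun x => f (-x) ^ 2) (Ioi R)) : MemLp f 2 := by
  rw [memLp_two_iff_integrable_sq hf.aestronglyMeasurable,
    integrable_iff_integrableAtFilter_atBot_atTop]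
  obtain ⟨R, hR⟩ := h1
  obtain ⟨R', hR'⟩ := h2
  refine ⟨⟨⟨Iio (-R'), Iio_mem_atBot _, ?_⟩, ⟨Ioi R, Ioi_mem_atTop R, hR⟩⟩,
    (hf.pow 2).locallyIntegrable⟩
  have := IntegrableOn.comp_neg_Iio (c := -R') (f := fun x => f (-x) ^ 2) (by simpa using hR')
  simpa using this

namespace IsSmoothSolitaryWave

variable {c k : ℝ} {φ : ℝ → ℝ}

/-- The profile decays to `k` in `H²(ℝ)`. The equation `φ'' = g(φ)` has `g(k) = 0` and
`g'(k) = (c - 4 k²) / (c - k²) > 0`, so that `φ - k` is convex towards the axis near infinity. -/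
theorem memLp_profile (h : IsSmoothSolitaryWave c k φ) (hc : 0 < c) (hkc : 4 * k ^ 2 < c) :
    MemLp (fun x => φ x - k) 2 ∧ MemLp (iteratedDeriv 1 φ) 2 ∧ MemLp (iteratedDeriv 2 φ) 2 := by
  have hkc' : k ^ 2 < c := by nlinarith [sq_nonneg k]
  obtain ⟨hA, -⟩ := h.profile_eqs hc hkc'
  set s := √(c - k ^ 2) with hs'
  have hs : 0 < s := Real.sqrt_pos.2 (by linarith)
  have hss : s ^ 2 = c - k ^ 2 := Real.sq_sqrt (by linarith)
  -- the linearization of the profile equation `φ'' = g φ` at `k` is hyperbolic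
  set g : ℝ → ℝ := fun y => y - k * s ^ 3 / √(c - y ^ 2) ^ 3 with hg
  set l := (c - 4 * k ^ 2) / (c - k ^ 2) / 2 with hl
  have hl0 : 0 < l := by
    have : 0 < c - 4 * k ^ 2 := by linarith
    have : 0 < c - k ^ 2 := by linarith
    positivity
  have hgφ : ∀ x, iteratedDeriv 2 φ x = g (φ x) := by
    intro x
    have h1 : momentum φ x = k * s ^ 3 / wavegap c φ x ^ 3 := by
      rw [← hA x]
      have := h.wavegap_pos x
      field_simp
    have h2 : iteratedDeriv 2 φ x = φ x - momentum φ x := by unfold momentum; ring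
    rw [h2, h1]
    rfl
  have hgk : g k = 0 := by
    rw [hg]
    simp only [← hs']
    field_simp
    ring
  have hgd : HasDerivAt g (2 * l) k := by
    have h1 : HasDerivAt (fun y : ℝ => c - y ^ 2) (-(2 * k)) k := by
      refine ((hasDerivAt_pow 2 k).const_sub c).congr_deriv ?_
      simp
    have h2 := (h1.sqrt (by linarith)).pow 3
    refine ((hasDerivAt_id k).sub ((hasDerivAt_const k (k * s ^ 3)).div h2 ?_)).congr_deriv ?_
    · simp only [Pi.pow_apply, ← hs']
      positivity
    · simp only [Pi.pow_apply, ← hs', Nat.cast_ofNat, Nat.add_one_sub_one, hl]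
      rw [show c - 4 * k ^ 2 = s ^ 2 - 3 * k ^ 2 by linarith, ← hss]
      field_simp
      ring
  have hnear : ∀ᶠ y in 𝓝 k, l * (y - k) ^ 2 ≤ (y - k) * g y ∧ |g y| ≤ 3 * l * |y - k| := by
    have h1 := (hasDerivAt_iff_isLittleO.1 hgd).bound hl0
    filter_upwards [h1] with y hy
    rw [hgk, sub_zero, smul_eq_mul, Real.norm_eq_abs, Real.norm_eq_abs] at hy
    constructor
    · have h2 : |(y - k) * (g y - (y - k) * (2 * l))| ≤ |y - k| * (l * |y - k|) := by
        rw [abs_mul]; gcongr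
      have h3 := (abs_le.1 h2).1
      have h4 : |y - k| * (l * |y - k|) = l * (y - k) ^ 2 := by
        rw [← sq_abs]; ring
      nlinarith
    · calc |g y| = |(g y - (y - k) * (2 * l)) + (y - k) * (2 * l)| := by ring_nf
        _ ≤ |g y - (y - k) * (2 * l)| + |(y - k) * (2 * l)| := abs_add_le _ _
        _ ≤ l * |y - k| + |y - k| * (2 * l) := by
            rw [abs_mul (y - k), abs_of_pos (by positivity : 0 < 2 * l)]
            gcongr
        _ = _ := by ring
  obtain ⟨-, ht1, ht2⟩ := h.tendsto_derivs hc hkc' h.tendsto_atTop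
  obtain ⟨-, hb1, hb2⟩ := h.tendsto_derivs hc hkc' h.tendsto_atBot
  have hcφ : Continuous φ := h.smooth.continuous
  have hT : Tendsto (fun x => φ x - k) atTop (𝓝 0) := by simpa using h.tendsto_atTop.sub_const k
  have hB : Tendsto (fun x => φ x - k) atBot (𝓝 0) := by simpa using h.tendsto_atBot.sub_const k
  obtain ⟨R, hR, hR₁⟩ := exists_integrableOn_sq_of_convex
    (fun x => (h.hasDerivAt x).sub_const k) (h.hasDerivAt_iteratedDeriv 1) hT ht1 hl0 (by
      filter_upwards [h.tendsto_atTop.eventually hnear] with x hx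
      rw [hgφ]
      exact hx.1)
  have hneg : ∀ {f f' : ℝ → ℝ}, (∀ x, HasDerivAt f (f' x) x) → ∀ x,
      HasDerivAt (fun x => f (-x)) (-f' (-x)) x := by
    intro f f' hf x
    have := (hf (-x)).scomp x (hasDerivAt_neg x)
    simpa [Function.comp_def] using this
  obtain ⟨R', hR', hR₁'⟩ := exists_integrableOn_sq_of_convex (w := fun x => φ (-x) - k)
    (w₁ := fun x => -iteratedDeriv 1 φ (-x)) (w₂ := fun x => iteratedDeriv 2 φ (-x))
    (fun x => (hneg h.hasDerivAt x).sub_const k)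
    (fun x => (hneg (h.hasDerivAt_iteratedDeriv 1) x).neg.congr_deriv (neg_neg _))
    (hB.comp tendsto_neg_atTop_atBot)
    (by simpa using (hb1.comp tendsto_neg_atTop_atBot).neg) hl0 (by
      filter_upwards [(h.tendsto_atBot.comp tendsto_neg_atTop_atBot).eventually hnear] with x hx
      rw [hgφ]
      exact hx.1)
  have hm1 : MemLp (fun x => φ x - k) 2 :=
    memLp_two_of_integrableOn (by fun_prop) ⟨R, hR⟩ ⟨R', hR'⟩
  refine ⟨hm1, memLp_two_of_integrableOn (h.continuous_iteratedDeriv 1) ⟨R, hR₁⟩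
    ⟨R', by simpa using hR₁'⟩, ?_⟩
  have hc2 := h.continuous_iteratedDeriv 2
  have hsq := (memLp_two_iff_integrable_sq hm1.1).1 hm1
  have hO : ∀ {l' : Filter ℝ}, Tendsto φ l' (𝓝 k) →
      (fun x => iteratedDeriv 2 φ x ^ 2) =O[l'] fun x => (φ x - k) ^ 2 := by
    intro l' hl'
    refine Asymptotics.IsBigO.of_bound ((3 * l) ^ 2) ?_
    filter_upwards [hl'.eventually hnear] with x hx
    rw [hgφ, norm_pow, norm_pow, ← mul_pow, Real.norm_eq_abs, Real.norm_eq_abs]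
    exact pow_le_pow_left₀ (abs_nonneg _) hx.2 2
  rw [memLp_two_iff_integrable_sq hc2.aestronglyMeasurable]
  exact (hc2.pow 2).locallyIntegrable.integrable_of_isBigO_atBot_atTop (hO h.tendsto_atBot)
    (hsq.integrableAtFilter _) (hO h.tendsto_atTop) (hsq.integrableAtFilter _)

/-- The profile equation `(c - φ²) μ' = 3 φ φ' μ` differentiated once and twice. -/
theorem profile_ode_deriv (h : IsSmoothSolitaryWave c k φ) (x : ℝ) :
    wavegap c φ x ^ 2 * (iteratedDeriv 2 φ x - iteratedDeriv 4 φ x) =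
      3 * (iteratedDeriv 1 φ x ^ 2 + φ x * iteratedDeriv 2 φ x) * momentum φ x
        + 5 * φ x * iteratedDeriv 1 φ x * (iteratedDeriv 1 φ x - iteratedDeriv 3 φ x) ∧
    wavegap c φ x ^ 2 * (iteratedDeriv 3 φ x - iteratedDeriv 5 φ x) =
      3 * (3 * iteratedDeriv 1 φ x * iteratedDeriv 2 φ x + φ x * iteratedDeriv 3 φ x) * momentum φ x
        + 8 * (iteratedDeriv 1 φ x ^ 2 + φ x * iteratedDeriv 2 φ x)
          * (iteratedDeriv 1 φ x - iteratedDeriv 3 φ x)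
        + 7 * φ x * iteratedDeriv 1 φ x * (iteratedDeriv 2 φ x - iteratedDeriv 4 φ x) := by
  have d0 := h.hasDerivAt
  have d := h.hasDerivAt_iteratedDeriv
  have dμ := h.hasDerivAt_momentum
  have dg : ∀ x, HasDerivAt (fun x => c - φ x ^ 2) (-(2 * φ x * iteratedDeriv 1 φ x)) x := by
    intro x
    refine (((d0 x).pow 2).const_sub c).congr_deriv ?_
    simp
  have key : ∀ x, (c - φ x ^ 2) * (iteratedDeriv 2 φ x - iteratedDeriv 4 φ x) =
      3 * (iteratedDeriv 1 φ x ^ 2 + φ x * iteratedDeriv 2 φ x) * momentum φ x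
        + 5 * φ x * iteratedDeriv 1 φ x * (iteratedDeriv 1 φ x - iteratedDeriv 3 φ x) := by
    intro x
    have e1 := (dg x).mul ((d 1 x).sub (d 3 x))
    have e2 := (((d0 x).const_mul 3).mul (d 1 x)).mul (dμ x)
    have e3 : (fun x => (c - φ x ^ 2) * (iteratedDeriv 1 φ x - iteratedDeriv 3 φ x)) =
        fun x => 3 * φ x * iteratedDeriv 1 φ x * momentum φ x := funext h.profile_ode
    have e4 := e1.unique
      (e2.congr_of_eventuallyEq (Eventually.of_forall fun y => congrFun e3 y))
    simp only [Pi.sub_apply, Pi.mul_apply] at e4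
    norm_num at e4
    simp only [iteratedDeriv_one]
    linarith
  rw [h.wavegap_sq]
  refine ⟨key x, ?_⟩
  have e1 := (dg x).mul ((d 2 x).sub (d 4 x))
  have e2 := ((((d 1 x).pow 2).add ((d0 x).mul (d 2 x))).const_mul 3 |>.mul (dμ x)).add
    ((((d0 x).const_mul 5).mul (d 1 x)).mul ((d 1 x).sub (d 3 x)))
  have e3 : (fun x => (c - φ x ^ 2) * (iteratedDeriv 2 φ x - iteratedDeriv 4 φ x)) =
      fun x => 3 * (iteratedDeriv 1 φ x ^ 2 + φ x * iteratedDeriv 2 φ x) * momentum φ x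
        + 5 * φ x * iteratedDeriv 1 φ x * (iteratedDeriv 1 φ x - iteratedDeriv 3 φ x) := funext key
  have e4 := e1.unique
      (e2.congr_of_eventuallyEq (Eventually.of_forall fun y => congrFun e3 y))
  simp only [Pi.sub_apply, Pi.mul_apply, Pi.add_apply, Pi.pow_apply] at e4
  norm_num at e4
  simp only [iteratedDeriv_one]
  linarith

end IsSmoothSolitaryWave

/-! ### Analytic properties of the wave -/

/-- Turns the fractional powers of `m` into natural powers of `m^{-1/3}`, which `field_simp` and
`ring` can handle. -/
theorem rpow_eq_neg_third_pow {m : ℝ} (hm : 0 < m) (n : ℕ) {q : ℝ} (hq : q = -(n / 3)) :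
    m ^ q = (m ^ (-(1 / 3) : ℝ)) ^ n := by
  rw [← Real.rpow_natCast, ← Real.rpow_mul hm.le, hq]
  congr 1
  ring

/-- The left-hand side of the Euler–Lagrange equation `Λ'(μ) = 0`, where `φ = (1 - ∂ₓ²)⁻¹ μ`. -/
def eulerLagrange (c k φ m m₁ m₂ : ℝ) : ℝ :=
  2 * omega0 c k * φ + 2 / 3 * omega1 c k * m ^ (-(1 / 3) : ℝ)
    + 8 / 3 * m ^ (-(11 / 3) : ℝ) * m₁ ^ 2 - 2 * m ^ (-(8 / 3) : ℝ) * m₂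
    - 6 * m ^ (-(5 / 3) : ℝ)

/-- The analytic properties of the wave used in the stability proof: `μ` is the momentum density of
the profile `φ`, with derivatives `μ₁`, `μ₂`, `μ₃`, and `φ₁` is the derivative of `φ`. -/
structure SolitaryProfile (c k : ℝ) (φ φ₁ μ μ₁ μ₂ μ₃ : ℝ → ℝ) : Prop where
  k_pos : 0 < k
  hasDerivAt_profile : ∀ x, HasDerivAt φ (φ₁ x) x
  hasDerivAt : ∀ x, HasDerivAt μ (μ₁ x) x
  hasDerivAt₁ : ∀ x, HasDerivAt μ₁ (μ₂ x) x
  hasDerivAt₂ : ∀ x, HasDerivAt μ₂ (μ₃ x) x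
  continuous₃ : Continuous μ₃
  bounds : ∃ lo hi, 0 < lo ∧ ∀ x, μ x ∈ Icc lo hi
  bounded₁ : ∃ C, ∀ x, |μ₁ x| ≤ C
  bounded₂ : ∃ C, ∀ x, |μ₂ x| ≤ C
  memLp : MemLp (fun x => μ x - k) 2
  memLp₁ : MemLp μ₁ 2
  memLp₂ : MemLp μ₂ 2
  memLp₃ : MemLp μ₃ 2
  helmholtz : ∀ x, helmholtzInv μ x = φ x
  helmholtz₁ : ∀ x, helmholtzInv μ₁ x = φ₁ x
  euler : ∀ x, eulerLagrange c k (φ x) (μ x) (μ₁ x) (μ₂ x) = 0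
  euler_const : eulerLagrange c k k k 0 0 = 0
  nonconst : ∃ x, μ₁ x ≠ 0
  memLp_varF : MemLp (varF k μ) 2
  varF_orthogonal : ∫ x, varF k μ x * μ₁ x = 0

namespace IsSmoothSolitaryWave

variable {c k : ℝ} {φ : ℝ → ℝ}

theorem aPar_eq (hkc : k ^ 2 < c) : aPar c k = k * √(c - k ^ 2) ^ 3 := by
  rw [aPar, Real.sqrt_eq_rpow, ← Real.rpow_natCast ((c - k ^ 2) ^ (1 / 2 : ℝ)) 3,
    ← Real.rpow_mul (by linarith)]
  norm_num

/-- The Euler–Lagrange equation, an algebraic consequence of the first integrals: with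
`S = (c - φ²)^{1/2}` and `β = a^{-1/3}`, one has `μ^{-1/3} = S β`. -/
theorem eulerLagrange_eq_zero (h : IsSmoothSolitaryWave c k φ) (hc : 0 < c) (hkc : k ^ 2 < c)
    (x : ℝ) :
    eulerLagrange c k (φ x) (momentum φ x) (iteratedDeriv 1 φ x - iteratedDeriv 3 φ x)
      (iteratedDeriv 2 φ x - iteratedDeriv 4 φ x) = 0 := by
  obtain ⟨hA, he⟩ := h.profile_eqs hc hkc
  have hA := hA x
  have he := he x
  have h1 := h.profile_ode x
  have h2 := (h.profile_ode_deriv x).1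
  have hS := h.wavegap_pos x
  have hSS := h.wavegap_sq x
  have hμ := h.momentum_pos x
  have hD2 : iteratedDeriv 2 φ x = φ x - momentum φ x := by unfold momentum; ring
  rw [← aPar_eq hkc] at hA he
  have ha : 0 < aPar c k := by rw [← hA]; positivity
  rw [← hSS] at h1
  set μ₁ := iteratedDeriv 1 φ x - iteratedDeriv 3 φ x
  set μ₂ := iteratedDeriv 2 φ x - iteratedDeriv 4 φ x
  rw [hD2] at h2
  set S := wavegap c φ x
  set f := φ x
  set f₁ := iteratedDeriv 1 φ x
  set m := momentum φ x
  set β := aPar c k ^ (-(1 / 3) : ℝ) with hβ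
  have hβ0 : 0 < β := Real.rpow_pos_of_pos ha _
  have haβ : aPar c k = 1 / β ^ 3 := by
    rw [hβ, ← rpow_eq_neg_third_pow ha 3 (q := -1) (by norm_num), Real.rpow_neg_one]
    simp
  have hm : m = 1 / (S * β) ^ 3 := by
    rw [mul_pow, ← div_div, div_right_comm, ← haβ, ← hA]
    field_simp
  have hp : m ^ (-(1 / 3) : ℝ) = S * β := by
    rw [hm, one_div, ← inv_pow, ← Real.rpow_natCast, ← Real.rpow_mul (by positivity)]
    norm_num
    rw [Real.rpow_neg_one]
    simp
  unfold eulerLagrange omega0 omega1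
  rw [rpow_eq_neg_third_pow hμ 11 (q := -(11 / 3)) (by norm_num),
    rpow_eq_neg_third_pow hμ 8 (q := -(8 / 3)) (by norm_num),
    rpow_eq_neg_third_pow hμ 5 (q := -(5 / 3)) (by norm_num), hp,
    rpow_eq_neg_third_pow ha 2 (q := -(2 / 3)) (by norm_num),
    rpow_eq_neg_third_pow ha 4 (q := -(4 / 3)) (by norm_num), ← hβ]
  rw [haβ] at he
  have hcS : c = S ^ 2 + f ^ 2 := by linarith
  have hE : 2 * EPar c k = f₁ ^ 2 - f ^ 2 + 2 * (1 / β ^ 3) * f / (c * S) := by linarith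
  have hμ₁ : μ₁ = 3 * f * f₁ * m / S ^ 2 := by
    rw [← h1]; field_simp
  have hμ₂ : μ₂ = (3 * (f₁ ^ 2 + f * (f - m)) * m + 5 * f * f₁ * μ₁) / S ^ 2 := by
    rw [← h2]; field_simp
  rw [hE, hμ₂, hμ₁, hm, hcS]
  have : 0 < S ^ 2 + f ^ 2 := by positivity
  field_simp
  ring

theorem tendsto_momentum_derivs (h : IsSmoothSolitaryWave c k φ) (hc : 0 < c) (hkc : k ^ 2 < c)
    {l : Filter ℝ} (hl : Tendsto φ l (𝓝 k)) :
    Tendsto (fun x => iteratedDeriv 1 φ x - iteratedDeriv 3 φ x) l (𝓝 0) ∧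
      Tendsto (fun x => iteratedDeriv 2 φ x - iteratedDeriv 4 φ x) l (𝓝 0) := by
  obtain ⟨t0, t1, t2⟩ := h.tendsto_derivs hc hkc hl
  have hs : 0 < √(c - k ^ 2) := Real.sqrt_pos.2 (by linarith)
  have tS := (tendsto_wavegap (c := c) hl).pow 2
  have hne : √(c - k ^ 2) ^ 2 ≠ 0 := by positivity
  have h1 : Tendsto (fun x => iteratedDeriv 1 φ x - iteratedDeriv 3 φ x) l (𝓝 0) := by
    have e : ∀ x, iteratedDeriv 1 φ x - iteratedDeriv 3 φ x =
        3 * φ x * iteratedDeriv 1 φ x * momentum φ x / wavegap c φ x ^ 2 := fun x => by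
      have h1 := h.profile_ode x
      have := h.wavegap_pos x
      rw [← h.wavegap_sq] at h1
      rw [← h1]; field_simp
    rw [funext e]
    exact ((((hl.const_mul 3).mul t1).mul t0).div tS hne).mono_right (by simp)
  refine ⟨h1, ?_⟩
  have e : ∀ x, iteratedDeriv 2 φ x - iteratedDeriv 4 φ x =
      (3 * (iteratedDeriv 1 φ x ^ 2 + φ x * iteratedDeriv 2 φ x) * momentum φ x
        + 5 * φ x * iteratedDeriv 1 φ x * (iteratedDeriv 1 φ x - iteratedDeriv 3 φ x))
        / wavegap c φ x ^ 2 := fun x => by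
    have := h.wavegap_pos x
    rw [← (h.profile_ode_deriv x).1]; field_simp
  rw [funext e]
  exact ((((((t1.pow 2).add (hl.mul t2)).const_mul 3).mul t0).add
    (((hl.const_mul 5).mul t1).mul h1)).div tS hne).mono_right (by simp)

theorem solitaryProfile (h : IsSmoothSolitaryWave c k φ) (hc : 0 < c) (hk : 0 < k)
    (hkc4 : 4 * k ^ 2 < c) :
    SolitaryProfile c k φ (iteratedDeriv 1 φ) (momentum φ)
      (fun x => iteratedDeriv 1 φ x - iteratedDeriv 3 φ x)
      (fun x => iteratedDeriv 2 φ x - iteratedDeriv 4 φ x)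
      (fun x => iteratedDeriv 3 φ x - iteratedDeriv 5 φ x) := by
  have hkc : k ^ 2 < c := by nlinarith [sq_nonneg k]
  have cD := h.continuous_iteratedDeriv
  have c1 := cD 1
  have c2 := cD 2
  have c3 := cD 3
  have c4 := cD 4
  have c5 := cD 5
  have cφ : Continuous φ := h.smooth.continuous
  have cμ := h.continuous_momentum
  have cS := h.continuous_wavegap
  have hS := h.wavegap_pos
  obtain ⟨T0, T1, T2⟩ := h.tendsto_derivs hc hkc h.tendsto_atTop
  obtain ⟨B0, B1, B2⟩ := h.tendsto_derivs hc hkc h.tendsto_atBot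
  obtain ⟨Tμ1, Tμ2⟩ := h.tendsto_momentum_derivs hc hkc h.tendsto_atTop
  obtain ⟨Bμ1, Bμ2⟩ := h.tendsto_momentum_derivs hc hkc h.tendsto_atBot
  obtain ⟨L0, L1, L2⟩ := h.memLp_profile hc hkc4
  have hs : 0 < √(c - k ^ 2) := Real.sqrt_pos.2 (by linarith)
  have hne : √(c - k ^ 2) ^ 2 ≠ 0 := by positivity
  have TS := (tendsto_wavegap (c := c) h.tendsto_atTop).pow 2
  have BS := (tendsto_wavegap (c := c) h.tendsto_atBot).pow 2
  have hSne : ∀ x, wavegap c φ x ^ 2 ≠ 0 := fun x => (pow_pos (hS x) 2).ne'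
  have Tφ := h.tendsto_atTop
  have Bφ := h.tendsto_atBot
  have Lμ : MemLp (fun x => momentum φ x - k) 2 := by
    have e : (fun x => momentum φ x - k) = fun x => (φ x - k) - iteratedDeriv 2 φ x := by
      ext x; unfold momentum; ring
    rw [e]
    exact L0.sub L2
  have Lμ1 : MemLp (fun x => iteratedDeriv 1 φ x - iteratedDeriv 3 φ x) 2 := by
    have e : (fun x => iteratedDeriv 1 φ x - iteratedDeriv 3 φ x) = fun x =>
        (3 * φ x * momentum φ x / wavegap c φ x ^ 2) * iteratedDeriv 1 φ x := by
      ext x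
      have h1 := h.profile_ode x
      rw [← h.wavegap_sq] at h1
      have := hS x
      field_simp
      linarith
    rw [e]
    exact memLp_bdd_mul L1 (((cφ.const_mul 3).mul cμ).div₀ (cS.pow 2) hSne)
      (bounded_of_tendsto (((cφ.const_mul 3).mul cμ).div₀ (cS.pow 2) hSne)
        (((Tφ.const_mul 3).mul T0).div TS hne) (((Bφ.const_mul 3).mul B0).div BS hne))
  have L3 : MemLp (iteratedDeriv 3 φ) 2 := by
    have e : iteratedDeriv 3 φ = fun x =>
        iteratedDeriv 1 φ x - (iteratedDeriv 1 φ x - iteratedDeriv 3 φ x) := by ext x; ring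
    rw [e]
    exact L1.sub Lμ1
  -- a bounded continuous coefficient times an `L²` function, divided by `c - φ²`
  have hmul : ∀ {b f : ℝ → ℝ} {β : ℝ}, MemLp f 2 → Continuous b → Tendsto b atTop (𝓝 β) →
      Tendsto b atBot (𝓝 β) → MemLp (fun x => b x / wavegap c φ x ^ 2 * f x) 2 :=
    fun {b f β} hf hb hT hB => memLp_bdd_mul hf (hb.div₀ (cS.pow 2) hSne)
      (bounded_of_tendsto (hb.div₀ (cS.pow 2) hSne) (hT.div TS hne) (hB.div BS hne))
  have Lμ2 : MemLp (fun x => iteratedDeriv 2 φ x - iteratedDeriv 4 φ x) 2 := by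
    have m1 := hmul L1 ((c1.const_mul 3).mul cμ) ((T1.const_mul 3).mul T0)
      ((B1.const_mul 3).mul B0)
    have m2 := hmul L2 ((cφ.const_mul 3).mul cμ) ((Tφ.const_mul 3).mul T0)
      ((Bφ.const_mul 3).mul B0)
    have m3 := hmul Lμ1 ((cφ.const_mul 5).mul c1) ((Tφ.const_mul 5).mul T1)
      ((Bφ.const_mul 5).mul B1)
    refine ((m1.add m2).add m3).ae_eq (Eventually.of_forall fun x => ?_)
    have h1 := (h.profile_ode_deriv x).1
    have := hS x
    simp only [Pi.add_apply, Pi.mul_apply]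
    field_simp
    linarith
  have Lμ3 : MemLp (fun x => iteratedDeriv 3 φ x - iteratedDeriv 5 φ x) 2 := by
    have m1 := hmul L2 ((c1.const_mul 9).mul cμ) ((T1.const_mul 9).mul T0)
      ((B1.const_mul 9).mul B0)
    have m2 := hmul L3 ((cφ.const_mul 3).mul cμ) ((Tφ.const_mul 3).mul T0)
      ((Bφ.const_mul 3).mul B0)
    have m3 := hmul Lμ1 (((c1.pow 2).add (cφ.mul c2)).const_mul 8)
      (((T1.pow 2).add (Tφ.mul T2)).const_mul 8) (((B1.pow 2).add (Bφ.mul B2)).const_mul 8)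
    have m4 := hmul Lμ2 ((cφ.const_mul 7).mul c1) ((Tφ.const_mul 7).mul T1)
      ((Bφ.const_mul 7).mul B1)
    refine (((m1.add m2).add m3).add m4).ae_eq (Eventually.of_forall fun x => ?_)
    have h1 := (h.profile_ode_deriv x).2
    have := hS x
    simp only [Pi.add_apply, Pi.pow_apply, Pi.mul_apply]
    field_simp
    linarith
  obtain ⟨Cμ, hCμ⟩ := bounded_of_tendsto cμ T0 B0
  obtain ⟨C', hC'⟩ := bounded_of_tendsto (cμ.inv₀ fun x => (h.momentum_pos x).ne')
    (T0.inv₀ hk.ne') (B0.inv₀ hk.ne')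
  have hC'0 : 0 < C' := lt_of_lt_of_le
    (abs_pos.2 (inv_ne_zero (h.momentum_pos 0).ne')) (hC' 0)
  have hIcc : ∀ x, momentum φ x ∈ Icc (min C'⁻¹ k) (max Cμ k) := fun x => by
    have hp := h.momentum_pos x
    refine ⟨(min_le_left _ _).trans ?_, (le_abs_self _).trans ((hCμ x).trans (le_max_left _ _))⟩
    have := hC' x
    rw [Pi.inv_apply, abs_of_pos (inv_pos.2 hp)] at this
    exact inv_le_of_inv_le₀ hp this
  have hmin : 0 < min C'⁻¹ k := lt_min (inv_pos.2 hC'0) hk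
  -- the Helmholtz equation
  have hHelm : ∀ x, helmholtzInv (momentum φ) x = φ x := by
    have hi : ∀ x, Integrable (fun y => green (x - y) * momentum φ y) := fun x => by
      have := (integrable_green_mul Lμ x).add ((integrable_green_sub x).mul_const k)
      refine this.congr (Eventually.of_forall fun y => ?_)
      simp only [Pi.add_apply]
      ring
    obtain ⟨Ca, hCa⟩ := bounded_of_tendsto cφ Tφ Bφ
    obtain ⟨Cb, hCb⟩ := bounded_of_tendsto c1 T1 B1
    exact helmholtzInv_sub_deriv_deriv hi h.hasDerivAt (h.hasDerivAt_iteratedDeriv 1)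
      (fun x => rfl) (C := max Ca Cb) (fun x => (hCa x).trans (le_max_left _ _))
      (fun x => (hCb x).trans (le_max_right _ _))
  have hHelm1 : ∀ x, helmholtzInv (fun x => iteratedDeriv 1 φ x - iteratedDeriv 3 φ x) x =
      iteratedDeriv 1 φ x := by
    obtain ⟨Ca, hCa⟩ := bounded_of_tendsto c1 T1 B1
    obtain ⟨Cb, hCb⟩ := bounded_of_tendsto c2 T2 B2
    exact helmholtzInv_sub_deriv_deriv (integrable_green_mul Lμ1)
      (h.hasDerivAt_iteratedDeriv 1) (h.hasDerivAt_iteratedDeriv 2)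
      (fun x => rfl) (C := max Ca Cb) (fun x => (hCa x).trans (le_max_left _ _))
      (fun x => (hCb x).trans (le_max_right _ _))
  have hk43 : k ^ (4 / 3 : ℝ) * k ^ (-(1 / 3) : ℝ) = k := by
    rw [← Real.rpow_add hk]; norm_num
  have hη : MemLp (varF k (momentum φ)) 2 := by
    obtain ⟨C, hC, hL⟩ := exists_rpow_sub_le (-(1 / 3)) hmin (max Cμ k)
    have e : varF k (momentum φ) = fun x => 2 * (φ x - k)
        + (-2 * k ^ (4 / 3 : ℝ)) * (momentum φ x ^ (-(1 / 3) : ℝ) - k ^ (-(1 / 3) : ℝ)) := by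
      ext x
      unfold varF
      rw [hHelm]
      linear_combination -2 * hk43
    rw [e]
    refine (L0.const_mul 2).add (MemLp.const_mul ?_ _)
    refine memLp_of_abs_le Lμ ?_ (C := C) fun x =>
      hL k ⟨min_le_right _ _, le_max_right _ _⟩ _ (hIcc x)
    exact ((continuous_rpow_of_pos cμ h.momentum_pos _).sub continuous_const).aestronglyMeasurable
  refine
    { k_pos := hk
      hasDerivAt_profile := h.hasDerivAt
      hasDerivAt := h.hasDerivAt_momentum
      hasDerivAt₁ := fun x => (h.hasDerivAt_iteratedDeriv 1 x).sub (h.hasDerivAt_iteratedDeriv 3 x)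
      hasDerivAt₂ := fun x => (h.hasDerivAt_iteratedDeriv 2 x).sub (h.hasDerivAt_iteratedDeriv 4 x)
      continuous₃ := c3.sub c5
      bounds := ⟨_, _, hmin, hIcc⟩
      bounded₁ := bounded_of_tendsto (c1.sub c3) Tμ1 Bμ1
      bounded₂ := bounded_of_tendsto (c2.sub c4) Tμ2 Bμ2
      memLp := Lμ
      memLp₁ := Lμ1
      memLp₂ := Lμ2
      memLp₃ := Lμ3
      helmholtz := hHelm
      helmholtz₁ := hHelm1
      euler := h.eulerLagrange_eq_zero hc hkc
      euler_const := ?_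
      nonconst := ?_
      memLp_varF := hη
      varF_orthogonal := ?_ }
  · have hr : ∀ q : ℝ, Tendsto (fun x => momentum φ x ^ q) atTop (𝓝 (k ^ q)) := fun q =>
      T0.rpow_const (Or.inl hk.ne')
    have ht := ((((Tφ.const_mul (2 * omega0 c k)).add
      ((hr (-(1 / 3))).const_mul (2 / 3 * omega1 c k))).add
      (((hr (-(11 / 3))).const_mul (8 / 3)).mul (Tμ1.pow 2))).sub
      (((hr (-(8 / 3))).const_mul 2).mul Tμ2)).sub ((hr (-(5 / 3))).const_mul 6)
    exact tendsto_nhds_unique ht (tendsto_const_nhds.congr fun x =>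
      (h.eulerLagrange_eq_zero hc hkc x).symm)
  · by_contra hcon
    push Not at hcon
    -- a constant momentum forces `φ φ' = 0`, so that `φ² = k²`
    obtain ⟨x₀, hx₀⟩ := h.nonconst
    have hφφ : ∀ x, φ x * iteratedDeriv 1 φ x = 0 := fun x => by
      have h1 := h.profile_ode x
      have h2 := hcon x
      rw [h2, mul_zero] at h1
      have := (h.momentum_pos x).ne'
      simpa [this] using h1
    have hd : ∀ x, HasDerivAt (fun x => φ x ^ 2) 0 x := fun x => by
      refine ((h.hasDerivAt x).pow 2).congr_deriv ?_
      simp only [Nat.cast_ofNat, Nat.add_one_sub_one, pow_one]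
      linear_combination 2 * hφφ x
    have hconst : ∀ x, φ x ^ 2 = φ x₀ ^ 2 := fun x =>
      is_const_of_deriv_eq_zero (fun x => (hd x).differentiableAt) (fun x => (hd x).deriv) x x₀
    have hlim : φ x₀ ^ 2 = k ^ 2 :=
      tendsto_nhds_unique (tendsto_const_nhds.congr fun x => (hconst x).symm) (Tφ.pow 2)
    have hpos : 0 < φ x₀ := by
      have h0 : 0 ≤ φ x₀ := by
        rw [← hHelm, helmholtzInv_eq]
        exact integral_nonneg fun y => mul_nonneg (green_nonneg _) (h.momentum_pos y).le
      refine lt_of_le_of_ne h0 fun h0' => ?_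
      rw [← h0'] at hlim
      nlinarith
    apply hx₀
    nlinarith
  -- `η μ'` is the derivative of the density of `𝓕`, up to a total derivative
  · have hd : ∀ x, HasDerivAt (fun x => φ x ^ 2 - 2 * (φ x * iteratedDeriv 2 φ x)
        + iteratedDeriv 1 φ x ^ 2 - 3 * k ^ (4 / 3 : ℝ) * momentum φ x ^ (2 / 3 : ℝ))
        (varF k (momentum φ) x * (iteratedDeriv 1 φ x - iteratedDeriv 3 φ x)) x := by
      intro x
      refine (((((h.hasDerivAt x).pow 2).sub
        (((h.hasDerivAt x).mul (h.hasDerivAt_iteratedDeriv 2 x)).const_mul 2)).add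
        ((h.hasDerivAt_iteratedDeriv 1 x).pow 2)).sub
        (((h.hasDerivAt_momentum x).rpow_const (p := 2 / 3)
          (Or.inl (h.momentum_pos x).ne')).const_mul _)).congr_deriv ?_
      unfold varF
      rw [hHelm]
      have e : (2 / 3 - 1 : ℝ) = -(1 / 3) := by norm_num
      simp only [Nat.cast_ofNat, Nat.add_one_sub_one, pow_one, e, Nat.reduceAdd]
      ring
    have hl : ∀ l : Filter ℝ, Tendsto φ l (𝓝 k) → Tendsto (fun x => φ x ^ 2
        - 2 * (φ x * iteratedDeriv 2 φ x) + iteratedDeriv 1 φ x ^ 2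
        - 3 * k ^ (4 / 3 : ℝ) * momentum φ x ^ (2 / 3 : ℝ)) l
        (𝓝 (k ^ 2 - 2 * (k * 0) + 0 ^ 2 - 3 * k ^ (4 / 3 : ℝ) * k ^ (2 / 3 : ℝ))) := by
      intro l hl
      obtain ⟨t0, t1, t2⟩ := h.tendsto_derivs hc hkc hl
      exact (((hl.pow 2).sub ((hl.mul t2).const_mul 2)).add (t1.pow 2)).sub
        ((t0.rpow_const (Or.inl hk.ne')).const_mul _)
    rw [integral_of_hasDerivAt_of_tendsto hd (integrable_mul_of_memLp hη Lμ1) (hl _ Bφ) (hl _ Tφ),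
      sub_self]

end IsSmoothSolitaryWave

/-! ### The functionals as absolutely convergent integrals -/

/-- The local part of the action density, as a function of `m` and `m'`, with the term
`2 ω₀ k (m - k)` that makes it quadratic at `(k, 0)`. -/
def lagr (c k m m₁ : ℝ) : ℝ :=
  2 * omega0 c k * k * (m - k) + omega1 c k * (m ^ (2 / 3 : ℝ) - k ^ (2 / 3 : ℝ))
    + m ^ (-(8 / 3) : ℝ) * m₁ ^ 2 + 9 * (m ^ (-(2 / 3) : ℝ) - k ^ (-(2 / 3) : ℝ))

/-- The local part of the constraint density, again quadratic at `m = k`. -/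
def lagrF (k m : ℝ) : ℝ :=
  2 * k * (m - k) - 3 * k ^ (4 / 3 : ℝ) * (m ^ (2 / 3 : ℝ) - k ^ (2 / 3 : ℝ))

/-- The action of `m = k + v` with `v' = f`, as a Lebesgue integral. -/
def regLambda (c k : ℝ) (v f : ℝ → ℝ) : ℝ :=
  ∫ x, (omega0 c k * (v x * helmholtzInv v x) + lagr c k (v x + k) (f x))

/-- The constraint functional at `m = k + v`, as a Lebesgue integral. -/
def regF (k : ℝ) (v : ℝ → ℝ) : ℝ :=
  ∫ x, (v x * helmholtzInv v x + lagrF k (v x + k))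

theorem euler_const_iff {c k : ℝ} : eulerLagrange c k k k 0 0 = 0 ↔
    2 * omega0 c k * k + 2 / 3 * omega1 c k * k ^ (-(1 / 3) : ℝ) - 6 * k ^ (-(5 / 3) : ℝ) = 0 := by
  unfold eulerLagrange
  simp

theorem rpow_four_thirds_mul {k : ℝ} (hk : 0 < k) : k ^ (4 / 3 : ℝ) * k ^ (-(1 / 3) : ℝ) = k := by
  rw [← Real.rpow_add hk]; norm_num

/-- The local part of the action is quadratic at `(k, 0)`, because the constant `k` solves the
Euler–Lagrange equation. -/
theorem exists_lagr_le {c k lo hi : ℝ} (hlo : 0 < lo) (hk : k ∈ Icc lo hi)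
    (hE : eulerLagrange c k k k 0 0 = 0) :
    ∃ C, ∀ m ∈ Icc lo hi, ∀ m₁, |lagr c k m m₁| ≤ C * ((m - k) ^ 2 + m₁ ^ 2) := by
  obtain ⟨C₁, h₁, H₁⟩ := exists_rpow_taylor_two (2 / 3) hlo hi
  obtain ⟨C₂, h₂, H₂⟩ := exists_rpow_taylor_two (-(2 / 3)) hlo hi
  obtain ⟨C₃, h₃, H₃⟩ := exists_abs_rpow_le (-(8 / 3)) hlo hi
  rw [show (2 / 3 - 1 : ℝ) = -(1 / 3) by norm_num] at H₁
  rw [show (-(2 / 3) - 1 : ℝ) = -(5 / 3) by norm_num] at H₂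
  rw [euler_const_iff] at hE
  refine ⟨|omega1 c k| * C₁ + 9 * C₂ + C₃, fun m hm m₁ => ?_⟩
  have b1 := H₁ k hk m hm
  have b2 := H₂ k hk m hm
  have b3 := H₃ m hm
  rw [sq_abs] at b1 b2
  set t1 := m ^ (2 / 3 : ℝ) - k ^ (2 / 3 : ℝ) - 2 / 3 * k ^ (-(1 / 3) : ℝ) * (m - k)
  set t2 := m ^ (-(2 / 3) : ℝ) - k ^ (-(2 / 3) : ℝ) - -(2 / 3) * k ^ (-(5 / 3) : ℝ) * (m - k)
  have e : lagr c k m m₁ = omega1 c k * t1 + 9 * t2 + m ^ (-(8 / 3) : ℝ) * m₁ ^ 2 := by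
    unfold lagr
    linear_combination (m - k) * hE
  rw [e]
  have n1 : 0 ≤ m₁ ^ 2 := sq_nonneg _
  have n2 : 0 ≤ (m - k) ^ 2 := sq_nonneg _
  calc |omega1 c k * t1 + 9 * t2 + m ^ (-(8 / 3) : ℝ) * m₁ ^ 2|
      ≤ |omega1 c k| * |t1| + 9 * |t2| + |m ^ (-(8 / 3) : ℝ)| * m₁ ^ 2 := by
        refine (abs_add_le _ _).trans (add_le_add ((abs_add_le _ _).trans_eq ?_) ?_)
        · rw [abs_mul, abs_mul, abs_of_pos (by norm_num : (0 : ℝ) < 9)]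
        · rw [abs_mul, abs_of_nonneg n1]
    _ ≤ |omega1 c k| * (C₁ * (m - k) ^ 2) + 9 * (C₂ * (m - k) ^ 2) + C₃ * m₁ ^ 2 := by gcongr
    _ ≤ _ := by
        have := mul_nonneg (mul_nonneg (abs_nonneg (omega1 c k)) h₁) n1
        have := mul_nonneg h₂ n1
        have := mul_nonneg h₃ n2
        nlinarith

theorem exists_lagrF_le {k lo hi : ℝ} (hlo : 0 < lo) (hk : k ∈ Icc lo hi) :
    ∃ C, ∀ m ∈ Icc lo hi, |lagrF k m| ≤ C * (m - k) ^ 2 := by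
  obtain ⟨C₁, h₁, H₁⟩ := exists_rpow_taylor_two (2 / 3) hlo hi
  rw [show (2 / 3 - 1 : ℝ) = -(1 / 3) by norm_num] at H₁
  have hk0 : 0 < k := lt_of_lt_of_le hlo hk.1
  refine ⟨3 * k ^ (4 / 3 : ℝ) * C₁, fun m hm => ?_⟩
  have b1 := H₁ k hk m hm
  rw [sq_abs] at b1
  have e : lagrF k m = -(3 * k ^ (4 / 3 : ℝ)) *
      (m ^ (2 / 3 : ℝ) - k ^ (2 / 3 : ℝ) - 2 / 3 * k ^ (-(1 / 3) : ℝ) * (m - k)) := by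
    unfold lagrF
    linear_combination -2 * (m - k) * rpow_four_thirds_mul hk0
  rw [e, abs_mul, abs_neg, abs_of_nonneg (by positivity), mul_assoc _ C₁]
  exact mul_le_mul_of_nonneg_left b1 (by positivity)

theorem IsH1.exists_bounds {v f : ℝ → ℝ} {k : ℝ} (hv : IsH1 v f) (hk : 0 < k)
    (hpos : ∀ x, 0 < v x + k) : ∃ lo hi, 0 < lo ∧ k ∈ Icc lo hi ∧ ∀ x, v x + k ∈ Icc lo hi := by
  have hc : Continuous fun x => v x + k := hv.continuous.add continuous_const
  have hT : Tendsto (fun x => v x + k) atTop (𝓝 k) := by simpa using hv.tendsto_atTop.add_const k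
  have hB : Tendsto (fun x => v x + k) atBot (𝓝 k) := by simpa using hv.tendsto_atBot.add_const k
  obtain ⟨C, hC⟩ := bounded_of_tendsto hc hT hB
  obtain ⟨C', hC'⟩ := bounded_of_tendsto (hc.inv₀ fun x => (hpos x).ne') (hT.inv₀ hk.ne')
    (hB.inv₀ hk.ne')
  have hC'0 : 0 < C' := lt_of_lt_of_le (abs_pos.2 (inv_ne_zero (hpos 0).ne')) (hC' 0)
  refine ⟨min C'⁻¹ k, max C k, lt_min (inv_pos.2 hC'0) hk, ⟨min_le_right _ _, le_max_right _ _⟩,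
    fun x => ⟨(min_le_left _ _).trans ?_, (le_abs_self _).trans ((hC x).trans (le_max_left _ _))⟩⟩
  have := hC' x
  rw [Pi.inv_apply, abs_of_pos (inv_pos.2 (hpos x))] at this
  exact inv_le_of_inv_le₀ (hpos x) this

theorem aestronglyMeasurable_lagr {c k : ℝ} {v f : ℝ → ℝ} (hv : IsH1 v f)
    (hpos : ∀ x, 0 < v x + k) : AEStronglyMeasurable (fun x => lagr c k (v x + k) (f x)) := by
  have hc : Continuous fun x => v x + k := hv.continuous.add continuous_const
  have h1 := continuous_rpow_of_pos hc hpos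
  have h8 := h1 (-(8 / 3))
  have h2 := h1 (2 / 3)
  have h3 := h1 (-(2 / 3))
  unfold lagr
  have hf := hv.memLp_deriv.1
  refine (AEStronglyMeasurable.add ?_ (h8.aestronglyMeasurable.mul (hf.pow 2))).add ?_
  · exact (((hc.sub continuous_const).const_mul _).add
      ((h2.sub continuous_const).const_mul _)).aestronglyMeasurable
  · exact ((h3.sub continuous_const).const_mul _).aestronglyMeasurable

theorem IsH1.integrable_lagr {c k : ℝ} {v f : ℝ → ℝ} (hv : IsH1 v f) (hk : 0 < k)
    (hpos : ∀ x, 0 < v x + k) (hE : eulerLagrange c k k k 0 0 = 0) :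
    Integrable (fun x => lagr c k (v x + k) (f x)) := by
  obtain ⟨lo, hi, hlo, hkI, hI⟩ := hv.exists_bounds hk hpos
  obtain ⟨C, hC⟩ := exists_lagr_le hlo hkI hE
  refine Integrable.mono' (((integrable_sq_of_memLp hv.memLp).add
    (integrable_sq_of_memLp hv.memLp_deriv)).const_mul C) (aestronglyMeasurable_lagr hv hpos)
    (Eventually.of_forall fun x => ?_)
  simpa using hC _ (hI x) (f x)

theorem IsH1.integrable_lagrF {k : ℝ} {v f : ℝ → ℝ} (hv : IsH1 v f) (hk : 0 < k)
    (hpos : ∀ x, 0 < v x + k) : Integrable (fun x => lagrF k (v x + k)) := by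
  obtain ⟨lo, hi, hlo, hkI, hI⟩ := hv.exists_bounds hk hpos
  obtain ⟨C, hC⟩ := exists_lagrF_le hlo hkI
  have hc : Continuous fun x => v x + k := hv.continuous.add continuous_const
  have h2 := continuous_rpow_of_pos hc hpos (2 / 3)
  refine Integrable.mono' ((integrable_sq_of_memLp hv.memLp).const_mul C) ?_
    (Eventually.of_forall fun x => ?_)
  · unfold lagrF
    exact (((hc.sub continuous_const).const_mul _).sub
      ((h2.sub continuous_const).const_mul _)).aestronglyMeasurable
  · simpa using hC _ (hI x)

theorem IsH1.integrable_mul_helmholtzInv {v f : ℝ → ℝ} (hv : IsH1 v f) :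
    Integrable (fun x => v x * helmholtzInv v x) :=
  integrable_mul_of_memLp hv.memLp (memLp_helmholtzInv hv.memLp)

/-- Adding a multiple of `(1 - ∂ₓ²)⁻¹ v - v` does not change an improper integral. -/
theorem IsH1.improperIntegral_eq {v f r dens : ℝ → ℝ} (hv : IsH1 v f) (hr : Integrable r) (κ : ℝ)
    (hd : ∀ᵐ x, dens x = κ * (helmholtzInv v x - v x) + r x) :
    ImproperlyIntegrable dens ∧ improperIntegral dens = ∫ x, r x := by
  have hG := continuous_helmholtzInv (integrable_green_mul hv.memLp) hv.continuous
  have hGv : Continuous fun x => helmholtzInv v x - v x := hG.sub hv.continuous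
  have hloc : LocallyIntegrable (fun x => κ * (helmholtzInv v x - v x) + r x) :=
    ((hGv.const_mul κ).locallyIntegrable).add hr.locallyIntegrable
  have ht : Tendsto (fun p : ℝ × ℝ => ∫ x in (-p.1)..p.2, dens x) atTop (𝓝 (∫ x, r x)) := by
    have h1 := (hv.tendsto_integral_helmholtzInv_sub).const_mul κ
    have h2 : Tendsto (fun p : ℝ × ℝ => ∫ x in (-p.1)..p.2, r x) atTop (𝓝 (∫ x, r x)) := by
      rw [← prod_atTop_atTop_eq]
      exact intervalIntegral_tendsto_integral hr (tendsto_neg_atTop_atBot.comp tendsto_fst)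
        tendsto_snd
    have h3 := h1.add h2
    rw [mul_zero, zero_add] at h3
    refine h3.congr fun p => ?_
    rw [← intervalIntegral.integral_const_mul, ← intervalIntegral.integral_add
      ((hGv.const_mul κ).intervalIntegrable _ _) hr.intervalIntegrable]
    refine intervalIntegral.integral_congr_ae ?_
    filter_upwards [hd] with x hx _
    rw [hx]
  refine ⟨⟨hloc.congr ?_, _, ht⟩, ht.limUnder_eq⟩
  filter_upwards [hd] with x hx
  rw [hx]

section Functionals

variable {c k : ℝ} {v f : ℝ → ℝ}

/-- The improper integral defining `𝓕` converges, to a Lebesgue integral. -/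
theorem IsH1.constraintF_eq (hv : IsH1 v f) (hk : 0 < k) (hpos : ∀ x, 0 < v x + k) :
    ImproperlyIntegrable (densF k fun x => v x + k) ∧
      constraintF k (fun x => v x + k) = regF k v := by
  refine hv.improperIntegral_eq (hv.integrable_mul_helmholtzInv.add (hv.integrable_lagrF hk hpos)) k
    (Eventually.of_forall fun x => ?_)
  simp only [densF, densE, densF1, lagrF, helmholtzInv_add_const hv.memLp]
  ring

/-- The improper integral defining `Λ` converges, to a Lebesgue integral. -/
theorem IsH1.Lambda_eq (hv : IsH1 v f) (hk : 0 < k) (hpos : ∀ x, 0 < v x + k)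
    (hE : eulerLagrange c k k k 0 0 = 0) :
    ImproperlyIntegrable (densLambda c k fun x => v x + k) ∧
      Lambda c k (fun x => v x + k) = regLambda c k v f := by
  refine hv.improperIntegral_eq ((hv.integrable_mul_helmholtzInv.const_mul (omega0 c k)).add
    (hv.integrable_lagr hk hpos hE)) (omega0 c k * k) ?_
  filter_upwards [weakDeriv_ae_eq (hv.toIsPrimitive.add_const k).isWeakDeriv] with x hx
  simp only [densLambda, densE, densF1, densF2, lagr, helmholtzInv_add_const hv.memLp, hx]
  ring

theorem regLambda_comp_add_right (c k : ℝ) (v f : ℝ → ℝ) (s : ℝ) :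
    regLambda c k (fun x => v (x + s)) (fun x => f (x + s)) = regLambda c k v f := by
  unfold regLambda
  rw [← integral_add_right_eq_self (fun x => omega0 c k * (v x * helmholtzInv v x)
    + lagr c k (v x + k) (f x)) s]
  simp only [helmholtzInv_comp_add_right]

theorem regF_comp_add_right (k : ℝ) (v : ℝ → ℝ) (s : ℝ) :
    regF k (fun x => v (x + s)) = regF k v := by
  unfold regF
  rw [← integral_add_right_eq_self (fun x => v x * helmholtzInv v x + lagrF k (v x + k)) s]
  simp only [helmholtzInv_comp_add_right]

theorem exists_isH1_of_mem_Xspace {m : ℝ → ℝ} (hm : m ∈ Xspace k) :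
    ∃ v f : ℝ → ℝ, IsH1 v f ∧ (∀ x, 0 < v x + k) ∧ m = fun x => v x + k := by
  obtain ⟨hc, h1, hpos⟩ := hm
  exact ⟨fun x => m x - k, _, isH1_of_memH1 h1 (hc.sub continuous_const),
    fun x => by simpa using hpos x, by simp⟩

end Functionals

/-! ### Taylor expansion of the functionals -/

/-- Second-order expansion of the local part of the action. It is exactly quadratic in `m'`, so the
error keeps one factor `|h|` and needs no bound on `g`. -/
theorem exists_lagr_taylor (c k : ℝ) {lo : ℝ} (hlo : 0 < lo) (hi : ℝ) {b : ℝ} (hb : 0 ≤ b) :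
    ∃ C, 0 ≤ C ∧ ∀ m ∈ Icc lo hi, ∀ h, m + h ∈ Icc lo hi → ∀ m₁, |m₁| ≤ b → ∀ g,
      |lagr c k (m + h) (m₁ + g) - lagr c k m m₁
        - ((2 * omega0 c k * k + 2 / 3 * omega1 c k * m ^ (-(1 / 3) : ℝ)
            - 8 / 3 * m ^ (-(11 / 3) : ℝ) * m₁ ^ 2 - 6 * m ^ (-(5 / 3) : ℝ)) * h
          + 2 * m ^ (-(8 / 3) : ℝ) * m₁ * g)
        - ((-(1 / 9) * omega1 c k * m ^ (-(4 / 3) : ℝ) + 44 / 9 * m ^ (-(14 / 3) : ℝ) * m₁ ^ 2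
            + 5 * m ^ (-(8 / 3) : ℝ)) * h ^ 2
          - 16 / 3 * m ^ (-(11 / 3) : ℝ) * m₁ * h * g + m ^ (-(8 / 3) : ℝ) * g ^ 2)|
      ≤ C * (|h| * (h ^ 2 + g ^ 2)) := by
  obtain ⟨C₁, h₁, H₁⟩ := exists_rpow_taylor_three (2 / 3) hlo hi
  obtain ⟨C₂, h₂, H₂⟩ := exists_rpow_taylor_three (-(2 / 3)) hlo hi
  obtain ⟨C₃, h₃, H₃⟩ := exists_rpow_taylor_three (-(8 / 3)) hlo hi
  obtain ⟨C₄, h₄, H₄⟩ := exists_rpow_taylor_two (-(8 / 3)) hlo hi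
  obtain ⟨C₅, h₅, H₅⟩ := exists_rpow_sub_le (-(8 / 3)) hlo hi
  rw [show (2 / 3 - 1 : ℝ) = -(1 / 3) by norm_num, show (2 / 3 - 2 : ℝ) = -(4 / 3) by norm_num]
    at H₁
  rw [show (-(2 / 3) - 1 : ℝ) = -(5 / 3) by norm_num,
    show (-(2 / 3) - 2 : ℝ) = -(8 / 3) by norm_num] at H₂
  rw [show (-(8 / 3) - 1 : ℝ) = -(11 / 3) by norm_num,
    show (-(8 / 3) - 2 : ℝ) = -(14 / 3) by norm_num] at H₃
  rw [show (-(8 / 3) - 1 : ℝ) = -(11 / 3) by norm_num] at H₄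
  refine ⟨|omega1 c k| * C₁ + 9 * C₂ + b ^ 2 * C₃ + 2 * b * C₄ + C₅, by positivity,
    fun m hm h hmh m₁ hm₁ g => ?_⟩
  have b1 := H₁ m hm _ hmh
  have b2 := H₂ m hm _ hmh
  have b3 := H₃ m hm _ hmh
  have b4 := H₄ m hm _ hmh
  have b5 := H₅ m hm _ hmh
  rw [add_sub_cancel_left] at b1 b2 b3 b4 b5
  set t1 := (m + h) ^ (2 / 3 : ℝ) - m ^ (2 / 3 : ℝ) - 2 / 3 * m ^ (-(1 / 3) : ℝ) * h
    - 2 / 3 * (-(1 / 3)) / 2 * m ^ (-(4 / 3) : ℝ) * h ^ 2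
  set t2 := (m + h) ^ (-(2 / 3) : ℝ) - m ^ (-(2 / 3) : ℝ) - -(2 / 3) * m ^ (-(5 / 3) : ℝ) * h
    - -(2 / 3) * (-(5 / 3)) / 2 * m ^ (-(8 / 3) : ℝ) * h ^ 2
  set t3 := (m + h) ^ (-(8 / 3) : ℝ) - m ^ (-(8 / 3) : ℝ) - -(8 / 3) * m ^ (-(11 / 3) : ℝ) * h
    - -(8 / 3) * (-(11 / 3)) / 2 * m ^ (-(14 / 3) : ℝ) * h ^ 2
  set t4 := (m + h) ^ (-(8 / 3) : ℝ) - m ^ (-(8 / 3) : ℝ) - -(8 / 3) * m ^ (-(11 / 3) : ℝ) * h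
  set t5 := (m + h) ^ (-(8 / 3) : ℝ) - m ^ (-(8 / 3) : ℝ)
  have hsq : m₁ ^ 2 ≤ b ^ 2 := by rw [← sq_abs]; gcongr
  have hh : |h| ^ 3 ≤ |h| * (h ^ 2 + g ^ 2) := by
    rw [pow_succ', sq_abs]
    gcongr
    linarith [sq_nonneg g]
  have hg : |h| ^ 2 * |g| ≤ |h| * (h ^ 2 + g ^ 2) := by
    rw [pow_two, mul_assoc]
    gcongr
    nlinarith [sq_abs h, sq_abs g, sq_nonneg (|h| - |g|), abs_nonneg h, abs_nonneg g]
  have hgg : |h| * g ^ 2 ≤ |h| * (h ^ 2 + g ^ 2) := by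
    gcongr
    linarith [sq_nonneg h]
  set P := |h| * (h ^ 2 + g ^ 2) with hP
  have hP0 : 0 ≤ P := by positivity
  calc _ = |omega1 c k * t1 + 9 * t2 + m₁ ^ 2 * t3 + 2 * m₁ * g * t4 + g ^ 2 * t5| := by
        congr 1
        simp only [lagr, t1, t2, t3, t4, t5]
        ring
    _ ≤ |omega1 c k| * |t1| + 9 * |t2| + m₁ ^ 2 * |t3| + 2 * |m₁| * |g| * |t4| + g ^ 2 * |t5| := by
        refine (abs_add_le _ _).trans (add_le_add ((abs_add_le _ _).trans (add_le_add
          ((abs_add_le _ _).trans (add_le_add ((abs_add_le _ _).trans_eq ?_) ?_)) ?_)) ?_)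
        · rw [abs_mul, abs_mul, abs_of_pos (by norm_num : (0 : ℝ) < 9)]
        · rw [abs_mul, abs_of_nonneg (sq_nonneg m₁)]
        · rw [abs_mul, abs_mul, abs_mul, abs_of_pos (by norm_num : (0 : ℝ) < 2)]
        · rw [abs_mul, abs_of_nonneg (sq_nonneg g)]
    _ ≤ |omega1 c k| * (C₁ * |h| ^ 3) + 9 * (C₂ * |h| ^ 3) + b ^ 2 * (C₃ * |h| ^ 3)
        + 2 * b * |g| * (C₄ * |h| ^ 2) + g ^ 2 * (C₅ * |h|) := by gcongr
    _ = |omega1 c k| * C₁ * |h| ^ 3 + 9 * C₂ * |h| ^ 3 + b ^ 2 * C₃ * |h| ^ 3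
        + 2 * b * C₄ * (|h| ^ 2 * |g|) + C₅ * (|h| * g ^ 2) := by ring
    _ ≤ |omega1 c k| * C₁ * P + 9 * C₂ * P + b ^ 2 * C₃ * P + 2 * b * C₄ * P + C₅ * P := by
        gcongr
    _ = _ := by ring

theorem exists_lagrF_taylor {k : ℝ} (hk : 0 < k) {lo : ℝ} (hlo : 0 < lo) (hi : ℝ) :
    ∃ C, 0 ≤ C ∧ ∀ m ∈ Icc lo hi, ∀ h, m + h ∈ Icc lo hi →
      |lagrF k (m + h) - lagrF k m - (2 * k - 2 * k ^ (4 / 3 : ℝ) * m ^ (-(1 / 3) : ℝ)) * h|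
        ≤ C * h ^ 2 := by
  obtain ⟨C₁, h₁, H₁⟩ := exists_rpow_taylor_two (2 / 3) hlo hi
  rw [show (2 / 3 - 1 : ℝ) = -(1 / 3) by norm_num] at H₁
  refine ⟨3 * k ^ (4 / 3 : ℝ) * C₁, by positivity, fun m hm h hmh => ?_⟩
  have b1 := H₁ m hm _ hmh
  rw [add_sub_cancel_left, sq_abs] at b1
  have e : lagrF k (m + h) - lagrF k m - (2 * k - 2 * k ^ (4 / 3 : ℝ) * m ^ (-(1 / 3) : ℝ)) * h =
      -(3 * k ^ (4 / 3 : ℝ)) *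
      ((m + h) ^ (2 / 3 : ℝ) - m ^ (2 / 3 : ℝ) - 2 / 3 * m ^ (-(1 / 3) : ℝ) * h) := by
    unfold lagrF
    ring
  rw [e, abs_mul, abs_neg, abs_of_nonneg (by positivity), mul_assoc _ C₁]
  exact mul_le_mul_of_nonneg_left b1 (by positivity)

/-! ### Second-order expansion at the wave -/

/-- `b` is continuous and bounded, so that it multiplies `L²(ℝ)`. -/
def IsBoundedContinuous (b : ℝ → ℝ) : Prop := Continuous b ∧ ∃ C, ∀ x, |b x| ≤ C

namespace IsBoundedContinuous

variable {a b f g : ℝ → ℝ}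

theorem mul (ha : IsBoundedContinuous a) (hb : IsBoundedContinuous b) :
    IsBoundedContinuous fun x => a x * b x := by
  obtain ⟨ca, A, hA⟩ := ha
  obtain ⟨cb, B, hB⟩ := hb
  refine ⟨ca.mul cb, A * B, fun x => ?_⟩
  rw [abs_mul]
  exact mul_le_mul (hA x) (hB x) (abs_nonneg _) ((abs_nonneg _).trans (hA x))

theorem add (ha : IsBoundedContinuous a) (hb : IsBoundedContinuous b) :
    IsBoundedContinuous fun x => a x + b x := by
  obtain ⟨ca, A, hA⟩ := ha
  obtain ⟨cb, B, hB⟩ := hb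
  exact ⟨ca.add cb, A + B, fun x => (abs_add_le _ _).trans (add_le_add (hA x) (hB x))⟩

theorem const_mul (ha : IsBoundedContinuous a) (t : ℝ) : IsBoundedContinuous fun x => t * a x :=
  mul ⟨continuous_const, |t|, fun _ => le_rfl⟩ ha

theorem memLp_mul (hb : IsBoundedContinuous b) (hf : MemLp f 2) : MemLp (fun x => b x * f x) 2 :=
  memLp_bdd_mul hf hb.1 hb.2

theorem integrable_mul (hb : IsBoundedContinuous b) (hf : MemLp f 2) (hg : MemLp g 2) :
    Integrable fun x => b x * (f x * g x) := by
  simpa only [mul_assoc] using integrable_mul_of_memLp (hb.memLp_mul hf) hg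

theorem isH1_mul {b' u : ℝ → ℝ} (hb : IsBoundedContinuous b) (hb' : IsBoundedContinuous b')
    (hd : ∀ x, HasDerivAt b (b' x) x) (hu : IsH1 u f) :
    IsH1 (fun x => b x * u x) (fun x => b' x * u x + b x * f x) where
  toIsPrimitive := (isPrimitive_of_hasDerivAt hd hb'.1).mul hu.toIsPrimitive
  memLp := hb.memLp_mul hu.memLp
  memLp_deriv := (hb'.memLp_mul hu.memLp).add (hb.memLp_mul hu.memLp_deriv)

end IsBoundedContinuous

/-- The potential of the Hessian:
`𝓛 v = -2 (μ^{-8/3} v')' + hessPotential · v + 2 ω₀ (1 - ∂ₓ²)⁻¹ v`. -/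
def hessPotential (c k : ℝ) (μ μ₁ μ₂ : ℝ → ℝ) (x : ℝ) : ℝ :=
  -(2 / 9) * omega1 c k * μ x ^ (-(4 / 3) : ℝ) + 10 * μ x ^ (-(8 / 3) : ℝ)
    + 16 / 3 * (μ x ^ (-(11 / 3) : ℝ) * μ₂ x)
    - 88 / 9 * (μ x ^ (-(14 / 3) : ℝ) * (μ₁ x * μ₁ x))

/-- The integrand of the quadratic form of `𝓛`, polarized; `f` and `g` are the derivatives of `u`
and `v`. -/
def hessDens (c k : ℝ) (μ μ₁ μ₂ u f v g : ℝ → ℝ) (x : ℝ) : ℝ :=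
  2 * μ x ^ (-(8 / 3) : ℝ) * (f x * g x) + hessPotential c k μ μ₁ μ₂ x * (u x * v x)
    + 2 * omega0 c k * (u x * helmholtzInv v x)

/-- The quadratic form of `𝓛`, polarized; `f` and `g` are the derivatives of `u` and `v`. -/
def hessForm (c k : ℝ) (μ μ₁ μ₂ u f v g : ℝ → ℝ) : ℝ := ∫ x, hessDens c k μ μ₁ μ₂ u f v g x

namespace SolitaryProfile

variable {c k : ℝ} {φ φ₁ μ μ₁ μ₂ μ₃ : ℝ → ℝ}

theorem pos (P : SolitaryProfile c k φ φ₁ μ μ₁ μ₂ μ₃) (x : ℝ) : 0 < μ x := by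
  obtain ⟨lo, hi, hlo, hb⟩ := P.bounds
  exact hlo.trans_le (hb x).1

theorem continuous (P : SolitaryProfile c k φ φ₁ μ μ₁ μ₂ μ₃) : Continuous μ :=
  continuous_iff_continuousAt.2 fun x => (P.hasDerivAt x).continuousAt

theorem continuous₁ (P : SolitaryProfile c k φ φ₁ μ μ₁ μ₂ μ₃) : Continuous μ₁ :=
  continuous_iff_continuousAt.2 fun x => (P.hasDerivAt₁ x).continuousAt

theorem continuous₂ (P : SolitaryProfile c k φ φ₁ μ μ₁ μ₂ μ₃) : Continuous μ₂ :=
  continuous_iff_continuousAt.2 fun x => (P.hasDerivAt₂ x).continuousAt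

theorem isBoundedContinuous₁ (P : SolitaryProfile c k φ φ₁ μ μ₁ μ₂ μ₃) : IsBoundedContinuous μ₁ :=
  ⟨P.continuous₁, P.bounded₁⟩

theorem isBoundedContinuous₂ (P : SolitaryProfile c k φ φ₁ μ μ₁ μ₂ μ₃) : IsBoundedContinuous μ₂ :=
  ⟨P.continuous₂, P.bounded₂⟩

theorem rpow (P : SolitaryProfile c k φ φ₁ μ μ₁ μ₂ μ₃) (q : ℝ) :
    IsBoundedContinuous fun x => μ x ^ q := by
  obtain ⟨lo, hi, hlo, hb⟩ := P.bounds
  obtain ⟨C, -, hC⟩ := exists_abs_rpow_le q hlo hi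
  exact ⟨continuous_rpow_of_pos P.continuous P.pos q, C, fun x => hC _ (hb x)⟩

theorem hasDerivAt_rpow (P : SolitaryProfile c k φ φ₁ μ μ₁ μ₂ μ₃) (q x : ℝ) :
    HasDerivAt (fun x => μ x ^ q) (q * (μ x ^ (q - 1) * μ₁ x)) x := by
  convert (P.hasDerivAt x).rpow_const (p := q) (Or.inl (P.pos x).ne') using 1
  ring

theorem isBoundedContinuous_hessPotential (P : SolitaryProfile c k φ φ₁ μ μ₁ μ₂ μ₃) :
    IsBoundedContinuous (hessPotential c k μ μ₁ μ₂) := by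
  unfold hessPotential
  simp only [sub_eq_add_neg, ← neg_mul]
  exact ((((P.rpow _).const_mul _).add ((P.rpow _).const_mul _)).add
    (((P.rpow _).mul P.isBoundedContinuous₂).const_mul _)).add
    (((P.rpow _).mul (P.isBoundedContinuous₁.mul P.isBoundedContinuous₁)).const_mul _)

theorem isH1 (P : SolitaryProfile c k φ φ₁ μ μ₁ μ₂ μ₃) : IsH1 (fun x => μ x - k) μ₁ where
  toIsPrimitive := by
    simpa [sub_eq_add_neg] using
      (isPrimitive_of_hasDerivAt P.hasDerivAt P.continuous₁).add_const (-k)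
  memLp := P.memLp
  memLp_deriv := P.memLp₁

theorem isH1₁ (P : SolitaryProfile c k φ φ₁ μ μ₁ μ₂ μ₃) : IsH1 μ₁ μ₂ where
  toIsPrimitive := isPrimitive_of_hasDerivAt P.hasDerivAt₁ P.continuous₂
  memLp := P.memLp₁
  memLp_deriv := P.memLp₂

theorem isH1₂ (P : SolitaryProfile c k φ φ₁ μ μ₁ μ₂ μ₃) : IsH1 μ₂ μ₃ where
  toIsPrimitive := isPrimitive_of_hasDerivAt P.hasDerivAt₂ P.continuous₃
  memLp := P.memLp₂
  memLp_deriv := P.memLp₃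

theorem helmholtz_sub (P : SolitaryProfile c k φ φ₁ μ μ₁ μ₂ μ₃) (x : ℝ) :
    helmholtzInv (fun y => μ y - k) x = φ x - k := by
  have := helmholtzInv_add_const P.memLp k x
  simp only [sub_add_cancel] at this
  rw [P.helmholtz] at this
  linarith

/-- The flux `μ^{-8/3} v'` of an `H²` function `v` is in `H¹`; here `u = v'`. -/
theorem isH1_flux (P : SolitaryProfile c k φ φ₁ μ μ₁ μ₂ μ₃) {u f : ℝ → ℝ} (hu : IsH1 u f) :
    IsH1 (fun x => μ x ^ (-(8 / 3) : ℝ) * u x)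
      (fun x => -(8 / 3) * (μ x ^ (-(11 / 3) : ℝ) * μ₁ x) * u x + μ x ^ (-(8 / 3) : ℝ) * f x) := by
  refine (P.rpow _).isH1_mul (((P.rpow _).mul P.isBoundedContinuous₁).const_mul _) (fun x => ?_) hu
  convert P.hasDerivAt_rpow (-(8 / 3)) x using 4
  norm_num

theorem integrable_hessDens (P : SolitaryProfile c k φ φ₁ μ μ₁ μ₂ μ₃) {u f v g : ℝ → ℝ}
    (hu : MemLp u 2) (hf : MemLp f 2) (hv : MemLp v 2) (hg : MemLp g 2) :
    Integrable (hessDens c k μ μ₁ μ₂ u f v g) :=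
  ((((P.rpow _).const_mul 2).integrable_mul hf hg).add
    (P.isBoundedContinuous_hessPotential.integrable_mul hu hv)).add
    ((integrable_mul_of_memLp hu (memLp_helmholtzInv hv)).const_mul _)

/-- The first variation of the action vanishes at the wave, by the Euler–Lagrange equation and
integration by parts of the flux `2 μ^{-8/3} μ'`. -/
theorem integral_firstVariation (P : SolitaryProfile c k φ φ₁ μ μ₁ μ₂ μ₃) {h g : ℝ → ℝ}
    (hh : IsH1 h g) :
    Integrable (fun x => (2 * omega0 c k * (φ x - k) + (2 * omega0 c k * k
        + 2 / 3 * omega1 c k * μ x ^ (-(1 / 3) : ℝ)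
        - 8 / 3 * μ x ^ (-(11 / 3) : ℝ) * μ₁ x ^ 2 - 6 * μ x ^ (-(5 / 3) : ℝ))) * h x
      + 2 * μ x ^ (-(8 / 3) : ℝ) * μ₁ x * g x) ∧
    ∫ x, ((2 * omega0 c k * (φ x - k) + (2 * omega0 c k * k
        + 2 / 3 * omega1 c k * μ x ^ (-(1 / 3) : ℝ)
        - 8 / 3 * μ x ^ (-(11 / 3) : ℝ) * μ₁ x ^ 2 - 6 * μ x ^ (-(5 / 3) : ℝ))) * h x
      + 2 * μ x ^ (-(8 / 3) : ℝ) * μ₁ x * g x) = 0 := by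
  have hF := P.isH1_flux P.isH1₁
  have i1 := integrable_mul_of_memLp hF.memLp hh.memLp_deriv
  have i2 := integrable_mul_of_memLp hF.memLp_deriv hh.memLp
  have hI := hF.integral_mul_deriv hh
  have e : ∀ x, (2 * omega0 c k * (φ x - k) + (2 * omega0 c k * k
        + 2 / 3 * omega1 c k * μ x ^ (-(1 / 3) : ℝ)
        - 8 / 3 * μ x ^ (-(11 / 3) : ℝ) * μ₁ x ^ 2 - 6 * μ x ^ (-(5 / 3) : ℝ))) * h x
      + 2 * μ x ^ (-(8 / 3) : ℝ) * μ₁ x * g x =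
      2 * (μ x ^ (-(8 / 3) : ℝ) * μ₁ x * g x + (-(8 / 3) * (μ x ^ (-(11 / 3) : ℝ) * μ₁ x) * μ₁ x
        + μ x ^ (-(8 / 3) : ℝ) * μ₂ x) * h x) := fun x => by
    have := P.euler x
    unfold eulerLagrange at this
    linear_combination h x * this
  simp only [e]
  refine ⟨(i1.add i2).const_mul 2, ?_⟩
  rw [integral_const_mul, integral_add i1 i2, hI]
  ring

/-- The mixed term of the second variation, integrated by parts. -/
theorem integral_mixed (P : SolitaryProfile c k φ φ₁ μ μ₁ μ₂ μ₃) {h g : ℝ → ℝ} (hh : IsH1 h g) :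
    Integrable (fun x => (-(8 / 3) * (μ x ^ (-(11 / 3) : ℝ) * μ₂ x)
        + 88 / 9 * (μ x ^ (-(14 / 3) : ℝ) * (μ₁ x * μ₁ x))) * h x ^ 2
      - 16 / 3 * μ x ^ (-(11 / 3) : ℝ) * μ₁ x * h x * g x) ∧
    ∫ x, ((-(8 / 3) * (μ x ^ (-(11 / 3) : ℝ) * μ₂ x)
        + 88 / 9 * (μ x ^ (-(14 / 3) : ℝ) * (μ₁ x * μ₁ x))) * h x ^ 2
      - 16 / 3 * μ x ^ (-(11 / 3) : ℝ) * μ₁ x * h x * g x) = 0 := by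
  have b1 := P.isBoundedContinuous₁
  have hB := (P.rpow (-(11 / 3))).mul b1
  have hB' : IsBoundedContinuous (fun x => -(11 / 3) * (μ x ^ (-(14 / 3) : ℝ) * (μ₁ x * μ₁ x))
      + μ x ^ (-(11 / 3) : ℝ) * μ₂ x) :=
    (((P.rpow _).mul (b1.mul b1)).const_mul _).add ((P.rpow _).mul P.isBoundedContinuous₂)
  have hd : ∀ x, HasDerivAt (fun x => μ x ^ (-(11 / 3) : ℝ) * μ₁ x)
      (-(11 / 3) * (μ x ^ (-(14 / 3) : ℝ) * (μ₁ x * μ₁ x)) + μ x ^ (-(11 / 3) : ℝ) * μ₂ x) x :=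
    fun x => by
    refine ((P.hasDerivAt_rpow (-(11 / 3)) x).mul (P.hasDerivAt₁ x)).congr_deriv ?_
    rw [show (-(11 / 3) - 1 : ℝ) = -(14 / 3) by norm_num]
    ring
  have hF := hB.isH1_mul hB' hd hh
  have i1 := integrable_mul_of_memLp hF.memLp hh.memLp_deriv
  have i2 := integrable_mul_of_memLp hF.memLp_deriv hh.memLp
  have hI := hF.integral_mul_deriv hh
  have e : ∀ x, (-(8 / 3) * (μ x ^ (-(11 / 3) : ℝ) * μ₂ x)
        + 88 / 9 * (μ x ^ (-(14 / 3) : ℝ) * (μ₁ x * μ₁ x))) * h x ^ 2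
      - 16 / 3 * μ x ^ (-(11 / 3) : ℝ) * μ₁ x * h x * g x =
      -(8 / 3) * (μ x ^ (-(11 / 3) : ℝ) * μ₁ x * h x * g x
        + ((-(11 / 3) * (μ x ^ (-(14 / 3) : ℝ) * (μ₁ x * μ₁ x)) + μ x ^ (-(11 / 3) : ℝ) * μ₂ x)
          * h x + μ x ^ (-(11 / 3) : ℝ) * μ₁ x * g x) * h x) := fun x => by ring
  simp only [e]
  refine ⟨(i1.add i2).const_mul _, ?_⟩
  rw [integral_const_mul, integral_add i1 i2, hI]
  ring

theorem sub_add_self_add (h : ℝ → ℝ) (x : ℝ) : μ x - k + h x + k = μ x + h x := by ring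

/-- The action near the wave is half of the Hessian form, up to a cubic error. -/
theorem exists_regLambda_expansion (P : SolitaryProfile c k φ φ₁ μ μ₁ μ₂ μ₃) :
    ∃ C, 0 ≤ C ∧ ∃ ε₀, 0 < ε₀ ∧ ∀ h g : ℝ → ℝ, IsH1 h g → ∀ ε ≤ ε₀, (∀ x, |h x| ≤ ε) →
      |regLambda c k (fun x => μ x - k + h x) (fun x => μ₁ x + g x)
          - regLambda c k (fun x => μ x - k) μ₁ - hessForm c k μ μ₁ μ₂ h g h g / 2|
        ≤ C * ε * ((∫ x, h x ^ 2) + ∫ x, g x ^ 2) := by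
  obtain ⟨lo, hi, hlo, hb⟩ := P.bounds
  obtain ⟨b, hb1⟩ := P.bounded₁
  obtain ⟨C, hC0, hC⟩ := exists_lagr_taylor c k (half_pos hlo) (hi + lo / 2)
    ((abs_nonneg _).trans (hb1 0))
  refine ⟨C, hC0, lo / 2, half_pos hlo, fun h g hh ε hε hhε => ?_⟩
  have hw := P.isH1
  have hwh := hw.add hh
  have hμI : ∀ x, μ x ∈ Icc (lo / 2) (hi + lo / 2) := fun x =>
    ⟨by linarith [(hb x).1], by linarith [(hb x).2]⟩
  have hμhI : ∀ x, μ x + h x ∈ Icc (lo / 2) (hi + lo / 2) := fun x => by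
    have := abs_le.1 ((hhε x).trans hε)
    exact ⟨by linarith [(hb x).1], by linarith [(hb x).2]⟩
  have iT := ((hwh.integrable_mul_helmholtzInv.const_mul (omega0 c k)).add
    (hwh.integrable_lagr P.k_pos (fun x => by
      rw [sub_add_self_add]; linarith [(hμhI x).1]) P.euler_const)).sub
    ((hw.integrable_mul_helmholtzInv.const_mul (omega0 c k)).add
    (hw.integrable_lagr P.k_pos (fun x => by
      rw [sub_add_cancel]; exact P.pos x) P.euler_const))
  obtain ⟨i1, I1⟩ := P.integral_firstVariation hh
  obtain ⟨i2, I2⟩ := P.integral_mixed hh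
  have i3 := (P.integrable_hessDens hh.memLp hh.memLp_deriv hh.memLp hh.memLp_deriv).div_const 2
  have i4a := integrable_mul_of_memLp hw.memLp (memLp_helmholtzInv hh.memLp)
  have i4b := integrable_mul_of_memLp hh.memLp (memLp_helmholtzInv hw.memLp)
  have i4 := (i4a.sub i4b).const_mul (omega0 c k)
  have iS := ((i1.add i2).add i3).add i4
  have hi2 := (integrable_sq_of_memLp hh.memLp).add (integrable_sq_of_memLp hh.memLp_deriv)
  -- the remainder is the difference of the actions minus four terms: the first variation, the mixed
  -- term, half of the Hessian density, and an antisymmetric term in `(1 - ∂ₓ²)⁻¹`; all but the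
  -- third integrate to zero
  have E : regLambda c k (fun x => μ x - k + h x) (fun x => μ₁ x + g x)
      - regLambda c k (fun x => μ x - k) μ₁ - hessForm c k μ μ₁ μ₂ h g h g / 2 =
      ∫ x, ((((omega0 c k * ((μ x - k + h x) * helmholtzInv (fun x => μ x - k + h x) x))
        + lagr c k (μ x - k + h x + k) (μ₁ x + g x)) - (omega0 c k * ((μ x - k) *
          helmholtzInv (fun x => μ x - k) x) + lagr c k (μ x - k + k) (μ₁ x))) -
        ((((2 * omega0 c k * (φ x - k) + (2 * omega0 c k * k
        + 2 / 3 * omega1 c k * μ x ^ (-(1 / 3) : ℝ)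
        - 8 / 3 * μ x ^ (-(11 / 3) : ℝ) * μ₁ x ^ 2 - 6 * μ x ^ (-(5 / 3) : ℝ))) * h x
      + 2 * μ x ^ (-(8 / 3) : ℝ) * μ₁ x * g x) + ((-(8 / 3) * (μ x ^ (-(11 / 3) : ℝ) * μ₂ x)
        + 88 / 9 * (μ x ^ (-(14 / 3) : ℝ) * (μ₁ x * μ₁ x))) * h x ^ 2
      - 16 / 3 * μ x ^ (-(11 / 3) : ℝ) * μ₁ x * h x * g x)
      + hessDens c k μ μ₁ μ₂ h g h g x / 2)
      + omega0 c k * ((μ x - k) * helmholtzInv h x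
        - h x * helmholtzInv (fun x => μ x - k) x))) := by
    have s1 := integral_sub iT iS
    have s2 := integral_sub ((hwh.integrable_mul_helmholtzInv.const_mul (omega0 c k)).add
      (hwh.integrable_lagr P.k_pos (fun x => by
      rw [sub_add_self_add]; linarith [(hμhI x).1]) P.euler_const))
      ((hw.integrable_mul_helmholtzInv.const_mul (omega0 c k)).add
    (hw.integrable_lagr P.k_pos (fun x => by
      rw [sub_add_cancel]; exact P.pos x) P.euler_const))
    have s3 := integral_add ((i1.add i2).add i3) i4
    have s4 := integral_add (i1.add i2) i3
    have s5 := integral_add i1 i2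
    have s6 := integral_const_mul (μ := volume) (omega0 c k)
      (fun x => (μ x - k) * helmholtzInv h x - h x * helmholtzInv (fun x => μ x - k) x)
    have s7 := integral_sub i4a i4b
    have s8 := integral_div (μ := volume) 2 (hessDens c k μ μ₁ μ₂ h g h g)
    rw [integral_mul_helmholtzInv_comm hw.memLp hh.memLp, sub_self] at s7
    simp only [Pi.add_apply, Pi.sub_apply] at s1 s2 s3 s4 s5 s6 s7 s8
    rw [s1, s2, s3, s4, s5, s6, s7, s8, I1, I2]
    unfold regLambda hessForm
    ring
  rw [E]
  calc _ ≤ ∫ x, C * ε * (h x ^ 2 + g x ^ 2) := by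
        refine (Real.norm_eq_abs _).symm.trans_le (norm_integral_le_of_norm_le (hi2.const_mul _)
          (Eventually.of_forall fun x => ?_))
        have hx := hC _ (hμI x) (h x) (hμhI x) (μ₁ x) (hb1 x) (g x)
        have hx' : C * (|h x| * (h x ^ 2 + g x ^ 2)) ≤ C * ε * (h x ^ 2 + g x ^ 2) := by
          rw [← mul_assoc]
          exact mul_le_mul_of_nonneg_right (mul_le_mul_of_nonneg_left (hhε x) hC0) (by positivity)
        refine le_trans (le_of_eq ?_) (hx.trans hx')
        rw [Real.norm_eq_abs]
        congr 1
        rw [helmholtzInv_add hw.memLp hh.memLp, P.helmholtz_sub, sub_add_cancel, sub_add_self_add]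
        unfold hessDens hessPotential
        ring
    _ = _ := by
        rw [integral_const_mul]
        congr 1
        exact integral_add (integrable_sq_of_memLp hh.memLp) (integrable_sq_of_memLp hh.memLp_deriv)

/-- The constraint functional near the wave, to first order. -/
theorem exists_regF_expansion (P : SolitaryProfile c k φ φ₁ μ μ₁ μ₂ μ₃) :
    ∃ C, 0 ≤ C ∧ ∃ ε₀, 0 < ε₀ ∧ ∀ h g : ℝ → ℝ, IsH1 h g → (∀ x, |h x| ≤ ε₀) →
      |regF k (fun x => μ x - k + h x) - regF k (fun x => μ x - k) - ∫ x, varF k μ x * h x|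
        ≤ C * ∫ x, h x ^ 2 := by
  obtain ⟨lo, hi, hlo, hb⟩ := P.bounds
  obtain ⟨C, hC0, hC⟩ := exists_lagrF_taylor P.k_pos (half_pos hlo) (hi + lo / 2)
  refine ⟨C + 1, by positivity, lo / 2, half_pos hlo, fun h g hh hhε => ?_⟩
  have hw := P.isH1
  have hwh := hw.add hh
  have hμI : ∀ x, μ x ∈ Icc (lo / 2) (hi + lo / 2) := fun x =>
    ⟨by linarith [(hb x).1], by linarith [(hb x).2]⟩
  have hμhI : ∀ x, μ x + h x ∈ Icc (lo / 2) (hi + lo / 2) := fun x => by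
    have := abs_le.1 (hhε x)
    exact ⟨by linarith [(hb x).1], by linarith [(hb x).2]⟩
  have j1 := hwh.integrable_mul_helmholtzInv.add
    (hwh.integrable_lagrF P.k_pos (fun x => by
      rw [sub_add_self_add]; linarith [(hμhI x).1]))
  have j2 := hw.integrable_mul_helmholtzInv.add
    (hw.integrable_lagrF P.k_pos (fun x => by rw [sub_add_cancel]; exact P.pos x))
  have i1 := integrable_mul_of_memLp P.memLp_varF hh.memLp
  have i2 := hh.integrable_mul_helmholtzInv
  have i3a := integrable_mul_of_memLp hw.memLp (memLp_helmholtzInv hh.memLp)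
  have i3b := integrable_mul_of_memLp hh.memLp (memLp_helmholtzInv hw.memLp)
  have i3 := i3a.sub i3b
  have E : regF k (fun x => μ x - k + h x) - regF k (fun x => μ x - k) - ∫ x, varF k μ x * h x =
      (∫ x, h x * helmholtzInv h x) +
      ∫ x, ((((μ x - k + h x) * helmholtzInv (fun x => μ x - k + h x) x
        + lagrF k (μ x - k + h x + k)) - ((μ x - k) *
          helmholtzInv (fun x => μ x - k) x + lagrF k (μ x - k + k))) -
        ((varF k μ x * h x + h x * helmholtzInv h x)
        + ((μ x - k) * helmholtzInv h x - h x * helmholtzInv (fun x => μ x - k) x))) := by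
    have s1 := integral_sub (j1.sub j2) ((i1.add i2).add i3)
    have s2 := integral_sub j1 j2
    have s3 := integral_add (i1.add i2) i3
    have s4 := integral_add i1 i2
    have s7 := integral_sub i3a i3b
    rw [integral_mul_helmholtzInv_comm hw.memLp hh.memLp, sub_self] at s7
    simp only [Pi.add_apply, Pi.sub_apply] at s1 s2 s3 s4 s7
    rw [s1, s2, s3, s4, s7]
    unfold regF
    ring
  have B1 : |∫ x, h x * helmholtzInv h x| ≤ ∫ x, h x ^ 2 :=
    (abs_integral_mul_helmholtzInv_le hh.memLp hh.memLp).trans_eq (by ring)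
  rw [E, add_mul, one_mul, add_comm]
  refine (abs_add_le _ _).trans (add_le_add ?_ B1)
  rw [← integral_const_mul]
  refine (Real.norm_eq_abs _).symm.trans_le (norm_integral_le_of_norm_le
    ((integrable_sq_of_memLp hh.memLp).const_mul _) (Eventually.of_forall fun x => ?_))
  refine le_trans (le_of_eq ?_) (hC _ (hμI x) (h x) (hμhI x))
  rw [Real.norm_eq_abs]
  congr 1
  rw [helmholtzInv_add hw.memLp hh.memLp, P.helmholtz_sub, sub_add_cancel, sub_add_self_add]
  unfold varF
  rw [P.helmholtz]
  ring

end SolitaryProfile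

/-! ### The Hessian form on `L²(ℝ)` -/

theorem inner_eq_integral {u v : L2} {a b : ℝ → ℝ} (hu : u =ᵐ[volume] a) (hv : v =ᵐ[volume] b) :
    inner ℝ u v = ∫ x, a x * b x := by
  rw [L2.inner_def]
  refine integral_congr_ae ?_
  filter_upwards [hu, hv] with x hx hy
  rw [hx, hy]
  simp [mul_comm]

theorem norm_sq_eq_integral {u : L2} {a : ℝ → ℝ} (hu : u =ᵐ[volume] a) :
    ‖u‖ ^ 2 = ∫ x, a x ^ 2 := by
  rw [← real_inner_self_eq_norm_sq, inner_eq_integral hu hu]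
  simp only [pow_two]

theorem memLp_of_ae_eq {u : L2} {a : ℝ → ℝ} (hu : u =ᵐ[volume] a) : MemLp a 2 :=
  (Lp.memLp u).ae_eq hu

/-- The subspace of classes of `H¹(ℝ)` functions in `L²(ℝ)`. -/
def h1Submodule : Submodule ℝ L2 where
  carrier := {u | ∃ a f : ℝ → ℝ, u =ᵐ[volume] a ∧ IsH1 a f}
  add_mem' := by
    rintro u v ⟨a, f, ha, hf⟩ ⟨b, g, hb, hg⟩
    exact ⟨_, _, (Lp.coeFn_add u v).trans (ha.add hb), hf.add hg⟩
  zero_mem' := ⟨fun _ => 0, fun _ => 0, Lp.coeFn_zero _ _ _,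
    { locallyIntegrable := continuous_const.locallyIntegrable
      sub_eq := fun _ _ => by simp
      memLp := MemLp.zero
      memLp_deriv := MemLp.zero }⟩
  smul_mem' := by
    rintro t u ⟨a, f, ha, hf⟩
    exact ⟨_, _, (Lp.coeFn_smul t u).trans (ha.const_smul t), hf.const_mul t⟩

/-- The Hessian form on classes of `H¹(ℝ)` functions. -/
def hessQ (c k : ℝ) (μ μ₁ μ₂ : ℝ → ℝ) (u v : L2) : ℝ :=
  hessForm c k μ μ₁ μ₂ u (weakDeriv u) v (weakDeriv v)

theorem hessQ_eq (c k : ℝ) (μ μ₁ μ₂ : ℝ → ℝ) {u v : L2} {a f b g : ℝ → ℝ} (ha : u =ᵐ[volume] a)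
    (hf : IsH1 a f) (hb : v =ᵐ[volume] b) (hg : IsH1 b g) :
    hessQ c k μ μ₁ μ₂ u v = hessForm c k μ μ₁ μ₂ a f b g := by
  refine integral_congr_ae ?_
  filter_upwards [ha, hb, weakDeriv_ae_eq (isWeakDeriv_congr hf.isWeakDeriv ha.symm .rfl),
    weakDeriv_ae_eq (isWeakDeriv_congr hg.isWeakDeriv hb.symm .rfl)] with x h1 h2 h3 h4
  simp only [hessDens, h1, h2, h3, h4, helmholtzInv_congr hb]

namespace SolitaryProfile

variable {c k : ℝ} {φ φ₁ μ μ₁ μ₂ μ₃ : ℝ → ℝ}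

theorem hessForm_comm (P : SolitaryProfile c k φ φ₁ μ μ₁ μ₂ μ₃) {u f v g : ℝ → ℝ}
    (hu : MemLp u 2) (hf : MemLp f 2) (hv : MemLp v 2) (hg : MemLp g 2) :
    hessForm c k μ μ₁ μ₂ u f v g = hessForm c k μ μ₁ μ₂ v g u f := by
  have i1 := P.integrable_hessDens hu hf hv hg
  have i2 := P.integrable_hessDens hv hg hu hf
  have j1 := integrable_mul_of_memLp hu (memLp_helmholtzInv hv)
  have j2 := integrable_mul_of_memLp hv (memLp_helmholtzInv hu)
  have e : (fun x => hessDens c k μ μ₁ μ₂ u f v g x - hessDens c k μ μ₁ μ₂ v g u f x) =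
      fun x => 2 * omega0 c k * (u x * helmholtzInv v x - v x * helmholtzInv u x) := by
    ext x; unfold hessDens; ring
  have s := integral_sub i1 i2
  rw [e, integral_const_mul, integral_sub j1 j2, integral_mul_helmholtzInv_comm hu hv, sub_self,
    mul_zero] at s
  exact (sub_eq_zero.1 s.symm)

theorem hessForm_add_left (P : SolitaryProfile c k φ φ₁ μ μ₁ μ₂ μ₃) {u f u' f' v g : ℝ → ℝ}
    (hu : MemLp u 2) (hf : MemLp f 2) (hu' : MemLp u' 2) (hf' : MemLp f' 2) (hv : MemLp v 2)
    (hg : MemLp g 2) :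
    hessForm c k μ μ₁ μ₂ (fun x => u x + u' x) (fun x => f x + f' x) v g =
      hessForm c k μ μ₁ μ₂ u f v g + hessForm c k μ μ₁ μ₂ u' f' v g := by
  unfold hessForm
  rw [← integral_add (P.integrable_hessDens hu hf hv hg) (P.integrable_hessDens hu' hf' hv hg)]
  congr 1 with x
  unfold hessDens
  ring

theorem hessForm_const_mul_left (t : ℝ) (u f v g : ℝ → ℝ) :
    hessForm c k μ μ₁ μ₂ (fun x => t * u x) (fun x => t * f x) v g =
      t * hessForm c k μ μ₁ μ₂ u f v g := by
  unfold hessForm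
  rw [← integral_const_mul]
  congr 1 with x
  unfold hessDens
  ring

/-- Gårding's inequality for the Hessian form. -/
theorem exists_garding (P : SolitaryProfile c k φ φ₁ μ μ₁ μ₂ μ₃) :
    ∃ α K, 0 < α ∧ 0 ≤ K ∧ ∀ h g : ℝ → ℝ, MemLp h 2 → MemLp g 2 →
      α * (∫ x, g x ^ 2) - K * (∫ x, h x ^ 2) ≤ hessForm c k μ μ₁ μ₂ h g h g := by
  obtain ⟨lo, hi, hlo, hb⟩ := P.bounds
  obtain ⟨-, C, hC⟩ := P.isBoundedContinuous_hessPotential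
  have hhi : 0 < hi := hlo.trans_le ((hb 0).1.trans (hb 0).2)
  refine ⟨2 * hi ^ (-(8 / 3) : ℝ), C + 2 * |omega0 c k|, by positivity,
    add_nonneg ((abs_nonneg _).trans (hC 0)) (by positivity), fun h g hh hg => ?_⟩
  have ih := integrable_sq_of_memLp hh
  have ig := integrable_sq_of_memLp hg
  have iG := (integrable_mul_of_memLp hh (memLp_helmholtzInv hh)).const_mul (2 * omega0 c k)
  have hG : |∫ x, h x * helmholtzInv h x| ≤ ∫ x, h x ^ 2 :=
    (abs_integral_mul_helmholtzInv_le hh hh).trans_eq (by ring)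
  have hG' : -(2 * |omega0 c k| * ∫ x, h x ^ 2) ≤ 2 * omega0 c k * ∫ x, h x * helmholtzInv h x := by
    refine (neg_le_neg ?_).trans (neg_abs_le _)
    rw [abs_mul, abs_mul, abs_of_pos (by norm_num : (0 : ℝ) < 2)]
    gcongr
  calc _ = 2 * hi ^ (-(8 / 3) : ℝ) * (∫ x, g x ^ 2) - C * (∫ x, h x ^ 2)
          - 2 * |omega0 c k| * ∫ x, h x ^ 2 := by ring
    _ ≤ 2 * hi ^ (-(8 / 3) : ℝ) * (∫ x, g x ^ 2) - C * (∫ x, h x ^ 2)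
          + 2 * omega0 c k * ∫ x, h x * helmholtzInv h x := by linarith
    _ = ∫ x, (2 * hi ^ (-(8 / 3) : ℝ) * g x ^ 2 - C * h x ^ 2
          + 2 * omega0 c k * (h x * helmholtzInv h x)) := by
        have s1 := integral_add ((ig.const_mul (2 * hi ^ (-(8 / 3) : ℝ))).sub (ih.const_mul C)) iG
        have s2 := integral_sub (ig.const_mul (2 * hi ^ (-(8 / 3) : ℝ))) (ih.const_mul C)
        simp only [Pi.sub_apply] at s1
        rw [s1, s2]
        simp only [integral_const_mul]
    _ ≤ _ := by
        refine integral_mono (((ig.const_mul _).sub (ih.const_mul C)).add iG)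
          (P.integrable_hessDens hh hg hh hg) fun x => ?_
        have h1 : hi ^ (-(8 / 3) : ℝ) ≤ μ x ^ (-(8 / 3) : ℝ) :=
          Real.rpow_le_rpow_of_nonpos (P.pos x) (hb x).2 (by norm_num)
        have h2 := mul_le_mul_of_nonneg_right h1 (sq_nonneg (g x))
        have h3 := mul_le_mul_of_nonneg_right (neg_le_of_abs_le (hC x)) (sq_nonneg (h x))
        simp only [hessDens, ← pow_two]
        linarith

theorem deriv_eq (P : SolitaryProfile c k φ φ₁ μ μ₁ μ₂ μ₃) : deriv μ = μ₁ :=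
  funext fun x => (P.hasDerivAt x).deriv

theorem iteratedDeriv_two_eq (P : SolitaryProfile c k φ φ₁ μ μ₁ μ₂ μ₃) :
    iteratedDeriv 2 μ = μ₂ := by
  rw [iteratedDeriv_succ, iteratedDeriv_one, P.deriv_eq]
  exact funext fun x => (P.hasDerivAt₁ x).deriv

/-- Regularity in the domain of the Hessian operator: the flux derivative that occurs in
`hessianGraph` is the classical expression in the first two derivatives. -/
theorem exists_of_mem_hessianGraph (P : SolitaryProfile c k φ φ₁ μ μ₁ μ₂ μ₃) {u f : L2}
    (h : (u, f) ∈ hessianGraph c k μ) :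
    ∃ a a₁ q : ℝ → ℝ, u =ᵐ[volume] a ∧ IsH1 a a₁ ∧
      IsH1 (fun x => μ x ^ (-(8 / 3) : ℝ) * a₁ x) q ∧
      f =ᵐ[volume] fun x => -2 * q x + hessPotential c k μ μ₁ μ₂ x * a x
        + 2 * omega0 c k * helmholtzInv a x := by
  obtain ⟨v₁, v₂, q, hv₁, hv₂, hd₁, hd₂, hq, he⟩ := h
  obtain ⟨a, ha, hua⟩ := hd₁.exists_isPrimitive
  obtain ⟨a₁, ha₁, hva⟩ := hd₂.exists_isPrimitive
  have hA₁ : IsH1 a₁ v₂ := ⟨ha₁, hv₁.ae_eq hva, hv₂⟩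
  have hA : IsH1 a a₁ := ⟨(isWeakDeriv_congr hd₁ hua hva).isPrimitive ha.continuous,
    memLp_of_ae_eq hua, hA₁.memLp⟩
  have hF := P.isH1_flux hA₁
  have hqF := (isWeakDeriv_congr hq (u' := fun x => μ x ^ (-(8 / 3) : ℝ) * a₁ x)
    (by filter_upwards [hva] with x hx; rw [hx]) .rfl).ae_unique hF.isWeakDeriv
  refine ⟨a, a₁, _, hua, hA, hF, ?_⟩
  filter_upwards [he, hqF, hua] with x h1 h2 h3
  rw [h1, h2, helmholtzInv_congr hua, h3, P.deriv_eq, P.iteratedDeriv_two_eq]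
  unfold hessPotential
  ring

/-- The Hessian form represents the Hessian operator. -/
theorem isFormOf (P : SolitaryProfile c k φ φ₁ μ μ₁ μ₂ μ₃) :
    ∃ K, IsFormOf (hessQ c k μ μ₁ μ₂) h1Submodule (hessianGraph c k μ) K := by
  obtain ⟨α, K, hα, -, hK⟩ := P.exists_garding
  refine ⟨K, ⟨?_, ?_, ?_, ?_, ?_, ?_⟩⟩
  · rintro u ⟨a, f, ha, hf⟩ v ⟨b, g, hb, hg⟩
    rw [hessQ_eq c k μ μ₁ μ₂ ha hf hb hg, hessQ_eq c k μ μ₁ μ₂ hb hg ha hf]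
    exact P.hessForm_comm hf.memLp hf.memLp_deriv hg.memLp hg.memLp_deriv
  · rintro u ⟨a, f, ha, hf⟩ v ⟨b, g, hb, hg⟩ w ⟨d, e, hd, he⟩
    rw [hessQ_eq c k μ μ₁ μ₂ ((Lp.coeFn_add u v).trans (ha.add hb)) (hf.add hg) hd he,
      hessQ_eq c k μ μ₁ μ₂ ha hf hd he, hessQ_eq c k μ μ₁ μ₂ hb hg hd he]
    exact P.hessForm_add_left hf.memLp hf.memLp_deriv hg.memLp hg.memLp_deriv he.memLp
      he.memLp_deriv
  · rintro t u ⟨a, f, ha, hf⟩ v ⟨b, g, hb, hg⟩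
    rw [hessQ_eq c k μ μ₁ μ₂ ((Lp.coeFn_smul t u).trans (ha.const_smul t)) (hf.const_mul t) hb hg,
      hessQ_eq c k μ μ₁ μ₂ ha hf hb hg]
    exact hessForm_const_mul_left t a f b g
  · rintro u ⟨a, f, ha, hf⟩
    rw [hessQ_eq c k μ μ₁ μ₂ ha hf ha hf, norm_sq_eq_integral ha]
    have := hK a f hf.memLp hf.memLp_deriv
    have h0 : 0 ≤ α * ∫ x, f x ^ 2 := mul_nonneg hα.le (integral_nonneg fun _ => sq_nonneg _)
    linarith
  · intro u f h
    obtain ⟨a, a₁, q, hua, hA, -, -⟩ := P.exists_of_mem_hessianGraph h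
    exact ⟨a, a₁, hua, hA⟩
  · rintro u f h v ⟨b, g, hb, hg⟩
    obtain ⟨a, a₁, q, hua, hA, hF, hf⟩ := P.exists_of_mem_hessianGraph h
    rw [hessQ_eq c k μ μ₁ μ₂ hb hg hua hA, inner_eq_integral hb hf]
    have i1 := integrable_mul_of_memLp hg.memLp hF.memLp_deriv
    have i2 := integrable_mul_of_memLp hg.memLp_deriv hF.memLp
    have i3 := P.isBoundedContinuous_hessPotential.integrable_mul hg.memLp hA.memLp
    have i4 := (integrable_mul_of_memLp hg.memLp (memLp_helmholtzInv hA.memLp)).const_mul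
      (2 * omega0 c k)
    have hI := hg.integral_mul_deriv hF
    have e1 : ∀ x, b x * (-2 * q x + hessPotential c k μ μ₁ μ₂ x * a x
        + 2 * omega0 c k * helmholtzInv a x) = -2 * (b x * q x)
        + (hessPotential c k μ μ₁ μ₂ x * (b x * a x)
        + 2 * omega0 c k * (b x * helmholtzInv a x)) := fun x => by ring
    have e2 : ∀ x, hessDens c k μ μ₁ μ₂ b g a a₁ x =
        2 * (g x * (μ x ^ (-(8 / 3) : ℝ) * a₁ x))
        + (hessPotential c k μ μ₁ μ₂ x * (b x * a x)
        + 2 * omega0 c k * (b x * helmholtzInv a x)) := fun x => by unfold hessDens; ring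
    have s1 := integral_add (i1.const_mul (-2)) (i3.add i4)
    have s2 := integral_add (i2.const_mul 2) (i3.add i4)
    simp only [Pi.add_apply] at s1 s2
    unfold hessForm
    simp only [e1, e2]
    rw [s1, s2, integral_const_mul, integral_const_mul, hI]
    ring

/-- Translation invariance: differentiating the Euler–Lagrange equation shows `𝓛 μ' = 0`. -/
theorem mem_hessianGraph_zero (P : SolitaryProfile c k φ φ₁ μ μ₁ μ₂ μ₃) :
    (P.memLp₁.toLp μ₁, (0 : L2)) ∈ hessianGraph c k μ := by
  have hF := P.isH1_flux P.isH1₂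
  have hu : P.memLp₁.toLp μ₁ =ᵐ[volume] μ₁ := P.memLp₁.coeFn_toLp
  refine ⟨μ₂, μ₃, _, P.memLp₂, P.memLp₃, isWeakDeriv_congr P.isH1₁.isWeakDeriv hu.symm .rfl,
    P.isH1₂.isWeakDeriv, hF.isWeakDeriv, ?_⟩
  filter_upwards [hu, Lp.coeFn_zero ℝ 2 (volume : Measure ℝ)] with x h1 h2
  rw [h2, h1, helmholtzInv_congr hu, P.helmholtz₁, P.deriv_eq, P.iteratedDeriv_two_eq]
  have hd := ((((P.hasDerivAt_profile x).const_mul (2 * omega0 c k)).add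
    ((P.hasDerivAt_rpow (-(1 / 3)) x).const_mul (2 / 3 * omega1 c k))).add
    (((P.hasDerivAt_rpow (-(11 / 3)) x).const_mul (8 / 3)).mul ((P.hasDerivAt₁ x).pow 2))).sub
    (((P.hasDerivAt_rpow (-(8 / 3)) x).const_mul 2).mul (P.hasDerivAt₂ x)) |>.sub
    ((P.hasDerivAt_rpow (-(5 / 3)) x).const_mul 6)
  have h0 := hd.unique ((hasDerivAt_const x (0 : ℝ)).congr_of_eventuallyEq
    (Eventually.of_forall P.euler))
  rw [show (-(1 / 3) - 1 : ℝ) = -(4 / 3) by norm_num,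
    show (-(11 / 3) - 1 : ℝ) = -(14 / 3) by norm_num,
    show (-(8 / 3) - 1 : ℝ) = -(11 / 3) by norm_num,
    show (-(5 / 3) - 1 : ℝ) = -(8 / 3) by norm_num] at h0
  simp only [Nat.cast_ofNat, Nat.add_one_sub_one, pow_one, Pi.pow_apply] at h0
  simp only [Pi.zero_apply]
  linear_combination -h0

theorem toLp_ne_zero (P : SolitaryProfile c k φ φ₁ μ μ₁ μ₂ μ₃) : P.memLp₁.toLp μ₁ ≠ 0 := by
  intro h
  have hu : P.memLp₁.toLp μ₁ =ᵐ[volume] μ₁ := P.memLp₁.coeFn_toLp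
  rw [h] at hu
  have h0 := ((Lp.coeFn_zero ℝ 2 (volume : Measure ℝ)).symm.trans hu)
  have := (continuous_zero.ae_eq_iff_eq volume P.continuous₁).1 h0
  obtain ⟨x, hx⟩ := P.nonconst
  exact hx (congrFun this x).symm

/-- Coercivity of the Hessian form in `H¹(ℝ)` on the `L²`-orthogonal complement of `μ'`, up to a
multiple of the square of the first variation of the constraint. -/
theorem exists_coercive (P : SolitaryProfile c k φ φ₁ μ μ₁ μ₂ μ₃) (hspec : SpectralAssumption c k μ)
    (hVK : VKCondition c k μ) :
    ∃ β Γ, 0 < β ∧ 0 ≤ Γ ∧ ∀ h g : ℝ → ℝ, IsH1 h g → ∫ x, h x * μ₁ x = 0 →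
      β * ((∫ x, h x ^ 2) + ∫ x, g x ^ 2) ≤
        hessForm c k μ μ₁ μ₂ h g h g + Γ * (∫ x, varF k μ x * h x) ^ 2 := by
  obtain ⟨ν, σ, hν, hσ, ⟨χν, hν0, hχν⟩, ⟨χ₀, -, hχ₀⟩, hG⟩ := hspec
  obtain ⟨K₀, hQ⟩ := P.isFormOf
  have hμ : P.memLp₁.toLp μ₁ =ᵐ[volume] μ₁ := P.memLp₁.coeFn_toLp
  have hη : P.memLp_varF.toLp (varF k μ) =ᵐ[volume] varF k μ := P.memLp_varF.coeFn_toLp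
  obtain ⟨t, ht⟩ := (hχ₀ (P.memLp₁.toLp μ₁)).1 (by rw [zero_smul]; exact P.mem_hessianGraph_zero)
  have ht0 : t ≠ 0 := by
    rintro rfl
    exact P.toLp_ne_zero (by rw [ht, zero_smul])
  have horth : ∀ w : L2, inner ℝ (P.memLp₁.toLp μ₁) w = 0 → inner ℝ χ₀ w = 0 := fun w hw => by
    rw [ht, real_inner_smul_left] at hw
    exact (mul_eq_zero.1 hw).resolve_left ht0
  obtain ⟨β, hβ, Γ, hΓ, hcoer⟩ := exists_coercive_of_spectrum hQ hν hσ (fun w h1 h2 h3 => by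
      by_contra hw
      rcases hG hw with h | h
      · exact h.elim h1 h2
      · exact absurd h3 (not_lt.2 h)) hν0 hχν hχ₀ (η := P.memLp_varF.toLp (varF k μ))
    (horth _ (by
      rw [inner_eq_integral hμ hη, ← P.varF_orthogonal]
      simp only [mul_comm]))
    (fun y hy => by
      rw [inner_eq_integral (Filter.EventuallyEq.refl _ _) hη]
      exact hVK y _ hy hη)
  obtain ⟨α, K, hα, hK, hgard⟩ := P.exists_garding
  have hM : 0 < K + 1 + β := by positivity
  refine ⟨β * min α 1 / (K + 1 + β), (K + 1) * Γ / (K + 1 + β), by positivity, by positivity,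
    fun h g hh h0 => ?_⟩
  have hu : hh.memLp.toLp h =ᵐ[volume] h := hh.memLp.coeFn_toLp
  have c1 := hcoer (hh.memLp.toLp h) ⟨h, g, hu, hh⟩ (horth _ (by
    rw [inner_eq_integral hμ hu, ← h0]
    simp only [mul_comm]))
  rw [hessQ_eq c k μ μ₁ μ₂ hu hh hu hh, norm_sq_eq_integral hu, inner_eq_integral hη hu] at c1
  have c2 := hgard h g hh.memLp hh.memLp_deriv
  have hH : 0 ≤ ∫ x, h x ^ 2 := integral_nonneg fun _ => sq_nonneg _
  have hg0 : 0 ≤ ∫ x, g x ^ 2 := integral_nonneg fun _ => sq_nonneg _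
  set S := ∫ x, h x ^ 2
  set T := ∫ x, g x ^ 2
  set Q := hessForm c k μ μ₁ μ₂ h g h g
  set e := (∫ x, varF k μ x * h x) ^ 2
  have k1 : min α 1 * T ≤ α * T := by gcongr; exact min_le_left _ _
  have k2 : min α 1 * S ≤ 1 * S := by gcongr; exact min_le_right _ _
  have key : β * min α 1 * (S + T) ≤ (K + 1 + β) * Q + (K + 1) * Γ * e := by
    have m1 := mul_le_mul_of_nonneg_left c1 (by positivity : 0 ≤ K + 1)
    have m2 := mul_le_mul_of_nonneg_left c2 hβ.le
    have m3 := mul_le_mul_of_nonneg_left k1 hβ.le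
    have m4 := mul_le_mul_of_nonneg_left k2 hβ.le
    linarith
  calc _ = β * min α 1 * (S + T) / (K + 1 + β) := by ring
    _ ≤ ((K + 1 + β) * Q + (K + 1) * Γ * e) / (K + 1 + β) := by gcongr
    _ = _ := by field_simp

end SolitaryProfile

/-! ### Translations in `H¹(ℝ)` -/

/-- The Cauchy–Schwarz inequality in `L²(ℝ)`. -/
theorem sq_integral_mul_le {u v : ℝ → ℝ} (hu : MemLp u 2) (hv : MemLp v 2) :
    (∫ x, u x * v x) ^ 2 ≤ (∫ x, u x ^ 2) * ∫ x, v x ^ 2 := by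
  rw [← inner_eq_integral hu.coeFn_toLp hv.coeFn_toLp, ← norm_sq_eq_integral hu.coeFn_toLp,
    ← norm_sq_eq_integral hv.coeFn_toLp, ← mul_pow, ← sq_abs]
  gcongr
  exact abs_real_inner_le_norm _ _

theorem memLp_comp_add_right {f : ℝ → ℝ} (hf : MemLp f 2) (s : ℝ) :
    MemLp (fun x => f (x + s)) 2 :=
  hf.comp_measurePreserving (measurePreserving_add_right volume s)

theorem integral_sq_comp_add_right (f : ℝ → ℝ) (s : ℝ) :
    ∫ x, f (x + s) ^ 2 = ∫ x, f x ^ 2 :=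
  integral_add_right_eq_self (fun x => f x ^ 2) s

/-- Correlating the difference quotient of an `H¹` function with `v ∈ L²(ℝ)`, by Fubini. -/
theorem IsH1.integral_translate_sub_mul {u f v : ℝ → ℝ} (hu : IsH1 u f) (hv : MemLp v 2) (s : ℝ) :
    ∫ x, (u (x + s) - u x) * v x = ∫ t in (0 : ℝ)..s, ∫ x, f (x + t) * v x := by
  have hf := hu.memLp_deriv
  have : IsFiniteMeasure (volume.restrict (uIoc 0 s)) :=
    ⟨by rw [Measure.restrict_apply_univ]; exact measure_Ioc_lt_top⟩
  have hprod : Integrable (Function.uncurry fun t x : ℝ => f (x + t) * v x)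
      ((volume.restrict (uIoc 0 s)).prod volume) := by
    have hmp : MeasurePreserving (fun z : ℝ × ℝ => (z.1, z.1 + z.2))
        ((volume.restrict (uIoc 0 s)).prod volume) ((volume.restrict (uIoc 0 s)).prod volume) :=
      measurePreserving_prod_add _ _
    have h1 : Integrable (fun z : ℝ × ℝ => f z.2 ^ 2)
        ((volume.restrict (uIoc 0 s)).prod volume) := (integrable_sq_of_memLp hf).comp_snd _
    have h1' := hmp.integrable_comp_of_integrable h1
    have h2 : Integrable (fun z : ℝ × ℝ => v z.2 ^ 2)
        ((volume.restrict (uIoc 0 s)).prod volume) := (integrable_sq_of_memLp hv).comp_snd _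
    have m1 : AEStronglyMeasurable (fun z : ℝ × ℝ => f (z.1 + z.2))
        ((volume.restrict (uIoc 0 s)).prod volume) :=
      (hf.1.comp_snd (μ := volume.restrict (uIoc 0 s))).comp_measurePreserving hmp
    have m2 : AEStronglyMeasurable (fun z : ℝ × ℝ => v z.2)
        ((volume.restrict (uIoc 0 s)).prod volume) := hv.1.comp_snd
    refine Integrable.mono' (h1'.add h2) ?_ (Eventually.of_forall fun z => ?_)
    · refine (m1.mul m2).congr (Eventually.of_forall fun z => ?_)
      simp [Function.uncurry_def, add_comm]
    · simp only [Function.uncurry_def, Pi.add_apply, Function.comp, Real.norm_eq_abs, abs_mul,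
        add_comm z.2]
      nlinarith [sq_nonneg (|f (z.1 + z.2)| - |v z.2|), sq_abs (f (z.1 + z.2)), sq_abs (v z.2),
        sq_nonneg (|f (z.1 + z.2)|), sq_nonneg (|v z.2|)]
  rw [intervalIntegral_integral_swap hprod]
  congr 1 with x
  rw [intervalIntegral.integral_mul_const,
    intervalIntegral.integral_comp_add_left (fun t => f t), add_zero, ← hu.sub_eq]

theorem IsH1.integral_translate_sub_sq_le {u f : ℝ → ℝ} (hu : IsH1 u f) (s : ℝ) :
    ∫ x, (u (x + s) - u x) ^ 2 ≤ s ^ 2 * ∫ x, f x ^ 2 := by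
  have hd : MemLp (fun x => u (x + s) - u x) 2 := (memLp_comp_add_right hu.memLp s).sub hu.memLp
  have hF : 0 ≤ ∫ x, f x ^ 2 := integral_nonneg fun _ => sq_nonneg _
  have hD : 0 ≤ ∫ x, (u (x + s) - u x) ^ 2 := integral_nonneg fun _ => sq_nonneg _
  have h := hu.integral_translate_sub_mul hd s
  simp only [← pow_two] at h
  have hb : ∀ t ∈ uIoc 0 s, ‖∫ x, f (x + t) * (u (x + s) - u x)‖ ≤
      √((∫ x, f x ^ 2) * ∫ x, (u (x + s) - u x) ^ 2) := fun t _ => by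
    rw [Real.norm_eq_abs, ← integral_sq_comp_add_right f t]
    exact Real.abs_le_sqrt (sq_integral_mul_le (memLp_comp_add_right hu.memLp_deriv t) hd)
  have hle := intervalIntegral.norm_integral_le_of_norm_le_const hb
  rw [← h, sub_zero, Real.norm_eq_abs, abs_of_nonneg hD] at hle
  set D := ∫ x, (u (x + s) - u x) ^ 2
  set F := ∫ x, f x ^ 2
  have h2 : D ^ 2 ≤ (F * D) * s ^ 2 := by
    rw [← Real.sq_sqrt (mul_nonneg hF hD), ← sq_abs s, ← mul_pow]
    gcongr
  rcases hD.eq_or_lt with h0 | h0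
  · rw [← h0]; positivity
  · nlinarith

theorem IsH1.continuous_integral_translate_mul {u f v : ℝ → ℝ} (hu : IsH1 u f) (hv : MemLp v 2) :
    Continuous fun s => ∫ x, u (x + s) * v x := by
  have hF : 0 ≤ ∫ x, f x ^ 2 := integral_nonneg fun _ => sq_nonneg _
  have hV : 0 ≤ ∫ x, v x ^ 2 := integral_nonneg fun _ => sq_nonneg _
  refine (LipschitzWith.of_dist_le_mul (K := ⟨√((∫ x, f x ^ 2) * ∫ x, v x ^ 2), Real.sqrt_nonneg _⟩)
    fun s t => ?_).continuous
  have hs := memLp_comp_add_right hu.memLp s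
  have ht := memLp_comp_add_right hu.memLp t
  rw [Real.dist_eq, Real.dist_eq, ← integral_sub (integrable_mul_of_memLp hs hv)
    (integrable_mul_of_memLp ht hv)]
  have e : ∀ x, u (x + s) * v x - u (x + t) * v x = (u (x + s) - u (x + t)) * v x := fun x => by
    ring
  simp only [e]
  have h1 := (hu.comp_add_right t).integral_translate_sub_sq_le (s - t)
  simp only [add_assoc, sub_add_cancel] at h1
  rw [integral_sq_comp_add_right] at h1
  have h2 := sq_integral_mul_le (hs.sub ht) hv
  simp only [Pi.sub_apply] at h2
  have h3 : (∫ x, (u (x + s) - u (x + t)) * v x) ^ 2 ≤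
      (s - t) ^ 2 * ((∫ x, f x ^ 2) * ∫ x, v x ^ 2) := by
    refine h2.trans ?_
    rw [← mul_assoc]
    gcongr
  refine (Real.abs_le_sqrt h3).trans_eq ?_
  rw [Real.sqrt_mul (sq_nonneg _), Real.sqrt_sq_eq_abs, mul_comm]
  rfl

theorem IsH1.h1Norm_sq_comp_add_right {u f : ℝ → ℝ} (hu : IsH1 u f) (s : ℝ) :
    h1Norm (fun x => u (x + s)) = h1Norm u := by
  rw [← sq_eq_sq₀ (h1Norm_nonneg _) (h1Norm_nonneg _), (hu.comp_add_right s).h1Norm_sq,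
    hu.h1Norm_sq, integral_sq_comp_add_right, integral_sq_comp_add_right]

theorem integral_add_sq_le {a b : ℝ → ℝ} (ha : MemLp a 2) (hb : MemLp b 2) :
    ∫ x, (a x + b x) ^ 2 ≤ 2 * (∫ x, a x ^ 2) + 2 * ∫ x, b x ^ 2 := by
  rw [← integral_const_mul, ← integral_const_mul,
    ← integral_add ((integrable_sq_of_memLp ha).const_mul 2)
      ((integrable_sq_of_memLp hb).const_mul 2)]
  refine integral_mono (integrable_sq_of_memLp (ha.add hb))
    (((integrable_sq_of_memLp ha).const_mul 2).add ((integrable_sq_of_memLp hb).const_mul 2))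
    fun x => ?_
  nlinarith [sq_nonneg (a x - b x)]

/-! ### Modulation and orbital stability -/

namespace SolitaryProfile

variable {c k : ℝ} {φ φ₁ μ μ₁ μ₂ μ₃ : ℝ → ℝ}

theorem integral_deriv_sq_pos (P : SolitaryProfile c k φ φ₁ μ μ₁ μ₂ μ₃) : 0 < ∫ x, μ₁ x ^ 2 := by
  rw [← norm_sq_eq_integral P.memLp₁.coeFn_toLp]
  have := norm_pos_iff.2 P.toLp_ne_zero
  positivity

/-- Near the wave, a small translation restores orthogonality to the kernel direction `μ'`: the
correlation `s ↦ ⟨μ(· + s) - μ, μ'⟩` has slope `‖μ'‖²` at `0`, so that it changes sign even after a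
small perturbation. -/
theorem exists_modulation (P : SolitaryProfile c k φ φ₁ μ μ₁ μ₂ μ₃) {ε : ℝ} (hε : 0 < ε) :
    ∃ δ, 0 < δ ∧ ∀ h g : ℝ → ℝ, IsH1 h g → (∫ x, h x ^ 2) + ∫ x, g x ^ 2 < δ →
      ∃ s, ∫ x, (μ (x + s) - μ x + h (x + s)) * μ₁ x = 0 ∧
        (∫ x, (μ (x + s) - μ x + h (x + s)) ^ 2)
          + ∫ x, (μ₁ (x + s) - μ₁ x + g (x + s)) ^ 2 < ε := by
  have hN := P.integral_deriv_sq_pos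
  have hN₂ : 0 ≤ ∫ x, μ₂ x ^ 2 := integral_nonneg fun _ => sq_nonneg _
  have hw := P.isH1
  have hw₁ := P.isH1₁
  have hA : ∀ s, ∫ x, (μ (x + s) - μ x) ^ 2 ≤ s ^ 2 * ∫ x, μ₁ x ^ 2 := fun s => by
    simpa using hw.integral_translate_sub_sq_le s
  have hA₁ := hw₁.integral_translate_sub_sq_le
  have hp : ∀ s, ∫ x, (μ (x + s) - μ x) * μ₁ x = ∫ t in (0 : ℝ)..s, ∫ x, μ₁ (x + t) * μ₁ x :=
    fun s => by simpa using hw.integral_translate_sub_mul P.memLp₁ s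
  have hr := hw₁.continuous_integral_translate_mul P.memLp₁
  have hrN : ∀ t, (∫ x, μ₁ x ^ 2) - t ^ 2 * (∫ x, μ₂ x ^ 2) / 2 ≤ ∫ x, μ₁ (x + t) * μ₁ x :=
    fun t => by
    have i1 := integrable_sq_of_memLp (memLp_comp_add_right P.memLp₁ t)
    have i2 := integrable_sq_of_memLp P.memLp₁
    have i3 := integrable_mul_of_memLp (memLp_comp_add_right P.memLp₁ t) P.memLp₁
    have e : ∀ x, (μ₁ (x + t) - μ₁ x) ^ 2 =
        μ₁ (x + t) ^ 2 + μ₁ x ^ 2 - 2 * (μ₁ (x + t) * μ₁ x) := fun x => by ring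
    have h1 := hA₁ t
    simp only [e] at h1
    have s1 := integral_sub (i1.add i2) (i3.const_mul 2)
    have s2 := integral_add i1 i2
    simp only [Pi.add_apply] at s1
    rw [s1, s2, integral_const_mul, integral_sq_comp_add_right] at h1
    linarith
  have hrpos : ∀ s, 0 ≤ s → ∀ a b, |a| ≤ s → |b| ≤ s → a ≤ b →
      s ^ 2 * (∫ x, μ₂ x ^ 2) ≤ ∫ x, μ₁ x ^ 2 →
      (b - a) * ((∫ x, μ₁ x ^ 2) / 2) ≤ ∫ t in a..b, ∫ x, μ₁ (x + t) * μ₁ x := by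
    intro s hs a b ha hb hab hsN
    rw [← smul_eq_mul, ← intervalIntegral.integral_const]
    refine intervalIntegral.integral_mono_on hab (by simp) (hr.intervalIntegrable _ _)
      fun t ht => ?_
    have h1 := hrN t
    have ht' : |t| ≤ s := abs_le.2 ⟨(neg_le_of_abs_le ha).trans ht.1, ht.2.trans (le_of_abs_le hb)⟩
    have h2 : t ^ 2 ≤ s ^ 2 := by rw [← sq_abs t]; gcongr
    have h3 := mul_le_mul_of_nonneg_right h2 hN₂
    linarith
  set N := ∫ x, μ₁ x ^ 2
  set N₂ := ∫ x, μ₂ x ^ 2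
  -- the first bound on `s²` keeps the slope above `‖μ'‖² / 2` on `[-s, s]`, the second one keeps
  -- the translates of `μ` within `ε`
  set s := √(min (N / (N₂ + 1)) (ε / (4 * (N + N₂ + 1)))) with hs
  have hmin : 0 < min (N / (N₂ + 1)) (ε / (4 * (N + N₂ + 1))) := by positivity
  have hs0 : 0 < s := Real.sqrt_pos.2 hmin
  have hs2 : s ^ 2 = min (N / (N₂ + 1)) (ε / (4 * (N + N₂ + 1))) := Real.sq_sqrt hmin.le
  have hs3 : s ^ 2 * N₂ ≤ N := by
    have : s ^ 2 ≤ N / (N₂ + 1) := hs2.trans_le (min_le_left _ _)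
    rw [le_div_iff₀ (by positivity)] at this
    nlinarith [sq_nonneg s]
  have hs4 : 2 * (s ^ 2 * (N + N₂)) ≤ ε / 2 := by
    have : s ^ 2 ≤ ε / (4 * (N + N₂ + 1)) := hs2.trans_le (min_le_right _ _)
    rw [le_div_iff₀ (by positivity)] at this
    nlinarith [sq_nonneg s]
  refine ⟨min (ε / 4) (s ^ 2 * N / 4), by positivity, fun h g hh hlt => ?_⟩
  have hH : 0 ≤ ∫ x, h x ^ 2 := integral_nonneg fun _ => sq_nonneg _
  have hG : 0 ≤ ∫ x, g x ^ 2 := integral_nonneg fun _ => sq_nonneg _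
  have hlt1 := hlt.trans_le (min_le_left _ _)
  have hlt2 := hlt.trans_le (min_le_right _ _)
  have mh := fun t => memLp_comp_add_right hh.memLp t
  have mw : ∀ t, MemLp (fun x => μ (x + t) - μ x) 2 := fun t => by
    refine ((memLp_comp_add_right hw.memLp t).sub hw.memLp).ae_eq (Eventually.of_forall fun x => ?_)
    simp
  have hsplit : ∀ t, ∫ x, (μ (x + t) - μ x + h (x + t)) * μ₁ x =
      (∫ x, (μ (x + t) - μ x) * μ₁ x) + ∫ x, h (x + t) * μ₁ x := fun t => by
    rw [← integral_add (integrable_mul_of_memLp (mw t) P.memLp₁)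
      (integrable_mul_of_memLp (mh t) P.memLp₁)]
    simp only [add_mul]
  have hcont : Continuous fun t => ∫ x, (μ (x + t) - μ x + h (x + t)) * μ₁ x := by
    simp only [hsplit, hp]
    exact (intervalIntegral.continuous_primitive (fun a b => hr.intervalIntegrable a b) 0).add
      (hh.continuous_integral_translate_mul P.memLp₁)
  have hsmall : ∀ t, |∫ x, h (x + t) * μ₁ x| ≤ s * (N / 2) := fun t => by
    refine abs_le_of_sq_le_sq ?_ (by positivity)
    refine (sq_integral_mul_le (mh t) P.memLp₁).trans ?_
    rw [integral_sq_comp_add_right]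
    have : ∫ x, h x ^ 2 ≤ s ^ 2 * N / 4 := by linarith
    calc _ ≤ s ^ 2 * N / 4 * N := by gcongr
      _ = _ := by ring
  have hneg : ∫ x, (μ (x + -s) - μ x + h (x + -s)) * μ₁ x ≤ 0 := by
    rw [hsplit, hp, intervalIntegral.integral_symm]
    have h1 := hrpos s hs0.le (-s) 0 (by rw [abs_neg, abs_of_pos hs0]) (by simpa using hs0.le)
      (by linarith) hs3
    have h2 := le_of_abs_le (hsmall (-s))
    linarith
  have hpos : 0 ≤ ∫ x, (μ (x + s) - μ x + h (x + s)) * μ₁ x := by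
    rw [hsplit, hp]
    have h1 := hrpos s hs0.le 0 s (by simpa using hs0.le) (abs_of_pos hs0).le hs0.le hs3
    have h2 := neg_le_of_abs_le (hsmall s)
    linarith
  obtain ⟨t, ht, ht0⟩ := intermediate_value_Icc (by linarith : -s ≤ s) hcont.continuousOn
    ⟨hneg, hpos⟩
  refine ⟨t, ht0, ?_⟩
  have ht2 : t ^ 2 ≤ s ^ 2 := sq_le_sq' ht.1 ht.2
  have k1 := integral_add_sq_le (mw t) (mh t)
  have k2 := integral_add_sq_le ((memLp_comp_add_right P.memLp₁ t).sub P.memLp₁)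
    (memLp_comp_add_right hh.memLp_deriv t)
  simp only [Pi.sub_apply] at k2
  rw [integral_sq_comp_add_right] at k1 k2
  have k3 := hA t
  have k4 := hA₁ t
  have k5 : t ^ 2 * (N + N₂) ≤ s ^ 2 * (N + N₂) := by gcongr
  linarith

/-- Orbital stability in energy form: on the constraint manifold the action controls the squared
distance to the orbit of the wave. -/
theorem exists_action_bound (P : SolitaryProfile c k φ φ₁ μ μ₁ μ₂ μ₃)
    (hspec : SpectralAssumption c k μ) (hVK : VKCondition c k μ) :
    ∃ δ : ℝ, 0 < δ ∧ ∃ C : ℝ, 0 < C ∧ ∀ m ∈ constraintManifold k μ, rho m μ < δ →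
      C * rho m μ ^ 2 ≤ Lambda c k m - Lambda c k μ := by
  obtain ⟨β, Γ, hβ, hΓ, hcoer⟩ := P.exists_coercive hspec hVK
  obtain ⟨C₁, hC₁, ε₁, hε₁, hexp⟩ := P.exists_regLambda_expansion
  obtain ⟨C₂, hC₂, ε₂, hε₂, hexpF⟩ := P.exists_regF_expansion
  -- the size of the neighbourhood: the cubic error of the action and the constraint term may each
  -- cost `β / 8` out of `β / 2`
  obtain ⟨e, he, he1, he2, he3, he4, he5⟩ : ∃ e : ℝ, 0 < e ∧ e ≤ ε₁ ∧ e ≤ ε₂ ∧ e ≤ 1 ∧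
      C₁ * e ≤ β / 8 ∧ Γ * C₂ ^ 2 * e ≤ β / 4 := by
    have h : ∀ a b : ℝ, 0 ≤ a → 0 < b → ∀ e ≤ b / (a + 1), 0 < e → a * e ≤ b := by
      intro a b ha hb e he h0
      rw [le_div_iff₀ (by positivity)] at he
      nlinarith
    refine ⟨min (min ε₁ ε₂) (min 1 (min (β / 8 / (C₁ + 1)) (β / 4 / (Γ * C₂ ^ 2 + 1)))),
      by positivity, (min_le_left _ _).trans (min_le_left _ _),
      (min_le_left _ _).trans (min_le_right _ _), (min_le_right _ _).trans (min_le_left _ _),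
      h _ _ hC₁ (by positivity) _ (((min_le_right _ _).trans (min_le_right _ _)).trans
        (min_le_left _ _)) (by positivity),
      h _ _ (by positivity) (by positivity) _ (((min_le_right _ _).trans (min_le_right _ _)).trans
        (min_le_right _ _)) (by positivity)⟩
  obtain ⟨δ, hδ, hmod⟩ := P.exists_modulation (ε := e ^ 2) (by positivity)
  refine ⟨√δ, Real.sqrt_pos.2 hδ, β / 4, by positivity, fun m hm hρ => ?_⟩
  obtain ⟨hmX, hmF⟩ := hm
  obtain ⟨v, f, hv, hpos, rfl⟩ := exists_isH1_of_mem_Xspace hmX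
  have hw := P.isH1
  have hwk : (fun x => μ x - k + k) = μ := funext fun x => sub_add_cancel _ _
  have hposw : ∀ x, 0 < μ x - k + k := fun x => by rw [sub_add_cancel]; exact P.pos x
  have hF := (hw.constraintF_eq P.k_pos hposw).2
  have hΛ := (hw.Lambda_eq P.k_pos hposw P.euler_const).2
  rw [hwk] at hF hΛ
  rw [(hv.constraintF_eq P.k_pos hpos).2, hF] at hmF
  rw [(hv.Lambda_eq P.k_pos hpos P.euler_const).2, hΛ]
  -- all translates of the difference have the norms that enter `rho`
  have hnorm : ∀ y, h1Norm (fun x => v x + k - μ (x - y)) ^ 2 =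
      (∫ x, (v (x + y) - (μ x - k)) ^ 2) + ∫ x, (f (x + y) - μ₁ x) ^ 2 := fun y => by
    have hd := (hv.comp_add_right y).sub hw
    rw [← hd.h1Norm_sq, ← hd.h1Norm_sq_comp_add_right (-y)]
    congr 2 with x
    rw [neg_add_cancel_right, sub_eq_add_neg x y]
    ring
  obtain ⟨x₀, hx₀⟩ := exists_lt_of_ciInf_lt hρ
  have hx₀' : h1Norm (fun x => v x + k - μ (x - x₀)) ^ 2 < δ := by
    rw [← Real.sq_sqrt hδ.le]
    exact pow_lt_pow_left₀ hx₀ (h1Norm_nonneg _) two_ne_zero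
  rw [hnorm] at hx₀'
  obtain ⟨s, horth, hsmall⟩ := hmod _ _ ((hv.comp_add_right x₀).sub hw) hx₀'
  have hh := (hv.comp_add_right (s + x₀)).sub hw
  have e1 : ∀ x, μ (x + s) - μ x + (v (x + s + x₀) - (μ (x + s) - k)) =
      v (x + (s + x₀)) - (μ x - k) := fun x => by rw [add_assoc]; ring
  have e2 : ∀ x, μ₁ (x + s) - μ₁ x + (f (x + s + x₀) - μ₁ (x + s)) =
      f (x + (s + x₀)) - μ₁ x := fun x => by rw [add_assoc]; ring
  simp only [e1] at horth hsmall
  simp only [e2] at hsmall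
  set h := fun x => v (x + (s + x₀)) - (μ x - k) with hh_def
  set g := fun x => f (x + (s + x₀)) - μ₁ x with hg_def
  have hρle : rho (fun x => v x + k) μ ^ 2 ≤ (∫ x, h x ^ 2) + ∫ x, g x ^ 2 := by
    rw [← hnorm]
    have h0 : 0 ≤ rho (fun x => v x + k) μ := Real.iInf_nonneg fun _ => h1Norm_nonneg _
    have h1 : rho (fun x => v x + k) μ ≤ h1Norm (fun x => v x + k - μ (x - (s + x₀))) :=
      ciInf_le ⟨0, by rintro _ ⟨y, rfl⟩; exact h1Norm_nonneg _⟩ (s + x₀)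
    exact pow_le_pow_left₀ h0 h1 2
  have hsup : ∀ x, |h x| ≤ e := fun x =>
    abs_le_of_sq_le_sq ((hh.sq_le x).trans hsmall.le) he.le
  have hvw : (fun x => μ x - k + h x) = fun x => v (x + (s + x₀)) := by
    ext x; simp only [hh_def]; ring
  have hfw : (fun x => μ₁ x + g x) = fun x => f (x + (s + x₀)) := by
    ext x; simp only [hg_def]; ring
  have x1 := hexp h g hh e he1 hsup
  have x2 := hexpF h g hh fun x => (hsup x).trans he2
  rw [hvw, hfw, regLambda_comp_add_right] at x1
  rw [hvw, regF_comp_add_right, hmF, sub_self, zero_sub, abs_neg] at x2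
  have x3 := hcoer h g hh horth
  have hH : 0 ≤ ∫ x, h x ^ 2 := integral_nonneg fun _ => sq_nonneg _
  have hG : 0 ≤ ∫ x, g x ^ 2 := integral_nonneg fun _ => sq_nonneg _
  set T := (∫ x, h x ^ 2) + ∫ x, g x ^ 2
  have hT : 0 ≤ T := by positivity
  have x4 : (∫ x, varF k μ x * h x) ^ 2 ≤ C₂ ^ 2 * e * T := by
    rw [← sq_abs]
    calc _ ≤ (C₂ * T) ^ 2 := by
          gcongr
          exact x2.trans (mul_le_mul_of_nonneg_left (by linarith) hC₂)
      _ = C₂ ^ 2 * (T * T) := by ring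
      _ ≤ C₂ ^ 2 * (e * T) := by
          gcongr
          nlinarith
      _ = _ := by ring
  have x5 := mul_le_mul_of_nonneg_left x4 hΓ
  have x6 := mul_le_mul_of_nonneg_right he5 hT
  have x7 := mul_le_mul_of_nonneg_right he4 hT
  have x8 := neg_le_of_abs_le x1
  calc _ ≤ β / 4 * T := by gcongr
    _ ≤ _ := by linarith

end SolitaryProfile

end Novikov

end

theorem propositionP (c k : ℝ) (hc : 0 < c) (hk : 0 < k) (hkc : k < Real.sqrt c / 2)
    (φ : ℝ → ℝ) (hφ : Novikov.IsSmoothSolitaryWave c k φ)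
    (hspec : Novikov.SpectralAssumption c k (Novikov.momentum φ))
    (hVK : Novikov.VKCondition c k (Novikov.momentum φ)) :
    (∀ m ∈ Novikov.Xspace k,
      Novikov.ImproperlyIntegrable (Novikov.densF k m) ∧
      Novikov.ImproperlyIntegrable (Novikov.densLambda c k m)) ∧
    ∃ δ : ℝ, 0 < δ ∧ ∃ C : ℝ, 0 < C ∧
      ∀ m ∈ Novikov.constraintManifold k (Novikov.momentum φ),
        Novikov.rho m (Novikov.momentum φ) < δ →
          C * Novikov.rho m (Novikov.momentum φ) ^ 2 ≤
            Novikov.Lambda c k m - Novikov.Lambda c k (Novikov.momentum φ) := by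
  have hkc4 := Novikov.sq_lt_of_lt_sqrt hc hk hkc
  have P := hφ.solitaryProfile hc hk hkc4
  refine ⟨fun m hm => ?_, P.exists_action_bound hspec hVK⟩
  obtain ⟨v, f, hv, hpos, rfl⟩ := Novikov.exists_isH1_of_mem_Xspace hm
  exact ⟨(hv.constraintF_eq hk hpos).1, (hv.Lambda_eq hk hpos P.euler_const).1⟩
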